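/- Let $N\in\mathbb N$ and let $s,\gamma\in(0,1]$ satisfy $N>2s$, $\gamma\ge s-\frac12$ and $N\ge N_{s,\gamma}$, where $N_{s,\gamma}=4s$ if $\gamma<2s$ and $N_{s,\gamma}=4s(1+\gamma)-\gamma$ if $\gamma\ge 2s$. Let $\Omega\subset\mathbb R^N$ be a bounded domain with $C^2$ boundary and $\delta(x)=\operatorname{dist}(x,\partial\Omega)$. Let $\mathcal L:C_c^\infty(\Omega)\to L^2(\Omega)$ be a linear, positive, symmetric operator and $\mathcal B(\varphi,\psi)=\int_\Omega\varphi\,\mathcal L\psi\,dx$. Let $\mathbb H(\Omega)\subset L^2(\Omega)$ be the completion of $C_c^\infty(\Omega)$ for the norm $\|\varphi\|_{L^2(\Omega)}+\sqrt{\mathcal B(\varphi,\varphi)}$, and let $\langle\cdot,\cdot\rangle_{\mathbb H(\Omega)}$ be the continuous extension of $\mathcal B$ to $\mathbb H(\Omega)$. Denote also by $\mathcal L$ the self-adjoint extension defined by this form: $u\in\operatorname{dom}\mathcal L$ and $\mathcal Lu=g\in L^2(\Omega)$ if and only if $u\in\mathbb H(\Omega)$ and $\langle u,\xi\rangle_{\mathbb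 H(\Omega)}=\int_\Omega g\xi\,dx$ for all $\xi\in\mathbb H(\Omega)$. Assume: * $\mathbb H(\Omega)=H^s_{00}(\Omega):=\{u\in H^s(\Omega): u/\delta^s\in L^2(\Omega)\}$ (for $s=1$ this is $H^1_0(\Omega)$). * $\mathcal L$ admits a Green function: there is a measurable, symmetric kernel $G^\Omega:\Omega\times\Omega\setminus\{(x,x):x\in\Omega\}\to(0,\infty)$ and a constant $C>0$ such that, for all $x\ne y$ in $\Omega$, $$C^{-1}\Gamma(x,y)\le G^\Omega(x,y)\le C\,\Gamma(x,y),\qquad \Gamma(x,y)=\frac{1}{|x-y|^{N-2s}}\Big(\frac{\delta(x)}{|x-y|}\wedge1\Big)^{\gamma}\Big(\frac{\delta(y)}{|x-y|}\wedge1\Big)^{\gamma},$$ and for every $f\in C_c^\infty(\Omega)$ the solution of $\mathcal Lu=f$ is $u=\mathbb G^\Omega[f]:=\int_\Omega G^\Omega(\cdot,y)f(y)\,dy$. Let $1<p<p^*:=\frac{N+\gamma}{N+\gamma-2s}$ and let $\mu$ be a positive Radon measure on $\Omega$ with $\int_\Omega\delta^\gamma\,d\mu=1$. For $\lambda>0$,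 a positive weak-dual solution of $$\mathcal Lu=u^p+\lambda\mu\ \text{ in }\Omega\quad\text{(with homogeneous boundary condition)}$$ is a measurable function $u>0$ a.e. in $\Omega$ with $\int_\Omega u^p\delta^\gamma dx<\infty$ and $$\int_\Omega u\,\xi\,dx=\int_\Omega u^p\,\mathbb G^\Omega[\xi]\,dx+\lambda\int_\Omega\mathbb G^\Omega[\xi]\,d\mu\qquad\text{for all }\xi\in\delta^\gamma L^\infty(\Omega).$$ It is minimal, and then denoted $\underline u_\lambda$, if it is a.e. less than or equal to every positive weak-dual solution for the same $\lambda$. Let $$\lambda^*=\sup\{\lambda>0:\text{ a positive weak-dual solution exists}\}.$$ **Theorem.** Let $\lambda\in(0,\lambda^*)$. Then the minimal positive weak-dual solution $\underline u_\lambda$ exists, and the problem $$\mathcal Lv=(\underline u_\lambda+v^+)^p-\underline u_\lambda^{\,p}\ \text{ in }\Omega\quad\text{(with homogeneous boundary condition)}$$ has a nontrivial variational solution: there is $v\in\mathbb H(\Omega)$, $v\neq0$, such that for all $\xi\in\mathbb H(\Omega)$ the function $\big[(\underline u_\lambda+v^+)^p-\underline u_\lambda^{\,p}\big]\xi$ is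 integrable on $\Omega$ and $$\langle v,\xi\rangle_{\mathbb H(\Omega)}=\int_\Omega\big[(\underline u_\lambda+v^+)^p-\underline u_\lambda^{\,p}\big]\,\xi\,dx .$$ -/

import Mathlib

open MeasureTheory Filter Topology

noncomputable section

namespace GreenSemilinear

/-! ### Domain, test functions, `L²` -/

/-- `ℝ^N` with its Euclidean norm. -/
abbrev Eucl (N : ℕ) : Type := EuclideanSpace ℝ (Fin N)

/-- `C_c^∞(Ω)` (real-valued). -/
abbrev Test {N : ℕ} (Ω : TopologicalSpace.Opens (Eucl N)) : Type := TestFunction Ω ℝ ⊤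

/-- `L²(Ω)` with respect to Lebesgue measure. -/
abbrev L2 {N : ℕ} (Ω : TopologicalSpace.Opens (Eucl N)) : Type :=
  Lp ℝ 2 (volume.restrict (Ω : Set (Eucl N)))

/-- The distance to the boundary, `δ(x) = dist(x, ∂Ω)`. -/
def bdist {N : ℕ} (Ω : TopologicalSpace.Opens (Eucl N)) (x : Eucl N) : ℝ :=
  Metric.infDist x (frontier (Ω : Set (Eucl N)))

/-- Bounded domains (nonempty connected open sets) with `C²` boundary: near each boundary point,
`Ω` is the sublevel set `{ψ < 0}` of a `C²` function with nonvanishing differential there. -/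
structure IsBoundedC2Domain {N : ℕ} (Ω : TopologicalSpace.Opens (Eucl N)) : Prop where
  connected : IsConnected (Ω : Set (Eucl N))
  bounded : Bornology.IsBounded (Ω : Set (Eucl N))
  boundary : ∀ x ∈ frontier (Ω : Set (Eucl N)), ∃ (U : Set (Eucl N)) (ψ : Eucl N → ℝ),
    IsOpen U ∧ x ∈ U ∧ ContDiffOn ℝ 2 ψ U ∧ fderiv ℝ ψ x ≠ 0 ∧
      ∀ y ∈ U, (y ∈ Ω ↔ ψ y < 0)

theorem test_memLp {N : ℕ} {Ω : TopologicalSpace.Opens (Eucl N)} (φ : Test Ω) :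
    MemLp (φ : Eucl N → ℝ) 2 (volume.restrict (Ω : Set (Eucl N))) :=
  (φ.continuous.memLp_of_hasCompactSupport φ.hasCompactSupport).restrict _

/-- The inclusion `C_c^∞(Ω) → L²(Ω)`. -/
def testToL2 {N : ℕ} (Ω : TopologicalSpace.Opens (Eucl N)) : Test Ω →ₗ[ℝ] L2 Ω where
  toFun φ := (test_memLp φ).toLp (φ : Eucl N → ℝ)
  map_add' _ _ := rfl
  map_smul' _ _ := rfl

/-! ### Operators `𝓛 : C_c^∞(Ω) → L²(Ω)`, their quadratic forms and the extended operator -/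

/-- The bilinear form `𝓑(φ, ψ) = ∫_Ω φ 𝓛ψ dx` on `C_c^∞(Ω)`. -/
def form {N : ℕ} {Ω : TopologicalSpace.Opens (Eucl N)} (L : Test Ω →ₗ[ℝ] L2 Ω) :
    LinearMap.BilinForm ℝ (Test Ω) :=
  (innerₗ (L2 Ω)).compl₁₂ (testToL2 Ω) L

/-- `𝓛 : C_c^∞(Ω) ⊂ L²(Ω) → L²(Ω)` is a positive, symmetric operator. -/
structure IsPositiveSymmetric {N : ℕ} {Ω : TopologicalSpace.Opens (Eucl N)}
    (L : Test Ω →ₗ[ℝ] L2 Ω) : Prop where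
  symm : ∀ φ ψ, form L φ ψ = form L ψ φ
  nonneg : ∀ φ, 0 ≤ form L φ φ

/-- The test functions `φ n` are a Cauchy sequence for the norm `‖·‖_{L²} + √𝓑(·,·)`,
with `L²`-limit `u`. -/
def FormApprox {N : ℕ} {Ω : TopologicalSpace.Opens (Eucl N)} (L : Test Ω →ₗ[ℝ] L2 Ω)
    (φ : ℕ → Test Ω) (u : L2 Ω) : Prop :=
  Tendsto (fun n => testToL2 Ω (φ n)) atTop (𝓝 u) ∧
    ∀ ε > 0, ∃ n₀, ∀ m ≥ n₀, ∀ n ≥ n₀, form L (φ m - φ n) (φ m - φ n) < ε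

/-- `ℍ(Ω)`: the completion of `C_c^∞(Ω)` for the norm `‖·‖_{L²} + √𝓑(·,·)`, realised inside `L²(Ω)`
(see `form_tendsto_formInner` for the fact that the realisation is faithful). -/
def formDomain {N : ℕ} {Ω : TopologicalSpace.Opens (Eucl N)} (L : Test Ω →ₗ[ℝ] L2 Ω) :
    Set (L2 Ω) :=
  {u | ∃ φ, FormApprox L φ u}

open Classical in
/-- Some approximating sequence of `u ∈ ℍ(Ω)`. -/
def approxSeq {N : ℕ} {Ω : TopologicalSpace.Opens (Eucl N)} (L : Test Ω →ₗ[ℝ] L2 Ω) (u : L2 Ω) :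
    ℕ → Test Ω :=
  if h : ∃ φ, FormApprox L φ u then h.choose else 0

/-- The inner product `⟨u, v⟩_ℍ = 𝓑(u, v)` of `ℍ(Ω)`: the extension of `𝓑` by continuity. -/
def formInner {N : ℕ} {Ω : TopologicalSpace.Opens (Eucl N)} (L : Test Ω →ₗ[ℝ] L2 Ω)
    (u v : L2 Ω) : ℝ :=
  limUnder atTop fun n => form L (approxSeq L u n) (approxSeq L v n)

/-- `u ∈ dom 𝓛` and `𝓛 u = g`, where `𝓛` now is the self-adjoint (Friedrichs) extension, that is,
the operator of the closed form `⟨·,·⟩_ℍ`. -/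
def ExtendedOp {N : ℕ} {Ω : TopologicalSpace.Opens (Eucl N)} (L : Test Ω →ₗ[ℝ] L2 Ω)
    (u g : L2 Ω) : Prop :=
  u ∈ formDomain L ∧ ∀ ξ ∈ formDomain L, formInner L u ξ = inner ℝ g ξ

end GreenSemilinear

end

namespace GreenSemilinear

variable {N : ℕ} {Ω : TopologicalSpace.Opens (Eucl N)} {L : Test Ω →ₗ[ℝ] L2 Ω}

theorem form_sub_self (hL : IsPositiveSymmetric L) (a b : Test Ω) :
    form L (a - b) (a - b) = form L a a - 2 * form L a b + form L b b := by
  simp only [map_sub, LinearMap.sub_apply]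
  rw [hL.symm b a]; ring

theorem form_add_le (hL : IsPositiveSymmetric L) (a b : Test Ω) :
    form L (a + b) (a + b) ≤ 2 * form L a a + 2 * form L b b := by
  have h := hL.nonneg (a - b)
  rw [form_sub_self hL] at h
  simp only [map_add, LinearMap.add_apply]
  rw [hL.symm b a]; linarith

/-- Closability. -/
theorem form_tendsto_zero (hL : IsPositiveSymmetric L) {d : ℕ → Test Ω} (hd : FormApprox L d 0) :
    Tendsto (fun n => form L (d n) (d n)) atTop (𝓝 0) := by
  rw [Metric.tendsto_atTop]
  intro ε hε
  obtain ⟨n₀, h⟩ := hd.2 (ε / 2) (by positivity)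
  refine ⟨n₀, fun n hn => ?_⟩
  have h1 : Tendsto (fun m => form L (d m) (d n)) atTop (𝓝 0) := by
    have := (hd.1.inner (tendsto_const_nhds (x := L (d n)) (f := atTop)) (𝕜 := ℝ))
    simpa [form] using this
  have h2 : form L (d n) (d n) ≤ ε / 2 + 2 * 0 := by
    refine ge_of_tendsto ((h1.const_mul 2).const_add (ε / 2)) ?_
    filter_upwards [eventually_ge_atTop n₀] with m hm
    have h3 := h n hn m hm
    rw [form_sub_self hL, hL.symm (d n) (d m)] at h3
    have := hL.nonneg (d m)
    linarith
  rw [Real.dist_eq, sub_zero, abs_of_nonneg (hL.nonneg _)]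
  linarith

theorem FormApprox.sub (hL : IsPositiveSymmetric L) {φ ψ : ℕ → Test Ω} {u v : L2 Ω}
    (h : FormApprox L φ u) (h' : FormApprox L ψ v) :
    FormApprox L (fun n => φ n - ψ n) (u - v) := by
  refine ⟨by simpa using h.1.sub h'.1, fun ε hε => ?_⟩
  obtain ⟨n₁, h₁⟩ := h.2 (ε / 4) (by positivity)
  obtain ⟨n₂, h₂⟩ := h'.2 (ε / 4) (by positivity)
  refine ⟨max n₁ n₂, fun m hm n hn => ?_⟩
  have e : φ m - ψ m - (φ n - ψ n) = (φ m - φ n) + (ψ n - ψ m) := by abel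
  have a₁ := h₁ m (le_of_max_le_left hm) n (le_of_max_le_left hn)
  have a₂ := h₂ n (le_of_max_le_right hn) m (le_of_max_le_right hm)
  have := form_add_le hL (φ m - φ n) (ψ n - ψ m)
  rw [e]; linarith

theorem form_cauchySchwarz (hL : IsPositiveSymmetric L) (a b : Test Ω) :
    form L a b ^ 2 ≤ form L a a * form L b b :=
  LinearMap.BilinForm.apply_sq_le_of_symm (form L) hL.nonneg ⟨fun x y => hL.symm x y⟩ a b

theorem abs_form_le (hL : IsPositiveSymmetric L) {a b : Test Ω} {ε M : ℝ} (hε : 0 ≤ ε) (hM : 0 ≤ M)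
    (ha : form L a a ≤ ε ^ 2) (hb : form L b b ≤ M ^ 2) : |form L a b| ≤ ε * M := by
  refine abs_le_of_sq_le_sq ?_ (by positivity)
  calc form L a b ^ 2 ≤ _ := form_cauchySchwarz hL a b
    _ ≤ ε ^ 2 * M ^ 2 := mul_le_mul ha hb (hL.nonneg b) (by positivity)
    _ = (ε * M) ^ 2 := by ring

theorem FormApprox.bounded (hL : IsPositiveSymmetric L) {φ : ℕ → Test Ω} {u : L2 Ω}
    (h : FormApprox L φ u) : ∃ M > 0, ∀ᶠ n in atTop, form L (φ n) (φ n) ≤ M ^ 2 := by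
  obtain ⟨n₀, h₀⟩ := h.2 1 one_pos
  have h1 := hL.nonneg (φ n₀)
  refine ⟨2 * form L (φ n₀) (φ n₀) + 2, by linarith, ?_⟩
  filter_upwards [eventually_ge_atTop n₀] with n hn
  have h2 := form_add_le hL (φ n - φ n₀) (φ n₀)
  rw [sub_add_cancel] at h2
  have := h₀ n hn n₀ le_rfl
  nlinarith

theorem form_tendsto_of_diff (hL : IsPositiveSymmetric L) {φ φ' ψ ψ' : ℕ → Test Ω} {u v : L2 Ω}
    (h : FormApprox L φ u) (h' : FormApprox L φ' u) (k : FormApprox L ψ v)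
    (k' : FormApprox L ψ' v) :
    Tendsto (fun n => form L (φ n) (ψ n) - form L (φ' n) (ψ' n)) atTop (𝓝 0) := by
  have z := form_tendsto_zero hL (by simpa using h.sub hL h')
  have z' := form_tendsto_zero hL (by simpa using k.sub hL k')
  obtain ⟨M, hM, hb⟩ := k.bounded hL
  obtain ⟨M', hM', hb'⟩ := h'.bounded hL
  rw [Metric.tendsto_atTop']
  intro ε hε
  have e₁ : 0 < (ε / (4 * M)) ^ 2 := by positivity
  have e₂ : 0 < (ε / (4 * M')) ^ 2 := by positivity
  have := (((z.eventually (gt_mem_nhds e₁)).and (z'.eventually (gt_mem_nhds e₂))).and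
    (hb.and hb'))
  obtain ⟨n₀, hn₀⟩ := eventually_atTop.1 this
  refine ⟨n₀, fun n hn => ?_⟩
  obtain ⟨⟨b₁, b₂⟩, b₃, b₄⟩ := hn₀ n hn.le
  have c₁ := abs_form_le hL (by positivity) hM.le b₁.le b₃
  have c₂ := abs_form_le hL (by positivity) hM'.le b₂.le b₄
  have q₁ : ε / (4 * M) * M = ε / 4 := by field_simp
  have q₂ : ε / (4 * M') * M' = ε / 4 := by field_simp
  have e : form L (φ n) (ψ n) - form L (φ' n) (ψ' n)
      = form L (φ n - φ' n) (ψ n) + form L (ψ n - ψ' n) (φ' n) := by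
    simp only [map_sub, LinearMap.sub_apply]
    rw [hL.symm (ψ n) (φ' n), hL.symm (ψ' n) (φ' n)]; ring
  rw [Real.dist_eq, sub_zero, e]
  have := abs_add_le (form L (φ n - φ' n) (ψ n)) (form L (ψ n - ψ' n) (φ' n))
  linarith

theorem form_cauchySeq (hL : IsPositiveSymmetric L) {φ ψ : ℕ → Test Ω} {u v : L2 Ω}
    (h : FormApprox L φ u) (k : FormApprox L ψ v) :
    CauchySeq fun n => form L (φ n) (ψ n) := by
  obtain ⟨M, hM, hb⟩ := k.bounded hL
  obtain ⟨M', hM', hb'⟩ := h.bounded hL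
  obtain ⟨n₀, hn₀⟩ := eventually_atTop.1 (hb.and hb')
  rw [Metric.cauchySeq_iff]
  intro ε hε
  obtain ⟨n₁, h₁⟩ := h.2 ((ε / (4 * M)) ^ 2) (by positivity)
  obtain ⟨n₂, h₂⟩ := k.2 ((ε / (4 * M')) ^ 2) (by positivity)
  refine ⟨max n₀ (max n₁ n₂), fun m hm n hn => ?_⟩
  simp only [ge_iff_le, max_le_iff] at hm hn
  have c₁ := abs_form_le hL (by positivity) hM.le (h₁ m hm.2.1 n hn.2.1).le (hn₀ m hm.1).1
  have c₂ := abs_form_le hL (by positivity) hM'.le (h₂ m hm.2.2 n hn.2.2).le (hn₀ n hn.1).2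
  have q₁ : ε / (4 * M) * M = ε / 4 := by field_simp
  have q₂ : ε / (4 * M') * M' = ε / 4 := by field_simp
  have e : form L (φ m) (ψ m) - form L (φ n) (ψ n)
      = form L (φ m - φ n) (ψ m) + form L (ψ m - ψ n) (φ n) := by
    simp only [map_sub, LinearMap.sub_apply]
    rw [hL.symm (ψ m) (φ n), hL.symm (ψ n) (φ n)]; ring
  rw [Real.dist_eq, e]
  have := abs_add_le (form L (φ m - φ n) (ψ m)) (form L (ψ m - ψ n) (φ n))
  linarith

theorem formApprox_approxSeq {u : L2 Ω} (hu : u ∈ formDomain L) :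
    FormApprox L (approxSeq L u) u := by
  have hu' : ∃ φ, FormApprox L φ u := hu
  rw [approxSeq, dif_pos hu']
  exact hu'.choose_spec

/-- For a positive symmetric operator, `formInner` is the limit of `𝓑` along every pair of
approximating sequences. -/
theorem form_tendsto_formInner (hL : IsPositiveSymmetric L) {φ ψ : ℕ → Test Ω} {u v : L2 Ω}
    (h : FormApprox L φ u) (k : FormApprox L ψ v) :
    Tendsto (fun n => form L (φ n) (ψ n)) atTop (𝓝 (formInner L u v)) := by
  have hu := formApprox_approxSeq (L := L) (u := u) ⟨φ, h⟩
  have hv := formApprox_approxSeq (L := L) (u := v) ⟨ψ, k⟩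
  have t : Tendsto (fun n => form L (approxSeq L u n) (approxSeq L v n)) atTop
      (𝓝 (formInner L u v)) := tendsto_nhds_limUnder
      (cauchySeq_tendsto_of_complete (form_cauchySeq hL hu hv))
  have := (form_tendsto_of_diff hL h hu k hv).add t
  simpa using this

end GreenSemilinear

noncomputable section

namespace GreenSemilinear

/-! ### The Green kernel -/

/-- `𝔾^Ω[f](x) = ∫_Ω G(x, y) f(y) dy`. -/
def greenOp {N : ℕ} (Ω : TopologicalSpace.Opens (Eucl N)) (G : Eucl N → Eucl N → ℝ)
    (f : Eucl N → ℝ) (x : Eucl N) : ℝ :=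
  ∫ y in (Ω : Set (Eucl N)), G x y * f y

/-- The comparison function
`|x-y|^{-(N-2s)} (δ(x)/|x-y| ∧ 1)^γ (δ(y)/|x-y| ∧ 1)^γ`. -/
def greenProfile {N : ℕ} (Ω : TopologicalSpace.Opens (Eucl N)) (s γ : ℝ) (x y : Eucl N) : ℝ :=
  1 / ‖x - y‖ ^ ((N : ℝ) - 2 * s) * min (bdist Ω x / ‖x - y‖) 1 ^ γ
    * min (bdist Ω y / ‖x - y‖) 1 ^ γ

/-- `G` is the Green function of `𝓛`: a positive symmetric (Borel) kernel off the diagonal of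
`Ω × Ω`, comparable to `greenProfile`, such that for every `f ∈ C_c^∞(Ω)` the solution of
`𝓛 u = f` with homogeneous boundary condition is `𝔾^Ω[f]`, `𝓛` being the extended operator
(uniqueness of that solution is then automatic: the extension is self-adjoint and its range
contains the dense set `C_c^∞(Ω)`). Values of `G` on the diagonal and
outside `Ω × Ω` play no role. -/
structure IsGreenFunction {N : ℕ} {Ω : TopologicalSpace.Opens (Eucl N)}
    (L : Test Ω →ₗ[ℝ] L2 Ω) (s γ : ℝ) (G : Eucl N → Eucl N → ℝ) : Prop where
  measurable : Measurable (Function.uncurry G)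
  pos : ∀ x ∈ Ω, ∀ y ∈ Ω, x ≠ y → 0 < G x y
  symm : ∀ x ∈ Ω, ∀ y ∈ Ω, x ≠ y → G x y = G y x
  estimate : ∃ C > 0, ∀ x ∈ Ω, ∀ y ∈ Ω, x ≠ y →
    C⁻¹ * greenProfile Ω s γ x y ≤ G x y ∧ G x y ≤ C * greenProfile Ω s γ x y
  solves : ∀ f : Test Ω, ∃ u : L2 Ω,
    u =ᵐ[volume.restrict (Ω : Set (Eucl N))] greenOp Ω G f ∧ ExtendedOp L u (testToL2 Ω f)

/-! ### The space `H^s_{00}(Ω)` -/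

/-- `u ∈ H^s(Ω)` for `u ∈ L²(Ω)`: finite Gagliardo seminorm if `s < 1`, weak first order
derivatives in `L²(Ω)` if `s = 1`. -/
def MemHs {N : ℕ} {Ω : TopologicalSpace.Opens (Eucl N)} (s : ℝ) (u : L2 Ω) : Prop :=
  if s < 1 then
    ∫⁻ x in (Ω : Set (Eucl N)), ∫⁻ y in (Ω : Set (Eucl N)),
      ENNReal.ofReal ((u x - u y) ^ 2 / ‖x - y‖ ^ ((N : ℝ) + 2 * s)) < ⊤
  else
    ∀ i : Fin N, ∃ g : L2 Ω, ∀ φ : Test Ω,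
      ∫ x in (Ω : Set (Eucl N)), u x * fderiv ℝ φ x (EuclideanSpace.single i 1)
        = - ∫ x in (Ω : Set (Eucl N)), g x * φ x

/-- `H^s_{00}(Ω) = {u ∈ H^s(Ω) : u / δ^s ∈ L²(Ω)}`; for `s = 1` and a bounded `C²` domain, this
is `H^1_0(Ω)`. -/
def Hs00 {N : ℕ} (Ω : TopologicalSpace.Opens (Eucl N)) (s : ℝ) : Set (L2 Ω) :=
  {u | MemHs s u ∧
    ∫⁻ x in (Ω : Set (Eucl N)), ENNReal.ofReal ((u x / bdist Ω x ^ s) ^ 2) < ⊤}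

/-! ### Exponents -/

/-- `p^* = (N + γ) / (N + γ - 2s)`. -/
def pStar (N : ℕ) (s γ : ℝ) : ℝ := ((N : ℝ) + γ) / ((N : ℝ) + γ - 2 * s)

/-- `N_{s,γ}`. -/
def Nsγ (s γ : ℝ) : ℝ := if γ < 2 * s then 4 * s else 4 * s * (1 + γ) - γ

/-! ### Weak-dual solutions of `𝓛 u = u^p + λ μ` and the threshold `λ^*` -/

/-- `μ` is a positive Radon measure on `Ω` with `‖μ‖_{𝓜(Ω,δ^γ)} = ∫_Ω δ^γ dμ = 1`
(finiteness on compact subsets of `Ω` follows). -/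
def IsUnitWeightedMeasure {N : ℕ} (Ω : TopologicalSpace.Opens (Eucl N)) (γ : ℝ)
    (μ : Measure (Eucl N)) : Prop :=
  ∫⁻ x in (Ω : Set (Eucl N)), ENNReal.ofReal (bdist Ω x ^ γ) ∂μ = 1

/-- `u > 0` a.e. is a weak-dual solution of `𝓛 u = u^p + λ μ` with homogeneous boundary condition:
`u ∈ L^p(Ω, δ^γ)` and `∫ u ξ = ∫ u^p 𝔾[ξ] + λ ∫ 𝔾[ξ] dμ` for all `ξ = δ^γ w`, `w ∈ L^∞(Ω)`. -/
structure IsPositiveWeakDualSolution {N : ℕ} (Ω : TopologicalSpace.Opens (Eucl N)) (γ p : ℝ)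
    (G : Eucl N → Eucl N → ℝ) (μ : Measure (Eucl N)) (lam : ℝ) (u : Eucl N → ℝ) : Prop where
  measurable : AEStronglyMeasurable u (volume.restrict (Ω : Set (Eucl N)))
  pos : ∀ᵐ x ∂volume.restrict (Ω : Set (Eucl N)), 0 < u x
  integrable : IntegrableOn (fun x => |u x| ^ p * bdist Ω x ^ γ) (Ω : Set (Eucl N)) volume
  eq : ∀ w : Eucl N → ℝ, MemLp w ⊤ (volume.restrict (Ω : Set (Eucl N))) →
    ∫ x in (Ω : Set (Eucl N)), u x * (bdist Ω x ^ γ * w x)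
      = (∫ x in (Ω : Set (Eucl N)), u x ^ p * greenOp Ω G (fun y => bdist Ω y ^ γ * w y) x)
        + lam * ∫ x in (Ω : Set (Eucl N)), greenOp Ω G (fun y => bdist Ω y ^ γ * w y) x ∂μ

/-- `u` is the minimal positive weak-dual solution `u̲_λ`. -/
def IsMinimalSolution {N : ℕ} (Ω : TopologicalSpace.Opens (Eucl N)) (γ p : ℝ)
    (G : Eucl N → Eucl N → ℝ) (μ : Measure (Eucl N)) (lam : ℝ) (u : Eucl N → ℝ) : Prop :=
  IsPositiveWeakDualSolution Ω γ p G μ lam u ∧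
    ∀ w, IsPositiveWeakDualSolution Ω γ p G μ lam w →
      ∀ᵐ x ∂volume.restrict (Ω : Set (Eucl N)), u x ≤ w x

/-- `λ^* = sup {λ > 0 : there is a positive weak-dual solution}`, as a supremum in `[-∞, ∞]`. -/
def lamStar {N : ℕ} (Ω : TopologicalSpace.Opens (Eucl N)) (γ p : ℝ)
    (G : Eucl N → Eucl N → ℝ) (μ : Measure (Eucl N)) : EReal :=
  sSup ((fun t : ℝ => (t : EReal)) ''
    {t : ℝ | 0 < t ∧ ∃ u, IsPositiveWeakDualSolution Ω γ p G μ t u})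

/-! ### Variational solutions -/

/-- `v ∈ ℍ(Ω)` is a variational solution of `𝓛 v = h(·, v)`:
`⟨v, ξ⟩_ℍ = ∫_Ω h(x, v(x)) ξ(x) dx` for all `ξ ∈ ℍ(Ω)`, the integrals being convergent. -/
def IsVariationalSolution {N : ℕ} {Ω : TopologicalSpace.Opens (Eucl N)}
    (L : Test Ω →ₗ[ℝ] L2 Ω) (h : Eucl N → ℝ → ℝ) (v : L2 Ω) : Prop :=
  v ∈ formDomain L ∧ ∀ ξ ∈ formDomain L,
    IntegrableOn (fun x => h x (v x) * ξ x) (Ω : Set (Eucl N)) volume ∧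
      formInner L v ξ = ∫ x in (Ω : Set (Eucl N)), h x (v x) * ξ x

end GreenSemilinear

end

/-! Weak-dual solutions are the fixed points of U ↦ 𝔾[U^p + λμ]. As λ < λ^*, there is a solution w
for some λ' > λ. With θ = λ/λ' < 1, the function θw is a supersolution for λ, because θ^p ≤ θ. Hence
the monotone iteration started at 0 stays below θw and converges to the minimal solution u
(`exists_isMinimalSolution`).

The gap u ≤ θw yields strict stability. The difference z = w - u satisfies z ≥ 𝔾[w^p - u^p] ≥ (1+ε)
𝔾[p u^(p-1) z], since secant slopes of the p-th power exceed the tangent slope at u by a fixed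
factor when u ≤ θw (`rpow_sub_rpow_ge`). Schur's test with the weight p u^(p-1) z, followed by
duality, turns this into ∫ p u^(p-1) h² ≤ (1+ε)⁻¹ ‖h‖² on ℍ (`integral_le_of_supersolution`).

The nonlinear terms are finite on ℍ although u is only in L^p(δ^γ). If J is the inclusion of ℍ into
L², the Green operator is J J†, so ‖J† f‖² = ∫ f 𝔾[f], and upper bounds on Green energies are dual
to embeddings of ℍ. Young's inequality for the kernel δ(x)^a δ(y)^a |x-y|^(-(N-2s+2a)) with a =
γ(p-1)/(2p) gives ℍ ⊂ L^{2p}(Ω, δ^(-γ(p-1))) (`exists_weighted_bound`); the p-th power of the Riesz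
factor is locally integrable exactly when p < p^*. Pairing this space with u^p δ^γ ∈ L¹ controls ∫
u^(p-1) h² + |h|^(p+1). Compactness of ℍ → L², combined with a truncation of u, makes this quantity
tend to 0 along weakly null sequences (`exists_tendsto_nlWeight`).

The solution is a mountain-pass point of ‖h‖²/2 - ∫ F(u, h), found without a deformation lemma or a
Palais–Smale condition. Let c be the infimum over all rays of the supremum of the action on the ray.
The primitive F is convex, and also convex in the square of the radial variable, because F'(t)/t is
increasing; so the action is concave in t² on every ray. A minimising sequence of unit directions
has a weak limit k whose ray stays at or below the level c, and stability gives c > 0. The maximum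
point v of that ray has level c. If the derivative at v did not vanish, a small displacement of v
would produce a ray lying strictly below c: near v by convexity of the potential, away from v by
concavity in t² (`le_of_minimax`). -/

noncomputable section

namespace GreenSemilinear

open scoped ENNReal
open ContinuousLinearMap (adjoint)

section Pointwise

/-! ### The nonlinearity `(u + t⁺)^p - u^p` and its primitive -/

/-- The nonlinearity `t ↦ (u + t⁺)^p - u^p`. -/
def nl (p u t : ℝ) : ℝ := (u + max t 0) ^ p - u ^ p

/-- The primitive of `nl p u` that vanishes at `0`. -/
def nlPrim (p u t : ℝ) : ℝ :=
  ((u + max t 0) ^ (p + 1) - u ^ (p + 1)) / (p + 1) - u ^ p * max t 0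

/-- The density of the energy that controls the nonlinear terms. -/
def nlWeight (p u a : ℝ) : ℝ := u ^ (p - 1) * a ^ 2 + |a| ^ (p + 1)

/-- Bernoulli's inequality for y/x - 1, multiplied by x^q. -/
theorem rpow_tangent_le {q x y : ℝ} (hq : 1 ≤ q) (hx : 0 < x) (hy : 0 ≤ y) :
    x ^ q + q * x ^ (q - 1) * (y - x) ≤ y ^ q := by
  have h := one_add_mul_self_le_rpow_one_add (s := y / x - 1)
    (by have : 0 ≤ y / x := by positivity
        linarith) hq
  have h1 : (1 + (y / x - 1)) = y / x := by ring
  rw [h1, Real.div_rpow hy hx.le, le_div_iff₀ (by positivity)] at h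
  have h2 : x ^ q = x ^ (q - 1) * x := by
    rw [← Real.rpow_add_one hx.ne', sub_add_cancel]
  calc x ^ q + q * x ^ (q - 1) * (y - x) = (1 + q * (y / x - 1)) * x ^ q := by
        rw [h2]; field_simp
    _ ≤ _ := h

theorem rpow_superadd {q x y : ℝ} (hq : 1 ≤ q) (hx : 0 ≤ x) (hy : 0 ≤ y) :
    x ^ q + y ^ q ≤ (x + y) ^ q :=
  Real.add_rpow_le_rpow_add hx hy hq

variable {p u : ℝ}

theorem nl_of_nonpos {t : ℝ} (ht : t ≤ 0) : nl p u t = 0 := by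
  simp [nl, max_eq_right ht]

theorem nlPrim_of_nonpos {t : ℝ} (ht : t ≤ 0) : nlPrim p u t = 0 := by
  simp [nlPrim, max_eq_right ht]

theorem nl_mono (hp : 1 < p) (hu : 0 ≤ u) {a b : ℝ} (h : a ≤ b) : nl p u a ≤ nl p u b := by
  have : max a 0 ≤ max b 0 := max_le_max_right 0 h
  have h0 : 0 ≤ max a 0 := le_max_right _ _
  unfold nl
  gcongr

theorem nl_nonneg (hp : 1 < p) (hu : 0 ≤ u) (t : ℝ) : 0 ≤ nl p u t := by
  have h := nl_mono hp hu (min_le_left t 0)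
  rwa [nl_of_nonpos (min_le_right t 0)] at h

theorem nlPrim_max (t : ℝ) : nlPrim p u (max t 0) = nlPrim p u t := by simp [nlPrim]

/-- Convexity of the primitive: for nonnegative arguments it is the tangent inequality for the power
p + 1. Passing to positive parts costs nothing, since the slope vanishes for a ≤ 0 and is
nonnegative otherwise. -/
theorem nlPrim_tangent (hp : 1 < p) (hu : 0 < u) (a b : ℝ) :
    nlPrim p u a + nl p u a * (b - a) ≤ nlPrim p u b := by
  have hA : 0 ≤ max a 0 := le_max_right _ _
  have hB : 0 ≤ max b 0 := le_max_right _ _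
  have h1 : nl p u a * (b - a) ≤ nl p u a * (max b 0 - max a 0) := by
    rcases le_total a 0 with h | h
    · simp [nl_of_nonpos h]
    · have := nl_nonneg hp hu.le a
      rw [max_eq_left h]
      gcongr
      exact le_max_left _ _
  have h2 := rpow_tangent_le (q := p + 1) (x := u + max a 0) (y := u + max b 0)
    (by linarith) (by linarith) (by linarith)
  rw [add_sub_cancel_right] at h2
  have h3 : (u + max a 0) ^ (p + 1) / (p + 1) + (u + max a 0) ^ p * (max b 0 - max a 0)
      ≤ (u + max b 0) ^ (p + 1) / (p + 1) := by
    rw [le_div_iff₀ (by linarith), add_mul, div_mul_cancel₀ _ (by linarith)]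
    linarith
  have h4 : nl p u a * (max b 0 - max a 0)
      = (u + max a 0) ^ p * (max b 0 - max a 0) - u ^ p * (max b 0 - max a 0) := by
    unfold nl; ring
  refine (add_le_add_right h1 _).trans ?_
  rw [h4]
  unfold nlPrim
  rw [sub_div, sub_div]
  linarith

theorem nlPrim_nonneg (hp : 1 < p) (hu : 0 < u) (t : ℝ) : 0 ≤ nlPrim p u t := by
  have h := nlPrim_tangent hp hu 0 t
  simpa [nl_of_nonpos, nlPrim_of_nonpos] using h

theorem nlPrim_le (hp : 1 < p) (hu : 0 < u) (t : ℝ) : nlPrim p u t ≤ nl p u t * t := by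
  have h := nlPrim_tangent hp hu t 0
  rw [nlPrim_of_nonpos le_rfl] at h
  linarith

theorem nl_lower (hp : 1 < p) (hu : 0 ≤ u) (t : ℝ) : max t 0 ^ p ≤ nl p u t := by
  have := rpow_superadd hp.le hu (le_max_right t 0)
  unfold nl; linarith

/-- The tangent at half of t⁺ already yields the power p + 1. This growth beats the quadratic part
of the action along rays. -/
theorem nlPrim_lower (hp : 1 < p) (hu : 0 < u) (t : ℝ) :
    (max t 0 / 2) ^ (p + 1) ≤ nlPrim p u t := by
  have h0 : 0 ≤ max t 0 / 2 := by have := le_max_right t 0; positivity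
  have h := nlPrim_tangent hp hu (max t 0 / 2) (max t 0)
  rw [nlPrim_max] at h
  have h1 := nlPrim_nonneg hp hu (max t 0 / 2)
  have h2 := nl_lower hp hu.le (max t 0 / 2)
  rw [max_eq_left h0] at h2
  have h3 : (max t 0 / 2) ^ (p + 1) = (max t 0 / 2) ^ p * (max t 0 / 2) :=
    Real.rpow_add_one' h0 (by linarith)
  rw [h3]
  have h4 := mul_le_mul_of_nonneg_right h2 h0
  linarith

theorem add_rpow_le_two_rpow {q x y : ℝ} (hq : 0 ≤ q) (hx : 0 ≤ x) (hy : 0 ≤ y) :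
    (x + y) ^ q ≤ 2 ^ q * (x ^ q + y ^ q) := by
  have hm : x + y ≤ 2 * max x y := by
    have := le_max_left x y
    have := le_max_right x y
    linarith
  calc (x + y) ^ q ≤ (2 * max x y) ^ q := by gcongr
    _ = 2 ^ q * max x y ^ q := Real.mul_rpow (by norm_num) (hx.trans (le_max_left _ _))
    _ ≤ _ := by
      gcongr
      rcases max_choice x y with h | h <;> rw [h]
      · linarith [Real.rpow_nonneg hy q]
      · linarith [Real.rpow_nonneg hx q]

/-- The increment of the p-th power is at most its slope at the far endpoint u + t times t. -/
theorem nl_upper (hp : 1 < p) (hu : 0 < u) (t : ℝ) :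
    nl p u t ≤ p * 2 ^ (p - 1) * (u ^ (p - 1) * |t| + |t| ^ p) := by
  rcases le_total t 0 with ht | ht
  · rw [nl_of_nonpos ht]; positivity
  rw [abs_of_nonneg ht]
  have h := rpow_tangent_le (q := p) (x := u + t) (y := u) hp.le (by linarith) hu.le
  have h2 := add_rpow_le_two_rpow (q := p - 1) (by linarith) hu.le ht
  have h3 : t ^ p = t ^ (p - 1) * t := by
    have := Real.rpow_add_one' (x := t) (y := p - 1) ht (by linarith)
    rwa [sub_add_cancel] at this
  unfold nl
  rw [max_eq_left ht]
  have h4 : p * (u + t) ^ (p - 1) * t ≤ p * (2 ^ (p - 1) * (u ^ (p - 1) + t ^ (p - 1))) * t := by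
    gcongr
  calc (u + t) ^ p - u ^ p ≤ p * (u + t) ^ (p - 1) * t := by linarith
    _ ≤ _ := h4
    _ = _ := by rw [h3]; ring

/-- Convexity of the p-th power between u and u + a⁺. It says that `nl` divided by its radial
variable is nondecreasing; the strict version below gives convexity in the square of that variable.
-/
theorem nl_smul_le (hp : 1 < p) (hu : 0 < u) {t a : ℝ} (ht : 0 ≤ t) (ht1 : t ≤ 1) :
    nl p u (t * a) ≤ t * nl p u a := by
  have hA : 0 ≤ max a 0 := le_max_right _ _
  have hm : max (t * a) 0 = t * max a 0 := by
    rw [mul_max_of_nonneg _ _ ht, mul_zero]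
  have h := (convexOn_rpow hp.le).2 (Set.mem_Ici.2 hu.le)
    (show u + max a 0 ∈ Set.Ici 0 by simp only [Set.mem_Ici]; linarith)
    (show 0 ≤ 1 - t by linarith) ht (by ring)
  simp only [smul_eq_mul] at h
  unfold nl
  rw [hm]
  have e : (1 - t) * u + t * (u + max a 0) = u + t * max a 0 := by ring
  rw [e] at h
  linarith

theorem nl_smul_lt (hp : 1 < p) (hu : 0 < u) {t a : ℝ} (ht : 0 < t) (ht1 : t < 1) (ha : 0 < a) :
    nl p u (t * a) < t * nl p u a := by
  have h := (strictConvexOn_rpow hp).2 (Set.mem_Ici.2 hu.le)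
    (show u + a ∈ Set.Ici 0 by simp only [Set.mem_Ici]; linarith) (by linarith)
    (show 0 < 1 - t by linarith) ht (by ring)
  simp only [smul_eq_mul] at h
  unfold nl
  rw [max_eq_left ha.le, max_eq_left (by positivity)]
  have e : (1 - t) * u + t * (u + a) = u + t * a := by ring
  rw [e] at h
  linarith

/-- `nlPrim p u √·` is strictly convex. -/
theorem nlPrim_sq_tangent_lt (hp : 1 < p) (hu : 0 < u) {b c : ℝ} (hb : 0 ≤ b) (hc : 0 < c)
    (hbc : b ≠ c) :
    nlPrim p u c + nl p u c / (2 * c) * (b ^ 2 - c ^ 2) < nlPrim p u b := by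
  -- This k makes c a critical point of φ, and strict monotonicity of nl(x)/x makes φ decrease
  -- before c and increase after it.
  set k := nl p u c / (2 * c) with hk
  let φ : ℝ → ℝ := fun b => ((u + b) ^ (p + 1) - u ^ (p + 1)) / (p + 1) - u ^ p * b - k * b ^ 2
  have hφ : ∀ x, 0 ≤ x → φ x = nlPrim p u x - k * x ^ 2 := fun x hx => by
    simp only [φ, nlPrim, max_eq_left hx]
  have hd : ∀ x, 0 ≤ x → HasDerivAt φ ((u + x) ^ p - u ^ p - k * (2 * x)) x := by
    intro x hx
    have h1 : HasDerivAt (fun b => (u + b) ^ (p + 1)) ((p + 1) * (u + x) ^ p) x := by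
      have := ((hasDerivAt_id x).const_add u).rpow_const (p := p + 1) (Or.inr (by linarith))
      simpa using this
    have h2 := ((h1.sub_const (u ^ (p + 1))).div_const (p + 1)).sub
      ((hasDerivAt_id x).const_mul (u ^ p))
    have h3 := h2.sub ((hasDerivAt_pow 2 x).const_mul k)
    have hp1 : p + 1 ≠ 0 := by linarith
    have e : (p + 1) * (u + x) ^ p / (p + 1) - u ^ p * 1 - k * ((2 : ℕ) * x ^ (2 - 1))
        = (u + x) ^ p - u ^ p - k * (2 * x) := by
      rw [mul_div_cancel_left₀ _ hp1]
      simp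
    rw [← e]
    exact h3
  have hcont : ∀ s : Set ℝ, s ⊆ Set.Ici 0 → ContinuousOn φ s := fun s hs x hx =>
    (hd x (hs hx)).continuousAt.continuousWithinAt
  have hnl : ∀ x, 0 ≤ x → (u + x) ^ p - u ^ p = nl p u x := fun x hx => by
    simp only [nl, max_eq_left hx]
  have main : φ c < φ b := by
    rcases lt_or_gt_of_ne hbc with h | h
    · refine strictAntiOn_of_deriv_neg (convex_Icc 0 c) (hcont _ fun x hx => hx.1) ?_
        ⟨hb, h.le⟩ ⟨hc.le, le_rfl⟩ h
      intro x hx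
      rw [interior_Icc] at hx
      rw [(hd x hx.1.le).deriv, hnl x hx.1.le]
      have h1 := nl_smul_lt hp hu (t := x / c) (a := c) (by have := hx.1; positivity)
        (by rw [div_lt_one hc]; exact hx.2) hc
      rw [div_mul_cancel₀ _ hc.ne'] at h1
      have : k * (2 * x) = x / c * nl p u c := by rw [hk]; field_simp
      linarith
    · refine strictMonoOn_of_deriv_pos (convex_Ici c) (hcont _ fun x hx => hc.le.trans hx) ?_
        (Set.mem_Ici.2 le_rfl) (Set.mem_Ici.2 h.le) h
      intro x hx
      rw [interior_Ici] at hx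
      have hx0 : 0 < x := hc.trans hx
      rw [(hd x hx0.le).deriv, hnl x hx0.le]
      have h1 := nl_smul_lt hp hu (t := c / x) (a := x) (by positivity)
        (by rw [div_lt_one hx0]; exact hx) hx0
      rw [div_mul_cancel₀ _ hx0.ne'] at h1
      have h2 : k * (2 * x) = x / c * nl p u c := by rw [hk]; field_simp
      have h3 : x / c * nl p u c < x / c * (c / x * nl p u x) := by gcongr
      have h4 : x / c * (c / x * nl p u x) = nl p u x := by field_simp
      linarith
  rw [hφ c hc.le, hφ b hb] at main
  linarith

theorem nlPrim_sq_tangent (hp : 1 < p) (hu : 0 < u) {b c : ℝ} (hb : 0 ≤ b) (hc : 0 < c) :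
    nlPrim p u c + nl p u c / (2 * c) * (b ^ 2 - c ^ 2) ≤ nlPrim p u b := by
  rcases eq_or_ne b c with rfl | h
  · simp
  · exact (nlPrim_sq_tangent_lt hp hu hb hc h).le

/-- Convexity in the square of the radial variable. -/
theorem nlPrim_ray (hp : 1 < p) (hu : 0 < u) {t s : ℝ} (ht : 0 ≤ t) (hs : 0 < s) (a : ℝ) :
    nlPrim p u (s * a) + (t ^ 2 - s ^ 2) / (2 * s) * (nl p u (s * a) * a)
      ≤ nlPrim p u (t * a) := by
  rcases le_or_gt a 0 with ha | ha
  · rw [nlPrim_of_nonpos (mul_nonpos_of_nonneg_of_nonpos hs.le ha),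
      nlPrim_of_nonpos (mul_nonpos_of_nonneg_of_nonpos ht ha),
      nl_of_nonpos (mul_nonpos_of_nonneg_of_nonpos hs.le ha)]
    simp
  · have h := nlPrim_sq_tangent hp hu (b := t * a) (c := s * a) (by positivity) (by positivity)
    convert h using 2
    field_simp

theorem nlPrim_ray_lt (hp : 1 < p) (hu : 0 < u) {t s a : ℝ} (ht : 0 ≤ t) (hs : 0 < s) (hts : t ≠ s)
    (ha : 0 < a) :
    nlPrim p u (s * a) + (t ^ 2 - s ^ 2) / (2 * s) * (nl p u (s * a) * a)
      < nlPrim p u (t * a) := by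
  have h := nlPrim_sq_tangent_lt hp hu (b := t * a) (c := s * a) (by positivity) (by positivity)
    (fun h => hts (mul_right_cancel₀ ha.ne' h))
  convert h using 2
  field_simp

theorem nl_div_tendsto (hu : 0 < u) (a : ℝ) :
    Tendsto (fun t : ℝ => nl p u (t * a) / t) (𝓝[>] 0)
      (𝓝 (p * u ^ (p - 1) * max a 0)) := by
  have hd : HasDerivAt (fun t : ℝ => (u + t * max a 0) ^ p) (p * u ^ (p - 1) * max a 0) 0 := by
    have := (((hasDerivAt_id (0 : ℝ)).mul_const (max a 0)).const_add u).rpow_const (p := p)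
      (Or.inl (by simp [hu.ne']))
    have e : (1 : ℝ) * max a 0 * p * (u + id 0 * max a 0) ^ (p - 1)
        = p * u ^ (p - 1) * max a 0 := by
      rw [id, zero_mul, add_zero]; ring
    rw [← e]
    exact this
  have := hd.tendsto_slope_zero_right
  refine this.congr' ?_
  filter_upwards [self_mem_nhdsWithin] with t ht
  have ht : 0 < t := ht
  have hm : max (t * a) 0 = t * max a 0 := by rw [mul_max_of_nonneg _ _ ht.le, mul_zero]
  simp [nl, hm, div_eq_inv_mul]

theorem nlWeight_nonneg (hu : 0 < u) (a : ℝ) : 0 ≤ nlWeight p u a := by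
  unfold nlWeight; positivity

theorem nlWeight_smul_le (hu : 0 < u) (R a : ℝ) :
    nlWeight p u (R * a) ≤ (R ^ 2 + |R| ^ (p + 1)) * nlWeight p u a := by
  unfold nlWeight
  rw [abs_mul, Real.mul_rpow (abs_nonneg _) (abs_nonneg _)]
  have h1 : 0 ≤ u ^ (p - 1) * a ^ 2 := by positivity
  have h2 : 0 ≤ |a| ^ (p + 1) := by positivity
  have h3 : 0 ≤ |R| ^ (p + 1) := by positivity
  nlinarith [mul_nonneg h3 h1, mul_nonneg (sq_nonneg R) h2]

/-- Compare |b| with ρ|a|: either |b| or |a| can be eliminated from the product. The coefficient of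
the a-term can be made as small as desired. -/
theorem rpow_mul_abs_le {q ρ : ℝ} (hq : 0 ≤ q) (hρ : 0 < ρ) (a b : ℝ) :
    |a| ^ q * |b| ≤ ρ * |a| ^ (q + 1) + ρ ^ (-q) * |b| ^ (q + 1) := by
  have e : ∀ x : ℝ, |x| ^ (q + 1) = |x| ^ q * |x| := fun x =>
    Real.rpow_add_one' (abs_nonneg _) (by linarith)
  rcases le_total |b| (ρ * |a|) with h | h
  · calc |a| ^ q * |b| ≤ |a| ^ q * (ρ * |a|) := by gcongr
      _ = ρ * |a| ^ (q + 1) := by rw [e]; ring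
      _ ≤ _ := le_add_of_nonneg_right (by positivity)
  · have h1 : |a| ≤ |b| / ρ := by rw [le_div_iff₀ hρ]; linarith
    calc |a| ^ q * |b| ≤ (|b| / ρ) ^ q * |b| := by gcongr
      _ = ρ ^ (-q) * |b| ^ (q + 1) := by
        rw [e, Real.div_rpow (abs_nonneg _) hρ.le, Real.rpow_neg hρ.le]; ring
      _ ≤ _ := le_add_of_nonneg_left (by positivity)

/-- The form with a free ρ serves limits in which the weight of a stays bounded and that of b tends
to 0: let b vanish first, then ρ. The exponents -1 and -p come from the linear and the p-th power
part of `nl`. -/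
theorem nl_mul_abs_le (hp : 1 < p) (hu : 0 < u) {ρ : ℝ} (hρ : 0 < ρ) (a b : ℝ) :
    nl p u a * |b| ≤ p * 2 ^ (p - 1) *
      (ρ * nlWeight p u a + (ρ ^ (-1 : ℝ) + ρ ^ (-p)) * nlWeight p u b) := by
  have h1 := mul_le_mul_of_nonneg_right (nl_upper hp hu a) (abs_nonneg b)
  refine h1.trans ?_
  rw [mul_assoc]
  gcongr
  have h2 := rpow_mul_abs_le (q := 1) zero_le_one hρ a b
  have h3 := rpow_mul_abs_le (q := p) (by linarith) hρ a b
  have e2 : ∀ x : ℝ, |x| ^ ((1 : ℝ) + 1) = x ^ 2 := fun x => by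
    rw [show (1 : ℝ) + 1 = (2 : ℕ) by norm_num, Real.rpow_natCast, sq_abs]
  rw [e2, e2, Real.rpow_one] at h2
  have h4 : u ^ (p - 1) * (|a| * |b|) ≤ u ^ (p - 1) * (ρ * a ^ 2 + ρ ^ (-1 : ℝ) * b ^ 2) := by
    gcongr
  have h5 : 0 ≤ ρ ^ (-1 : ℝ) * |b| ^ (p + 1) := by positivity
  have h6 : 0 ≤ ρ ^ (-p) * (u ^ (p - 1) * b ^ 2) := by positivity
  unfold nlWeight
  linarith

/-- By homogeneity only r = w/u ≥ θ⁻¹ matters. The slope of the chord of r^p from 1 to r increases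
with r, and at r = θ⁻¹ its value m already exceeds p by the strict Bernoulli inequality; so ε = m/p
- 1 works. -/
theorem rpow_sub_rpow_ge {θ : ℝ} (hp : 1 < p) (hθ0 : 0 < θ) (hθ : θ < 1) :
    ∃ ε > 0, ∀ u w : ℝ, 0 < u → u ≤ θ * w →
      (1 + ε) * (p * u ^ (p - 1) * (w - u)) ≤ w ^ p - u ^ p := by
  have hT : 1 < θ⁻¹ := (one_lt_inv₀ hθ0).2 hθ
  have hT' : 0 < θ⁻¹ - 1 := by linarith
  have h0 := one_add_mul_self_lt_rpow_one_add (s := θ⁻¹ - 1) (by linarith) (by linarith) hp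
  rw [add_sub_cancel] at h0
  set m := (θ⁻¹ ^ p - 1) / (θ⁻¹ - 1) with hm
  have hmp : p < m := by rw [hm, lt_div_iff₀ hT']; linarith
  refine ⟨m / p - 1, by rw [gt_iff_lt, sub_pos, one_lt_div (by linarith)]; exact hmp, ?_⟩
  intro u w hu huw
  have hw : 0 < w := by by_contra! h; nlinarith
  have h1 : θ⁻¹ ≤ w / u := by
    rw [le_div_iff₀ hu]
    calc θ⁻¹ * u ≤ θ⁻¹ * (θ * w) := by gcongr
      _ = w := by field_simp
  have hne : w / u - 1 > 0 := by linarith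
  have h2 := (convexOn_rpow hp.le).secant_mono (a := 1) (x := θ⁻¹) (y := w / u) (by simp)
    (by simp [hθ0.le]) (by simp only [Set.mem_Ici]; positivity) (by linarith) (by linarith) h1
  rw [Real.one_rpow, ← hm, le_div_iff₀ hne, Real.div_rpow hw.le hu.le] at h2
  have h3 : u ^ p = u ^ (p - 1) * u := by
    rw [← Real.rpow_add_one hu.ne', sub_add_cancel]
  have h4 := mul_le_mul_of_nonneg_right h2 (Real.rpow_nonneg hu.le p)
  rw [sub_mul, div_mul_cancel₀ _ (by positivity), one_mul] at h4
  refine le_trans (le_of_eq ?_) h4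
  rw [h3]
  have : p ≠ 0 := by linarith
  field_simp
  ring

end Pointwise

/-! ### An abstract variational problem -/

section Variational

variable {X : Type*} [MeasurableSpace X] {ν : Measure X} {H : Type*} [NormedAddCommGroup H]
  [InnerProductSpace ℝ H]

/-- The data of the variational problem: an energy space `H` mapped to `L²`, a positive weight `u`,
and nonlinear terms that are finite on `H`. -/
structure IsAdmissible (J : H →L[ℝ] Lp ℝ 2 ν) (p : ℝ) (u : X → ℝ) : Prop where
  one_lt : 1 < p
  meas : AEStronglyMeasurable u ν
  pos : ∀ᵐ x ∂ν, 0 < u x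
  int : ∀ k : H, Integrable (fun x => nlWeight p (u x) (J k x)) ν

/-- `h ↦ ∫ F(u, J h)`. -/
def potential (J : H →L[ℝ] Lp ℝ 2 ν) (p : ℝ) (u : X → ℝ) (h : H) : ℝ :=
  ∫ x, nlPrim p (u x) (J h x) ∂ν

/-- The derivative of the potential at `h` in the direction `k`. -/
def nlPair (J : H →L[ℝ] Lp ℝ 2 ν) (p : ℝ) (u : X → ℝ) (h k : H) : ℝ :=
  ∫ x, nl p (u x) (J h x) * J k x ∂ν

/-- The action functional. -/
def action (J : H →L[ℝ] Lp ℝ 2 ν) (p : ℝ) (u : X → ℝ) (h : H) : ℝ :=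
  ‖h‖ ^ 2 / 2 - potential J p u h

variable {J : H →L[ℝ] Lp ℝ 2 ν} {p : ℝ} {u : X → ℝ}

theorem coe_smul_ae (J : H →L[ℝ] Lp ℝ 2 ν) (t : ℝ) (h : H) :
    ∀ᵐ x ∂ν, J (t • h) x = t * J h x := by
  rw [map_smul]
  filter_upwards [Lp.coeFn_smul t (J h)] with x hx
  simpa using hx

theorem coe_add_ae (J : H →L[ℝ] Lp ℝ 2 ν) (h k : H) :
    ∀ᵐ x ∂ν, J (h + k) x = J h x + J k x := by
  rw [map_add]
  filter_upwards [Lp.coeFn_add (J h) (J k)] with x hx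
  simpa using hx

theorem coe_sub_ae (J : H →L[ℝ] Lp ℝ 2 ν) (h k : H) :
    ∀ᵐ x ∂ν, J (h - k) x = J h x - J k x := by
  rw [map_sub]
  filter_upwards [Lp.coeFn_sub (J h) (J k)] with x hx
  simpa using hx

theorem aestronglyMeasurable_nl (hu : AEStronglyMeasurable u ν) {v : X → ℝ}
    (hv : AEStronglyMeasurable v ν) : AEStronglyMeasurable (fun x => nl p (u x) (v x)) ν := by
  have := hu.aemeasurable
  have := hv.aemeasurable
  unfold nl
  refine AEMeasurable.aestronglyMeasurable ?_
  fun_prop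

theorem aestronglyMeasurable_nlPrim (hu : AEStronglyMeasurable u ν) {v : X → ℝ}
    (hv : AEStronglyMeasurable v ν) :
    AEStronglyMeasurable (fun x => nlPrim p (u x) (v x)) ν := by
  have := hu.aemeasurable
  have := hv.aemeasurable
  unfold nlPrim
  refine AEMeasurable.aestronglyMeasurable ?_
  fun_prop

/-! ### Integrability, convexity and behaviour of the action along rays -/

namespace IsAdmissible

theorem measJ (k : H) : AEStronglyMeasurable (J k) ν := Lp.aestronglyMeasurable (J k)

theorem integrable_nl_mul_abs (A : IsAdmissible J p u) (h k : H) :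
    Integrable (fun x => nl p (u x) (J h x) * |J k x|) ν := by
  refine (((A.int h).const_mul 1).add ((A.int k).const_mul (1 ^ (-1 : ℝ) + 1 ^ (-p)))
    |>.const_mul (p * 2 ^ (p - 1))).mono'
    ((aestronglyMeasurable_nl A.meas (measJ h)).mul (continuous_abs.comp_aestronglyMeasurable
      (measJ k))) ?_
  filter_upwards [A.pos] with x hx
  have h1 := nl_nonneg A.one_lt hx.le (J h x)
  rw [Real.norm_eq_abs, abs_of_nonneg (by positivity)]
  exact nl_mul_abs_le A.one_lt hx one_pos _ _

theorem integrable_nl_mul (A : IsAdmissible J p u) (h k : H) :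
    Integrable (fun x => nl p (u x) (J h x) * J k x) ν := by
  refine (A.integrable_nl_mul_abs h k).mono'
    ((aestronglyMeasurable_nl A.meas (measJ h)).mul (measJ k)) ?_
  filter_upwards [A.pos] with x hx
  have h1 := nl_nonneg A.one_lt hx.le (J h x)
  rw [Real.norm_eq_abs, abs_mul, abs_of_nonneg h1]

theorem integrable_nlPrim (A : IsAdmissible J p u) (h : H) :
    Integrable (fun x => nlPrim p (u x) (J h x)) ν := by
  refine (A.integrable_nl_mul h h).mono' (aestronglyMeasurable_nlPrim A.meas (measJ h)) ?_
  filter_upwards [A.pos] with x hx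
  rw [Real.norm_eq_abs, abs_of_nonneg (nlPrim_nonneg A.one_lt hx _)]
  exact nlPrim_le A.one_lt hx _

theorem nlPair_add (A : IsAdmissible J p u) (h k l : H) :
    nlPair J p u h (k + l) = nlPair J p u h k + nlPair J p u h l := by
  unfold nlPair
  rw [← integral_add (A.integrable_nl_mul h k) (A.integrable_nl_mul h l)]
  refine integral_congr_ae ?_
  filter_upwards [coe_add_ae J k l] with x hx
  rw [hx]; ring

theorem nlPair_smul (h k : H) (t : ℝ) :
    nlPair J p u h (t • k) = t * nlPair J p u h k := by
  unfold nlPair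
  rw [← integral_const_mul]
  refine integral_congr_ae ?_
  filter_upwards [coe_smul_ae J t k] with x hx
  rw [hx]; ring

theorem nlPair_zero (h : H) : nlPair J p u h 0 = 0 := by
  simpa using nlPair_smul (J := J) (p := p) (u := u) h 0 0

theorem potential_tangent (A : IsAdmissible J p u) (h k : H) :
    potential J p u h + nlPair J p u h (k - h) ≤ potential J p u k := by
  unfold potential nlPair
  rw [← integral_add (A.integrable_nlPrim h) (A.integrable_nl_mul h _)]
  refine integral_mono_ae ((A.integrable_nlPrim h).add (A.integrable_nl_mul h _))
    (A.integrable_nlPrim k) ?_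
  filter_upwards [A.pos, coe_sub_ae J k h] with x hx hs
  rw [hs]
  exact nlPrim_tangent A.one_lt hx _ _

/-- There is an affine minorant touching at each point z; its slopes towards a and b cancel when
weighted by the coefficients of z. -/
theorem potential_convexOn (A : IsAdmissible J p u) :
    ConvexOn ℝ Set.univ (potential J p u) := by
  refine ⟨convex_univ, fun a _ b _ α β hα hβ hαβ => ?_⟩
  set z := α • a + β • b with hz
  have h1 := mul_le_mul_of_nonneg_left (A.potential_tangent z a) hα
  have h2 := mul_le_mul_of_nonneg_left (A.potential_tangent z b) hβ
  have e : α • (a - z) + β • (b - z) = 0 := by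
    have : α • (a - z) + β • (b - z) = z - (α + β) • z := by
      rw [hz]; module
    rw [this, hαβ, one_smul, sub_self]
  have h3 : α * nlPair J p u z (a - z) + β * nlPair J p u z (b - z) = 0 := by
    rw [← nlPair_smul, ← nlPair_smul, ← A.nlPair_add, e, nlPair_zero]
  have h4 : potential J p u z = α * potential J p u z + β * potential J p u z := by
    rw [← add_mul, hαβ, one_mul]
  simp only [smul_eq_mul]
  linarith

/-- A finite convex function on the real line is continuous. Continuity on lines is all that the
minimax argument needs. -/
theorem continuous_potential_line (A : IsAdmissible J p u) (a b : H) :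
    Continuous fun t : ℝ => potential J p u (a + t • b) := by
  have h : ConvexOn ℝ Set.univ (fun t : ℝ => potential J p u (a + t • b)) := by
    refine ⟨convex_univ, fun x _ y _ α β hα hβ hαβ => ?_⟩
    have := A.potential_convexOn.2 (Set.mem_univ (a + x • b)) (Set.mem_univ (a + y • b)) hα hβ hαβ
    convert this using 2
    have : a = (α + β) • a := by rw [hαβ, one_smul]
    nth_rewrite 1 [this]
    simp only [smul_eq_mul]
    module
  exact continuousOn_univ.1 (h.continuousOn isOpen_univ)

theorem continuous_action_line (A : IsAdmissible J p u) (a b : H) :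
    Continuous fun t : ℝ => action J p u (a + t • b) := by
  unfold action
  have := A.continuous_potential_line a b
  fun_prop

/-- In the variable t² the quadratic part is affine and the potential is convex, so the action is
concave; κ is the slope of a supporting line at s². The inequality is strict once J w is positive on
a set of positive measure, because F is strictly convex in the square there. -/
theorem action_ray (A : IsAdmissible J p u) (w : H) {s : ℝ} (hs : 0 < s) :
    ∃ κ : ℝ, (∀ t : ℝ, 0 ≤ t →
        action J p u (t • w) ≤ action J p u (s • w) + (t ^ 2 - s ^ 2) * κ) ∧
      ((¬ ∀ᵐ x ∂ν, J w x ≤ 0) → ∀ t : ℝ, 0 ≤ t → t ≠ s →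
        action J p u (t • w) < action J p u (s • w) + (t ^ 2 - s ^ 2) * κ) := by
  have hi : ∀ t : ℝ, Integrable (fun x => nlPrim p (u x) (t * J w x)) ν := fun t => by
    refine (A.integrable_nlPrim (t • w)).congr ?_
    filter_upwards [coe_smul_ae J t w] with x hx
    rw [hx]
  have hpot : ∀ t : ℝ, potential J p u (t • w) = ∫ x, nlPrim p (u x) (t * J w x) ∂ν := fun t => by
    refine integral_congr_ae ?_
    filter_upwards [coe_smul_ae J t w] with x hx
    rw [hx]
  have hj : Integrable (fun x => nl p (u x) (s * J w x) * J w x) ν := by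
    refine (A.integrable_nl_mul (s • w) w).congr ?_
    filter_upwards [coe_smul_ae J s w] with x hx
    rw [hx]
  set P := ∫ x, nl p (u x) (s * J w x) * J w x ∂ν with hP
  have hd : ∀ t : ℝ, Integrable (fun x => nlPrim p (u x) (t * J w x) - (nlPrim p (u x) (s * J w x)
      + (t ^ 2 - s ^ 2) / (2 * s) * (nl p (u x) (s * J w x) * J w x))) ν := fun t =>
    (hi t).sub ((hi s).add (hj.const_mul _))
  have hI : ∀ t : ℝ, ∫ x, nlPrim p (u x) (t * J w x) - (nlPrim p (u x) (s * J w x)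
      + (t ^ 2 - s ^ 2) / (2 * s) * (nl p (u x) (s * J w x) * J w x)) ∂ν
      = potential J p u (t • w) - (potential J p u (s • w) + (t ^ 2 - s ^ 2) / (2 * s) * P) := by
    intro t
    have h2 : Integrable (fun x => nlPrim p (u x) (s * J w x)
      + (t ^ 2 - s ^ 2) / (2 * s) * (nl p (u x) (s * J w x) * J w x)) ν :=
      (hi s).add (hj.const_mul _)
    rw [integral_sub (hi t) h2, integral_add (hi s) (hj.const_mul _),
      integral_const_mul, hpot, hpot]
  have hact : ∀ t : ℝ, action J p u (s • w) + (t ^ 2 - s ^ 2) * (‖w‖ ^ 2 / 2 - P / (2 * s))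
      - action J p u (t • w) = potential J p u (t • w) - (potential J p u (s • w)
        + (t ^ 2 - s ^ 2) / (2 * s) * P) := by
    intro t
    unfold action
    rw [norm_smul, norm_smul, mul_pow, mul_pow, Real.norm_eq_abs, Real.norm_eq_abs, sq_abs, sq_abs]
    ring
  refine ⟨‖w‖ ^ 2 / 2 - P / (2 * s), fun t ht => ?_, fun hw t ht hts => ?_⟩
  · have : 0 ≤ ∫ x, nlPrim p (u x) (t * J w x) - (nlPrim p (u x) (s * J w x)
        + (t ^ 2 - s ^ 2) / (2 * s) * (nl p (u x) (s * J w x) * J w x)) ∂ν := by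
      refine integral_nonneg_of_ae ?_
      filter_upwards [A.pos] with x hx
      have := nlPrim_ray A.one_lt hx ht hs (J w x)
      simp only [Pi.zero_apply]
      linarith
    rw [hI, ← hact] at this
    linarith
  · have : 0 < ∫ x, nlPrim p (u x) (t * J w x) - (nlPrim p (u x) (s * J w x)
        + (t ^ 2 - s ^ 2) / (2 * s) * (nl p (u x) (s * J w x) * J w x)) ∂ν := by
      have h0 : 0 ≤ᵐ[ν] (fun x => nlPrim p (u x) (t * J w x) - (nlPrim p (u x) (s * J w x)
        + (t ^ 2 - s ^ 2) / (2 * s) * (nl p (u x) (s * J w x) * J w x))) := by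
        filter_upwards [A.pos] with x hx
        have := nlPrim_ray A.one_lt hx ht hs (J w x)
        simp only [Pi.zero_apply]
        linarith
      refine lt_of_le_of_ne (integral_nonneg_of_ae h0) fun h => hw ?_
      have := (integral_eq_zero_iff_of_nonneg_ae h0 (hd t)).1 h.symm
      filter_upwards [A.pos, this] with x hx h1
      by_contra! h2
      have := nlPrim_ray_lt A.one_lt hx ht hs hts h2
      simp only [Pi.zero_apply] at h1
      linarith
    rw [hI, ← hact] at this
    linarith

theorem potential_lower (A : IsAdmissible J p u) (h : H) {t : ℝ} (ht : 0 ≤ t) :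
    t ^ (p + 1) * ∫ x, (max (J h x) 0 / 2) ^ (p + 1) ∂ν ≤ potential J p u (t • h) := by
  rw [← integral_const_mul]
  refine integral_mono_of_nonneg (Eventually.of_forall fun x => ?_) (A.integrable_nlPrim _) ?_
  · have := le_max_right (J h x) 0
    simp only [Pi.zero_apply]; positivity
  · filter_upwards [A.pos, coe_smul_ae J t h] with x hx hs
    have := nlPrim_lower A.one_lt hx (t * J h x)
    have h0 := le_max_right (J h x) 0
    rw [hs, ← Real.mul_rpow ht (by positivity)]
    refine le_trans (le_of_eq ?_) this
    congr 1
    have : max (t * J h x) 0 = t * max (J h x) 0 := by rw [mul_max_of_nonneg _ _ ht, mul_zero]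
    rw [this]; ring

theorem potential_lower_pos (A : IsAdmissible J p u) {h : H} (hh : ¬ ∀ᵐ x ∂ν, J h x ≤ 0) :
    0 < ∫ x, (max (J h x) 0 / 2) ^ (p + 1) ∂ν := by
  have h0 : ∀ x, 0 ≤ max (J h x) 0 := fun x => le_max_right _ _
  have hp := A.one_lt
  have hi : Integrable (fun x => (max (J h x) 0 / 2) ^ (p + 1)) ν := by
    refine (A.integrable_nlPrim h).mono' ?_ ?_
    · have := (measJ (J := J) h).aemeasurable
      exact AEMeasurable.aestronglyMeasurable (by fun_prop)
    · filter_upwards [A.pos] with x hx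
      have := h0 x
      rw [Real.norm_eq_abs, abs_of_nonneg (by positivity)]
      exact nlPrim_lower A.one_lt hx _
  have h1 : 0 ≤ᵐ[ν] fun x => (max (J h x) 0 / 2) ^ (p + 1) := Eventually.of_forall fun x => by
    have := h0 x
    simp only [Pi.zero_apply]; positivity
  refine lt_of_le_of_ne (integral_nonneg_of_ae h1) fun h2 => hh ?_
  filter_upwards [(integral_eq_zero_iff_of_nonneg_ae h1 hi).1 h2.symm] with x hx
  simp only [Pi.zero_apply] at hx
  have := h0 x
  rw [Real.rpow_eq_zero (by positivity) (by linarith)] at hx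
  have := le_max_left (J h x) 0
  linarith

theorem action_zero : action J p u (0 : H) = 0 := by
  have : ∀ᵐ x ∂ν, nlPrim p (u x) (J 0 x) = 0 := by
    rw [map_zero]
    filter_upwards [Lp.coeFn_zero ℝ 2 ν] with x hx
    rw [hx]
    exact nlPrim_of_nonpos le_rfl
  unfold action potential
  rw [integral_congr_ae this]
  simp

theorem action_smul (h : H) (t : ℝ) :
    action J p u (t • h) = t ^ 2 * ‖h‖ ^ 2 / 2 - potential J p u (t • h) := by
  unfold action
  rw [norm_smul, mul_pow, Real.norm_eq_abs, sq_abs]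

/-- The potential grows at least like t^(p+1), so the action is nonpositive for large t and the
maximum is attained on a compact interval. -/
theorem exists_max_ray (A : IsAdmissible J p u) {h : H} (hh : ¬ ∀ᵐ x ∂ν, J h x ≤ 0) :
    ∃ t₀ : ℝ, 0 ≤ t₀ ∧ ∀ t : ℝ, 0 ≤ t → action J p u (t • h) ≤ action J p u (t₀ • h) := by
  have hp := A.one_lt
  set m := ∫ x, (max (J h x) 0 / 2) ^ (p + 1) ∂ν with hm
  have hm0 : 0 < m := A.potential_lower_pos hh
  -- Beyond R the bound m t^(p+1) on the potential exceeds t²‖h‖²/2, whence the exponent p - 1 here.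
  obtain ⟨R, hR0, hR⟩ : ∃ R : ℝ, 0 < R ∧ ∀ t ≥ R, ‖h‖ ^ 2 / (2 * m) ≤ t ^ (p - 1) := by
    have := (tendsto_rpow_atTop (y := p - 1) (by linarith)).eventually_ge_atTop
      (‖h‖ ^ 2 / (2 * m))
    obtain ⟨R, hR⟩ := eventually_atTop.1 this
    exact ⟨max R 1, by positivity, fun t ht => hR t ((le_max_left _ _).trans ht)⟩
  have hc : Continuous fun t : ℝ => action J p u (t • h) := by
    simpa using A.continuous_action_line 0 h
  obtain ⟨t₀, ht₀, hmax⟩ := isCompact_Icc.exists_isMaxOn (Set.nonempty_Icc.2 hR0.le)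
    hc.continuousOn
  refine ⟨t₀, ht₀.1, fun t ht => ?_⟩
  rcases le_total t R with htR | htR
  · exact hmax ⟨ht, htR⟩
  · have h1 := hmax (show (0 : ℝ) ∈ Set.Icc 0 R from ⟨le_rfl, hR0.le⟩)
    simp only [Set.mem_ofPred_eq, zero_smul, action_zero] at h1
    refine le_trans ?_ h1
    have h2 := A.potential_lower h ht
    rw [← hm] at h2
    have ht0 : 0 < t := hR0.trans_le htR
    have h3 := hR t htR
    rw [div_le_iff₀ (by positivity)] at h3
    have h4 : t ^ (p + 1) = t ^ (p - 1) * t ^ 2 := by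
      rw [← Real.rpow_natCast t 2, ← Real.rpow_add ht0]; congr 1; push_cast; ring
    rw [action_smul]
    rw [h4] at h2
    nlinarith [sq_nonneg t]

/-- If J h ≤ 0 the potential vanishes on the ray and the action is the unbounded function t²‖h‖²/2.
-/
theorem not_nonpos_of_bounded_ray {h : H} (hh : h ≠ 0) {M : ℝ}
    (hM : ∀ t : ℝ, 0 ≤ t → action J p u (t • h) ≤ M) : ¬ ∀ᵐ x ∂ν, J h x ≤ 0 := by
  intro hn
  have hpot : ∀ t : ℝ, 0 ≤ t → potential J p u (t • h) = 0 := fun t ht => by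
    unfold potential
    rw [integral_congr_ae (g := fun _ => 0), integral_zero]
    filter_upwards [hn, coe_smul_ae J t h] with x hx hs
    rw [hs]
    exact nlPrim_of_nonpos (mul_nonpos_of_nonneg_of_nonpos ht hx)
  have hn0 : 0 < ‖h‖ ^ 2 := by have := norm_pos_iff.2 hh; positivity
  have h1 := hM (1 + 2 * |M| / ‖h‖ ^ 2) (by positivity)
  rw [action_smul, hpot _ (by positivity)] at h1
  set q := 2 * |M| / ‖h‖ ^ 2 with hq
  have hq0 : 0 ≤ q := by positivity
  have h2 : q * ‖h‖ ^ 2 = 2 * |M| := by rw [hq]; field_simp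
  have h3 := le_abs_self M
  nlinarith [mul_nonneg hq0 hn0.le, mul_nonneg (mul_nonneg hq0 hq0) hn0.le]

/-- Stability at second order: the potential at t h is at most (t²/2)(∫ p u^(p-1) (h⁺)² + o(1)) as t
→ 0⁺, strictly below t²‖h‖²/2 for small t. -/
theorem exists_action_pos (A : IsAdmissible J p u) {h : H}
    (hst : ∫ x, p * u x ^ (p - 1) * J h x ^ 2 ∂ν < ‖h‖ ^ 2) :
    ∃ t : ℝ, 0 ≤ t ∧ 0 < action J p u (t • h) := by
  have hp := A.one_lt
  have hi2 : Integrable (fun x => p * u x ^ (p - 1) * J h x ^ 2) ν := by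
    refine ((A.int h).const_mul p).mono' ?_ ?_
    · have := (measJ (J := J) h).aemeasurable
      have := A.meas.aemeasurable
      exact AEMeasurable.aestronglyMeasurable (by fun_prop)
    · filter_upwards [A.pos] with x hx
      rw [Real.norm_eq_abs, abs_of_nonneg (by positivity), mul_assoc]
      have : 0 ≤ |J h x| ^ (p + 1) := by positivity
      unfold nlWeight
      gcongr
      linarith
  have hlim : Tendsto (fun t : ℝ => ∫ x, nl p (u x) (t * J h x) / t * J h x ∂ν) (𝓝[>] 0)
      (𝓝 (∫ x, p * u x ^ (p - 1) * max (J h x) 0 * J h x ∂ν)) := by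
    -- For t < 1 the quotients nl(t a)/t are bounded by nl(a), by convexity; this is the dominating
    -- function.
    refine tendsto_integral_filter_of_dominated_convergence _ ?_ ?_ (A.integrable_nl_mul_abs h h) ?_
    · refine Eventually.of_forall fun t => ?_
      have h1 : AEStronglyMeasurable (fun x => nl p (u x) (t * J h x)) ν :=
        aestronglyMeasurable_nl A.meas ((measJ h).const_mul t)
      exact (h1.mul_const t⁻¹).mul (measJ h)
    · filter_upwards [Ioo_mem_nhdsGT one_pos] with t ht
      filter_upwards [A.pos] with x hx
      have h1 := nl_smul_le hp hx (a := J h x) ht.1.le ht.2.le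
      have h2 := nl_nonneg hp hx.le (t * J h x)
      have ht0 := ht.1
      rw [Real.norm_eq_abs, abs_mul, abs_of_nonneg (by positivity)]
      gcongr
      rw [div_le_iff₀ ht0]
      linarith
    · filter_upwards [A.pos] with x hx
      exact (nl_div_tendsto hx (J h x)).mul_const _
  have hlt : ∫ x, p * u x ^ (p - 1) * max (J h x) 0 * J h x ∂ν < ‖h‖ ^ 2 := by
    refine lt_of_le_of_lt (integral_mono_of_nonneg ?_ hi2 ?_) hst
    · filter_upwards [A.pos] with x hx
      rcases le_total (J h x) 0 with h1 | h1
      · simp [h1]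
      · simp only [max_eq_left h1, Pi.zero_apply]; positivity
    · filter_upwards [A.pos] with x hx
      rcases le_total (J h x) 0 with h1 | h1
      · simp only [max_eq_right h1]
        have : 0 ≤ p * u x ^ (p - 1) * J h x ^ 2 := by positivity
        simpa using this
      · rw [max_eq_left h1]
        exact le_of_eq (by ring)
  obtain ⟨t, h1, ht⟩ := ((hlim.eventually (gt_mem_nhds hlt)).and self_mem_nhdsWithin).exists
  have ht : 0 < t := ht
  refine ⟨t, ht.le, ?_⟩
  -- The supporting line in the square of the radial variable at t, evaluated at 0; it gains the
  -- factor 1/2 over the bound F(x) ≤ F'(x) x.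
  have h2 : potential J p u (t • h) ≤ t / 2 * nlPair J p u (t • h) h := by
    unfold potential nlPair
    rw [← integral_const_mul]
    refine integral_mono_ae (A.integrable_nlPrim _) ((A.integrable_nl_mul _ _).const_mul _) ?_
    filter_upwards [A.pos, coe_smul_ae J t h] with x hx hs
    have := nlPrim_ray hp hx (t := 0) le_rfl ht (J h x)
    rw [zero_mul, nlPrim_of_nonpos le_rfl] at this
    rw [hs]
    have e : (0 ^ 2 - t ^ 2) / (2 * t) = -(t / 2) := by field_simp; ring
    rw [e] at this
    linarith
  have h3 : nlPair J p u (t • h) h = t * ∫ x, nl p (u x) (t * J h x) / t * J h x ∂ν := by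
    unfold nlPair
    rw [← integral_const_mul]
    refine integral_congr_ae ?_
    filter_upwards [coe_smul_ae J t h] with x hs
    rw [hs]
    field_simp
  rw [action_smul]
  rw [h3] at h2
  have h4 := mul_lt_mul_of_pos_left h1 (show 0 < t * t / 2 by positivity)
  nlinarith

theorem continuousAt_nlPair (A : IsAdmissible J p u) (v ξ : H) :
    ContinuousAt (fun t : ℝ => nlPair J p u (t • v) ξ) 1 := by
  have hp := A.one_lt
  have e : ∀ t : ℝ, nlPair J p u (t • v) ξ = ∫ x, nl p (u x) (t * J v x) * J ξ x ∂ν := fun t => by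
    refine integral_congr_ae ?_
    filter_upwards [coe_smul_ae J t v] with x hs
    rw [hs]
  simp only [e]
  -- A dominating function for 0 ≤ t ≤ 2. Since |J v| is pointwise J v or -J v, its integrability
  -- follows from the directions 2v and -2v in H, without using that H is stable under absolute
  -- values.
  have hb : Integrable (fun x => nl p (u x) (2 * |J v x|) * |J ξ x|) ν := by
    refine ((A.integrable_nl_mul_abs ((2 : ℝ) • v) ξ).add
      (A.integrable_nl_mul_abs ((-2 : ℝ) • v) ξ)).mono' ?_ ?_
    · exact (aestronglyMeasurable_nl A.meas
        ((continuous_abs.comp_aestronglyMeasurable (measJ v)).const_mul 2)).mul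
        (continuous_abs.comp_aestronglyMeasurable (measJ ξ))
    · filter_upwards [A.pos, coe_smul_ae J 2 v, coe_smul_ae J (-2) v] with x hx h1 h2
      have := nl_nonneg hp hx.le (2 * |J v x|)
      rw [Real.norm_eq_abs, abs_of_nonneg (by positivity), Pi.add_apply, h1, h2]
      rcases abs_choice (J v x) with h | h
      · rw [h]
        have := nl_nonneg hp hx.le (-2 * J v x)
        exact le_add_of_nonneg_right (by positivity)
      · rw [h, show 2 * -J v x = -2 * J v x by ring]
        have := nl_nonneg hp hx.le (2 * J v x)
        exact le_add_of_nonneg_left (by positivity)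
  refine continuousAt_of_dominated ?_ ?_ hb ?_
  · refine Eventually.of_forall fun t => ?_
    exact (aestronglyMeasurable_nl A.meas ((measJ v).const_mul t)).mul (measJ ξ)
  · filter_upwards [Icc_mem_nhds (show (0 : ℝ) < 1 by norm_num) (show (1 : ℝ) < 2 by norm_num)]
      with t ht
    filter_upwards [A.pos] with x hx
    rw [Real.norm_eq_abs, abs_mul, abs_of_nonneg (nl_nonneg hp hx.le _)]
    gcongr
    refine nl_mono hp hx.le ?_
    calc t * J v x ≤ t * |J v x| := by gcongr; exacts [ht.1, le_abs_self _]
      _ ≤ _ := by gcongr; exact ht.2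
  · refine Eventually.of_forall fun x => ?_
    have : Continuous fun t : ℝ => nl p (u x) (t * J v x) := by
      unfold nl
      exact ((continuous_const.add ((continuous_id.mul continuous_const).max
        continuous_const)).rpow_const fun _ => Or.inr (by linarith)).sub continuous_const
    exact (this.mul continuous_const).continuousAt

end IsAdmissible

end Variational

/-! ### The minimax level and its critical points -/

section Variational

variable {X : Type*} [MeasurableSpace X] {ν : Measure X} {H : Type*} [NormedAddCommGroup H]
  [InnerProductSpace ℝ H] {J : H →L[ℝ] Lp ℝ 2 ν} {p : ℝ} {u : X → ℝ}

namespace IsAdmissible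

/-- A maximiser along its own ray whose level is a lower bound for the maxima along all rays is
a critical point. -/
theorem le_of_minimax (A : IsAdmissible J p u) {v : H} {c : ℝ} (hc : 0 < c)
    (hvc : action J p u v = c) (hv : ∀ t : ℝ, 0 ≤ t → action J p u (t • v) ≤ c)
    (hmin : ∀ w : H, w ≠ 0 → ∀ M : ℝ, (∀ t : ℝ, 0 ≤ t → action J p u (t • w) ≤ M) → c ≤ M)
    (ξ : H) : nlPair J p u v ξ ≤ inner ℝ v ξ := by
  by_contra! hD
  set D := nlPair J p u v ξ - inner ℝ v ξ with hDdef
  have hD0 : 0 < D := sub_pos.2 hD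
  have hv0 : v ≠ 0 := by
    rintro rfl
    rw [action_zero] at hvc
    exact hc.ne hvc
  have hvpos : ¬ ∀ᵐ x ∂ν, J v x ≤ 0 := not_nonpos_of_bounded_ray hv0 hv
  -- On a whole interval around t = 1 the derivative of the action at t v in the direction ξ stays
  -- below -D/2. The cap η ≤ 1/2 keeps t away from 0.
  obtain ⟨η, hη0, hη1, hη⟩ : ∃ η : ℝ, 0 < η ∧ η ≤ 1 / 2 ∧ ∀ t : ℝ, |t - 1| ≤ η →
      t * inner ℝ v ξ - nlPair J p u (t • v) ξ ≤ - (D / 2) := by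
    have h1 : ContinuousAt (fun t : ℝ => t * inner ℝ v ξ - nlPair J p u (t • v) ξ) 1 :=
      (continuousAt_id.mul continuousAt_const).sub (A.continuousAt_nlPair v ξ)
    have h2 : (fun t : ℝ => t * inner ℝ v ξ - nlPair J p u (t • v) ξ) 1 < -(D / 2) := by
      simp only [one_smul, one_mul]; linarith
    obtain ⟨r, hr, h3⟩ := Metric.eventually_nhds_iff.1 (h1.eventually (gt_mem_nhds h2))
    refine ⟨min (r / 2) (1 / 2), by positivity, min_le_right _ _, fun t ht => (h3 ?_).le⟩
    rw [Real.dist_eq]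
    have := ht.trans (min_le_left _ _)
    linarith
  -- Strict concavity in t² makes the maximum on the ray unique: with a second maximum σ, the strict
  -- supporting line at the midpoint s would have to rise both towards 1 and towards σ, which lie on
  -- opposite sides of s.
  have hside : ∀ σ : ℝ, 0 < σ → σ ≠ 1 → action J p u (σ • v) < c := by
    intro σ hσ hσ1
    refine lt_of_le_of_ne (hv σ hσ.le) fun heq => ?_
    set s := (1 + σ) / 2 with hs
    have hs0 : 0 < s := by positivity
    obtain ⟨κ, -, h1⟩ := A.action_ray v hs0
    have h1 := h1 hvpos
    have h2 := h1 1 zero_le_one (fun h => hσ1 (by linarith))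
    have h3 := h1 σ hσ.le (fun h => hσ1 (by linarith))
    have h4 := hv s hs0.le
    rw [one_smul, hvc] at h2
    rw [heq] at h3
    have h5 : 0 < (1 ^ 2 - s ^ 2) * κ := by linarith
    have h6 : 0 < (σ ^ 2 - s ^ 2) * κ := by linarith
    have e1 : 1 ^ 2 - s ^ 2 = (1 - σ) / 2 * (1 + s) := by rw [hs]; ring
    have e2 : σ ^ 2 - s ^ 2 = (σ - 1) / 2 * (σ + s) := by rw [hs]; ring
    rw [e1] at h5
    rw [e2] at h6
    have h7 : 0 < (1 - σ) * κ := by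
      by_contra! h
      have : (1 - σ) / 2 * (1 + s) * κ = ((1 - σ) * κ) * ((1 + s) / 2) := by ring
      rw [this] at h5
      have := mul_nonpos_of_nonpos_of_nonneg h (show 0 ≤ (1 + s) / 2 by positivity)
      linarith
    have h8 : 0 < (σ - 1) * κ := by
      by_contra! h
      have : (σ - 1) / 2 * (σ + s) * κ = ((σ - 1) * κ) * ((σ + s) / 2) := by ring
      rw [this] at h6
      have := mul_nonpos_of_nonpos_of_nonneg h (show 0 ≤ (σ + s) / 2 by positivity)
      linarith
    linarith
  have hup := hside (1 + η) (by linarith) (by linarith)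
  have hlo := hside (1 - η) (by linarith) (by linarith)
  -- For small ε the level at w = v + ε ξ still exceeds the levels at (1 ± η) v. This is used to
  -- locate the maximum of the new ray.
  have hev1 : ∀ᶠ ε : ℝ in 𝓝[>] 0, max (action J p u ((1 + η) • v)) (action J p u ((1 - η) • v))
      < action J p u (v + ε • ξ) := by
    have h1 : Tendsto (fun ε : ℝ => action J p u (v + ε • ξ)) (𝓝 0) (𝓝 c) := by
      have := (A.continuous_action_line v ξ).tendsto 0
      simpa [hvc] using this
    exact (h1.mono_left nhdsWithin_le_nhds).eventually (lt_mem_nhds (max_lt hup hlo))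
  have hev2 : ∀ᶠ ε : ℝ in 𝓝[>] 0, ε * ‖ξ‖ ^ 2 < D / 4 := by
    have h1 : Tendsto (fun ε : ℝ => ε * ‖ξ‖ ^ 2) (𝓝 0) (𝓝 0) := by
      have : Continuous fun ε : ℝ => ε * ‖ξ‖ ^ 2 := by fun_prop
      simpa using this.tendsto 0
    exact (h1.mono_left nhdsWithin_le_nhds).eventually (gt_mem_nhds (by positivity))
  obtain ⟨ε, ⟨h1, h2⟩, hε⟩ := ((hev1.and hev2).and self_mem_nhdsWithin).exists
  have hε : 0 < ε := hε
  set w := v + ε • ξ with hw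
  -- The potential is bounded below by its tangent at t v, so the action drops by at least t ε (D/2
  -- - D/4), and t ≥ 1/2. The second D/4 pays for the quadratic remainder in ε.
  have hmid : ∀ t : ℝ, |t - 1| ≤ η → action J p u (t • w) ≤ action J p u (t • v) - ε * D / 8 := by
    intro t ht
    have ht' := abs_le.1 ht
    have h3 := A.potential_tangent (t • v) (t • w)
    have e : t • w - t • v = (t * ε) • ξ := by rw [hw]; module
    rw [e, nlPair_smul] at h3
    have h4 := hη t ht
    have h5 : ‖w‖ ^ 2 = ‖v‖ ^ 2 + 2 * ε * inner ℝ v ξ + ε ^ 2 * ‖ξ‖ ^ 2 := by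
      rw [hw, norm_add_sq_real, norm_smul, inner_smul_right, mul_pow, Real.norm_eq_abs, sq_abs]
      ring
    rw [action_smul, action_smul, h5]
    have h6 : t * (ε * ‖ξ‖ ^ 2) / 2 ≤ D / 4 := by nlinarith
    have h7 : t * ε * (t * inner ℝ v ξ - nlPair J p u (t • v) ξ + t * (ε * ‖ξ‖ ^ 2) / 2)
        ≤ t * ε * (- (D / 4)) :=
      mul_le_mul_of_nonneg_left (by linarith) (mul_nonneg (by linarith) hε.le)
    have h8 : t * ε * (- (D / 4)) ≤ - (ε * D / 8) := by
      have : 0 ≤ (t - 1 / 2) * (ε * D) := mul_nonneg (by linarith) (by positivity)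
      linarith
    linarith
  have hηabs : |1 + η - 1| ≤ η := by rw [add_sub_cancel_left, abs_of_pos hη0]
  have hηabs' : |1 - η - 1| ≤ η := by rw [sub_sub_cancel_left, abs_neg, abs_of_pos hη0]
  have hεD : 0 < ε * D / 8 := by positivity
  have hw0 : w ≠ 0 := by
    intro h0
    have h3 := hmid 1 (by simp [hη0.le])
    have h4 := hmid (1 + η) hηabs
    have h5 := le_max_left (action J p u ((1 + η) • v)) (action J p u ((1 - η) • v))
    rw [h0, smul_zero] at h4
    rw [h0] at h1
    linarith
  -- Near 1 this is `hmid`. Away from 1, the supporting line at 1 ± η must rise towards t = 1, where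
  -- the level is higher; so it descends on the other side, and the bound at 1 ± η persists there.
  have hall : ∀ t : ℝ, 0 ≤ t → action J p u (t • w) ≤ c - ε * D / 8 := by
    intro t ht
    rcases le_or_gt |t - 1| η with h | h
    · have := hmid t h
      have := hv t ht
      linarith
    · rcases lt_abs.1 h with h3 | h3
      · have hσ : 0 < 1 + η := by linarith
        obtain ⟨κ, hκ, -⟩ := A.action_ray w hσ
        have h4 := hκ 1 zero_le_one
        have h5 := hκ t ht
        have h6 := hmid (1 + η) hηabs
        rw [one_smul] at h4
        have h7 := (le_max_left _ _).trans_lt h1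
        have h8 : 0 < (1 ^ 2 - (1 + η) ^ 2) * κ := by linarith
        have h9 : κ < 0 := by
          by_contra! hk
          have : (1 ^ 2 - (1 + η) ^ 2) * κ = - (η * (2 + η) * κ) := by ring
          have : 0 ≤ η * (2 + η) * κ := by positivity
          linarith
        have h10 : (t ^ 2 - (1 + η) ^ 2) * κ ≤ 0 :=
          mul_nonpos_of_nonneg_of_nonpos (by nlinarith) h9.le
        linarith
      · have hσ : 0 < 1 - η := by linarith
        obtain ⟨κ, hκ, -⟩ := A.action_ray w hσ
        have h4 := hκ 1 zero_le_one
        have h5 := hκ t ht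
        have h6 := hmid (1 - η) hηabs'
        rw [one_smul] at h4
        have h7 := (le_max_right _ _).trans_lt h1
        have h8 : 0 < (1 ^ 2 - (1 - η) ^ 2) * κ := by linarith
        have h9 : 0 < κ := by
          by_contra! hk
          have e : (1 ^ 2 - (1 - η) ^ 2) * κ = η * (2 - η) * κ := by ring
          have : η * (2 - η) * κ ≤ 0 :=
            mul_nonpos_of_nonneg_of_nonpos (mul_nonneg hη0.le (by linarith)) hk
          linarith
        have h10 : (t ^ 2 - (1 - η) ^ 2) * κ ≤ 0 :=
          mul_nonpos_of_nonpos_of_nonneg (by nlinarith) h9.le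
        linarith
  have := hmin w hw0 _ hall
  linarith

/-- Existence of a nonzero critical point of the action. -/
theorem exists_critical (A : IsAdmissible J p u)
    (hb : ∃ C : ℝ, ∀ k : H, ‖k‖ ≤ 1 → ∫ x, nlWeight p (u x) (J k x) ∂ν ≤ C)
    (hcpt : ∀ h : ℕ → H, (∀ n, ‖h n‖ ≤ 1) → ∃ k : H, ‖k‖ ≤ 1 ∧ ∃ φ : ℕ → ℕ, StrictMono φ ∧
      Tendsto (fun n => ∫ x, nlWeight p (u x) (J (h (φ n) - k) x) ∂ν) atTop (𝓝 0))
    (hst : ∀ h : H, h ≠ 0 → ∫ x, p * u x ^ (p - 1) * J h x ^ 2 ∂ν < ‖h‖ ^ 2)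
    (hJ : ∃ h : H, J h ≠ 0) :
    ∃ v : H, v ≠ 0 ∧ ∀ k : H, nlPair J p u v k = inner ℝ v k := by
  have hp := A.one_lt
  -- S collects the upper bounds of the action on rays, so inf S is the minimax level even though
  -- some rays may be unbounded.
  set S : Set ℝ := {M | ∃ w : H, w ≠ 0 ∧ ∀ t : ℝ, 0 ≤ t → action J p u (t • w) ≤ M} with hS
  have hS0 : ∀ M ∈ S, 0 ≤ M := by
    rintro M ⟨w, -, hw⟩
    simpa [action_zero] using hw 0 le_rfl
  have hSne : S.Nonempty := by
    obtain ⟨h, hh⟩ := hJ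
    -- Only the positive part enters the nonlinearity; one of h and -h has a nontrivial positive
    -- part, and its ray is bounded above.
    have : (¬ ∀ᵐ x ∂ν, J h x ≤ 0) ∨ (¬ ∀ᵐ x ∂ν, J (-h) x ≤ 0) := by
      by_contra! hcon
      apply hh
      refine Lp.ext ?_
      have hneg : ∀ᵐ x ∂ν, J (-h) x = - J h x := by
        rw [map_neg]
        filter_upwards [Lp.coeFn_neg (J h)] with x hx
        simpa using hx
      filter_upwards [hcon.1, hcon.2, hneg, Lp.coeFn_zero ℝ 2 ν] with x h1 h2 h3 h4
      rw [h4]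
      rw [h3] at h2
      simp only [Pi.zero_apply]
      linarith
    have h0 : h ≠ 0 := by rintro rfl; simp at hh
    rcases this with h1 | h1
    · obtain ⟨t₀, -, ht⟩ := A.exists_max_ray h1
      exact ⟨_, h, h0, ht⟩
    · obtain ⟨t₀, -, ht⟩ := A.exists_max_ray h1
      exact ⟨_, -h, neg_ne_zero.2 h0, ht⟩
  have hSbdd : BddBelow S := ⟨0, hS0⟩
  set c := sInf S with hc
  obtain ⟨M, -, hMlim, hMS⟩ := exists_seq_tendsto_sInf hSne hSbdd
  have hseq : ∀ n, ∃ h : H, ‖h‖ = 1 ∧ ∀ t : ℝ, 0 ≤ t → action J p u (t • h) ≤ M n := by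
    intro n
    obtain ⟨w, hw0, hw⟩ := hMS n
    refine ⟨‖w‖⁻¹ • w, by simpa using norm_smul_inv_norm (𝕜 := ℝ) hw0, fun t ht => ?_⟩
    rw [smul_smul]
    exact hw _ (by positivity)
  choose h hnorm hbd using hseq
  obtain ⟨k, hk1, φ, hφ, hlim⟩ := hcpt h fun n => (hnorm n).le
  obtain ⟨C, hC⟩ := hb
  -- The unit directions h n satisfy potential(R h n) ≥ R²/2 - M n; this passes to the limit k. The
  -- constant R²/2 is kept although ‖k‖ may be less than 1, which only helps.
  have hpot : ∀ R : ℝ, 0 ≤ R → R ^ 2 / 2 - c ≤ potential J p u (R • k) := by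
    intro R hR
    set B := (R ^ 2 + |R| ^ (p + 1)) with hB
    have hB0 : 0 ≤ B := by positivity
    have key : ∀ ρ > 0, R ^ 2 / 2 - c - p * 2 ^ (p - 1) * (ρ * (B * C))
        ≤ potential J p u (R • k) := by
      intro ρ hρ
      set K := ρ ^ (-1 : ℝ) + ρ ^ (-p) with hK
      have hK0 : 0 ≤ K := by positivity
      have hn : ∀ n, R ^ 2 / 2 - M (φ n) - p * 2 ^ (p - 1) * (ρ * (B * C)
          + K * (B * ∫ x, nlWeight p (u x) (J (h (φ n) - k) x) ∂ν)) ≤ potential J p u (R • k) := by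
        intro n
        set g := h (φ n) with hg
        -- Convexity compares the potentials at R k and R g; the tangent term is ρ times a bounded
        -- weight plus K(ρ) times the weight of g - k, which vanishes in the limit. Afterwards ρ →
        -- 0.
        have h1 := A.potential_tangent (R • g) (R • k)
        have h2 := hbd (φ n) R hR
        rw [action_smul, hnorm, ← hg] at h2
        have h3 : - nlPair J p u (R • g) (R • k - R • g) ≤ p * 2 ^ (p - 1) * (ρ * (B * C)
          + K * (B * ∫ x, nlWeight p (u x) (J (g - k) x) ∂ν)) := by
          have e : R • k - R • g = (-1 : ℝ) • (R • (g - k)) := by module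
          rw [e, nlPair_smul]
          have hi : Integrable (fun x => p * 2 ^ (p - 1) * (ρ * (B * nlWeight p (u x) (J g x))
              + K * (B * nlWeight p (u x) (J (g - k) x)))) ν :=
            (((((A.int g).const_mul B).const_mul ρ).add
              (((A.int (g - k)).const_mul B).const_mul K)).const_mul _)
          have h4 : nlPair J p u (R • g) (R • (g - k)) ≤ ∫ x, p * 2 ^ (p - 1) *
              (ρ * (B * nlWeight p (u x) (J g x))
              + K * (B * nlWeight p (u x) (J (g - k) x))) ∂ν := by
            refine integral_mono_ae (A.integrable_nl_mul _ _) hi ?_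
            filter_upwards [A.pos, coe_smul_ae J R g, coe_smul_ae J R (g - k)] with x hx e1 e2
            rw [e1, e2]
            have h5 := nl_mul_abs_le hp hx hρ (R * J g x) (R * J (g - k) x)
            have h6 := nlWeight_smul_le (p := p) hx R (J g x)
            have h7 := nlWeight_smul_le (p := p) hx R (J (g - k) x)
            have h8 := nl_nonneg hp hx.le (R * J g x)
            refine le_trans (mul_le_mul_of_nonneg_left (le_abs_self _) h8) (h5.trans ?_)
            rw [← hK]
            gcongr
          rw [integral_const_mul, integral_add (((A.int g).const_mul B).const_mul ρ)
            (((A.int (g - k)).const_mul B).const_mul K), integral_const_mul, integral_const_mul,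
            integral_const_mul, integral_const_mul] at h4
          have h9 : ρ * (B * ∫ x, nlWeight p (u x) (J g x) ∂ν) ≤ ρ * (B * C) := by
            gcongr
            exact hC g (hnorm _).le
          have h10 : p * 2 ^ (p - 1) * (ρ * (B * ∫ x, nlWeight p (u x) (J g x) ∂ν)
              + K * (B * ∫ x, nlWeight p (u x) (J (g - k) x) ∂ν)) ≤ p * 2 ^ (p - 1) * (ρ * (B * C)
              + K * (B * ∫ x, nlWeight p (u x) (J (g - k) x) ∂ν)) := by gcongr
          linarith
        linarith
      have hl : Tendsto (fun n => R ^ 2 / 2 - M (φ n) - p * 2 ^ (p - 1) * (ρ * (B * C)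
          + K * (B * ∫ x, nlWeight p (u x) (J (h (φ n) - k) x) ∂ν))) atTop
          (𝓝 (R ^ 2 / 2 - c - p * 2 ^ (p - 1) * (ρ * (B * C) + K * (B * 0)))) :=
        (tendsto_const_nhds.sub (hMlim.comp hφ.tendsto_atTop)).sub
          (((hlim.const_mul B).const_mul K).const_add _ |>.const_mul _)
      have := le_of_tendsto' hl hn
      simpa using this
    have hl : Tendsto (fun ρ : ℝ => R ^ 2 / 2 - c - p * 2 ^ (p - 1) * (ρ * (B * C))) (𝓝[>] 0)
        (𝓝 (R ^ 2 / 2 - c)) := by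
      have : Continuous fun ρ : ℝ => R ^ 2 / 2 - c - p * 2 ^ (p - 1) * (ρ * (B * C)) := by fun_prop
      have := (this.tendsto 0).mono_left (nhdsWithin_le_nhds (s := Set.Ioi 0))
      simpa using this
    refine le_of_tendsto hl ?_
    filter_upwards [self_mem_nhdsWithin] with ρ hρ using key ρ hρ
  have hc0 : 0 ≤ c := le_csInf hSne hS0
  -- At k = 0 the potential vanishes, but R = c + 2 makes R²/2 - c positive.
  have hk0 : k ≠ 0 := by
    rintro rfl
    have := hpot (c + 2) (by linarith)
    have h0 : potential J p u (0 : H) = 0 := by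
      simpa [action] using action_zero (J := J) (p := p) (u := u)
    rw [smul_zero, h0] at this
    nlinarith
  have hkc : ∀ t : ℝ, 0 ≤ t → action J p u (t • k) ≤ c := by
    intro t ht
    have := hpot t ht
    rw [action_smul]
    have h1 : ‖k‖ ^ 2 ≤ 1 := pow_le_one₀ (norm_nonneg _) hk1
    nlinarith [sq_nonneg t]
  obtain ⟨t₀, ht₀, hmax⟩ := A.exists_max_ray (not_nonpos_of_bounded_ray hk0 hkc)
  have hmin : ∀ w : H, w ≠ 0 → ∀ M : ℝ, (∀ t : ℝ, 0 ≤ t → action J p u (t • w) ≤ M) → c ≤ M :=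
    fun w hw M hM => csInf_le hSbdd ⟨w, hw, hM⟩
  -- The ray of k is itself a competitor, so its maximum cannot lie below c. Thus t₀ k realises the
  -- minimax level.
  have hval : action J p u (t₀ • k) = c := le_antisymm (hkc t₀ ht₀) (hmin k hk0 _ hmax)
  obtain ⟨t, ht, htpos⟩ := A.exists_action_pos (hst k hk0)
  have hcpos : 0 < c := htpos.trans_le (hkc t ht)
  have hray : ∀ t : ℝ, 0 ≤ t → action J p u (t • t₀ • k) ≤ c := fun t ht => by
    rw [smul_smul]; exact hkc _ (by positivity)
  refine ⟨t₀ • k, ?_, fun ξ => le_antisymm (A.le_of_minimax hcpos hval hray hmin ξ) ?_⟩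
  · intro h0
    rw [h0, action_zero] at hval
    exact hcpos.ne hval
  · have := A.le_of_minimax hcpos hval hray hmin ((-1 : ℝ) • ξ)
    rw [nlPair_smul, inner_smul_right] at this
    linarith

end IsAdmissible

end Variational

/-! ### The distance to the boundary -/

section Geometry

variable {N : ℕ} {Ω : TopologicalSpace.Opens (Eucl N)}

theorem frontier_nonempty (hN : 0 < N) (hne : (Ω : Set (Eucl N)).Nonempty)
    (hb : Bornology.IsBounded (Ω : Set (Eucl N))) : (frontier (Ω : Set (Eucl N))).Nonempty := by
  have : Nonempty (Fin N) := ⟨⟨0, hN⟩⟩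
  rw [nonempty_frontier_iff]
  refine ⟨hne, fun h => ?_⟩
  rw [h] at hb
  exact NormedSpace.unbounded_univ ℝ (Eucl N) hb

theorem bdist_pos (hf : (frontier (Ω : Set (Eucl N))).Nonempty) {x : Eucl N} (hx : x ∈ Ω) :
    0 < bdist Ω x := by
  refine (isClosed_frontier.notMem_iff_infDist_pos hf).1 fun h => ?_
  rw [Ω.isOpen.frontier_eq] at h
  exact h.2 hx

theorem bdist_nonneg (x : Eucl N) : 0 ≤ bdist Ω x := Metric.infDist_nonneg

theorem continuous_bdist : Continuous (bdist Ω) := Metric.continuous_infDist_pt _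

@[fun_prop]
theorem measurable_bdist : Measurable (bdist Ω) := continuous_bdist.measurable

theorem bdist_le_add (x y : Eucl N) : bdist Ω x ≤ bdist Ω y + ‖x - y‖ := by
  rw [← dist_eq_norm]
  exact Metric.infDist_le_infDist_add_dist

theorem exists_bdist_le (hb : Bornology.IsBounded (Ω : Set (Eucl N))) :
    ∃ D : ℝ, 1 ≤ D ∧ ∀ x ∈ Ω, bdist Ω x ≤ D := by
  obtain ⟨R, hR⟩ := hb.subset_closedBall 0
  refine ⟨max 1 (bdist Ω 0 + R), le_max_left _ _, fun x hx => le_trans ?_ (le_max_right _ _)⟩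
  have h1 := bdist_le_add (Ω := Ω) x 0
  have h2 := hR hx
  rw [mem_closedBall_zero_iff] at h2
  rw [sub_zero] at h1
  linarith

variable {s γ : ℝ}

theorem min_rpow_le {d r a : ℝ} (hd : 0 < d) (hr : 0 < r) (ha : 0 ≤ a) (haγ : a ≤ γ) :
    min (d / r) 1 ^ γ ≤ d ^ a * r ^ (-a) := by
  have h0 : 0 < min (d / r) 1 := lt_min (by positivity) one_pos
  calc min (d / r) 1 ^ γ ≤ min (d / r) 1 ^ a :=
        Real.rpow_le_rpow_of_exponent_ge h0 (min_le_right _ _) haγ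
    _ ≤ (d / r) ^ a := Real.rpow_le_rpow h0.le (min_le_left _ _) ha
    _ = d ^ a * r ^ (-a) := by
        rw [Real.div_rpow hd.le hr.le, Real.rpow_neg hr.le, div_eq_mul_inv]

/-- Each factor min(δ/r, 1)^γ is at most (δ/r)^a for 0 ≤ a ≤ γ: boundary decay is traded for a
stronger singularity. The value a = 0 gives the bare Riesz kernel; a = γ(p-1)/(2p) is used in the
weighted Sobolev inequality. -/
theorem greenProfile_le (hf : (frontier (Ω : Set (Eucl N))).Nonempty) {a : ℝ} (ha : 0 ≤ a)
    (haγ : a ≤ γ) {x y : Eucl N} (hx : x ∈ Ω) (hy : y ∈ Ω) (hxy : x ≠ y) :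
    greenProfile Ω s γ x y
      ≤ bdist Ω x ^ a * bdist Ω y ^ a * ‖x - y‖ ^ (-((N : ℝ) - 2 * s + 2 * a)) := by
  have hr : 0 < ‖x - y‖ := norm_pos_iff.2 (sub_ne_zero.2 hxy)
  have hdx := bdist_pos hf hx
  have hdy := bdist_pos hf hy
  have h1 := min_rpow_le hdx hr ha haγ
  have h2 := min_rpow_le hdy hr ha haγ
  have h3 : 0 ≤ min (bdist Ω y / ‖x - y‖) 1 ^ γ := by positivity
  have e : ‖x - y‖ ^ (-((N : ℝ) - 2 * s + 2 * a))
      = 1 / ‖x - y‖ ^ ((N : ℝ) - 2 * s) * ‖x - y‖ ^ (-a) * ‖x - y‖ ^ (-a) := by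
    rw [one_div, ← Real.rpow_neg hr.le, ← Real.rpow_add hr, ← Real.rpow_add hr]
    congr 1; ring
  unfold greenProfile
  calc _ ≤ 1 / ‖x - y‖ ^ ((N : ℝ) - 2 * s) * (bdist Ω x ^ a * ‖x - y‖ ^ (-a))
        * (bdist Ω y ^ a * ‖x - y‖ ^ (-a)) := by gcongr
    _ = _ := by rw [e]; ring

/-- Moves the weight from y to x. If δ(y) ≤ 2|x-y|, the factor δ(x)/|x-y| compensates; otherwise
δ(y) ≤ 2δ(x), because δ is 1-Lipschitz. -/
theorem greenProfile_mul_le (hf : (frontier (Ω : Set (Eucl N))).Nonempty) (hγ : 0 ≤ γ)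
    {x y : Eucl N} (hx : x ∈ Ω) (hy : y ∈ Ω) (hxy : x ≠ y) :
    greenProfile Ω s γ x y * bdist Ω y ^ γ
      ≤ 2 ^ γ * bdist Ω x ^ γ * ‖x - y‖ ^ (-((N : ℝ) - 2 * s)) := by
  have hr : 0 < ‖x - y‖ := norm_pos_iff.2 (sub_ne_zero.2 hxy)
  have hdx := bdist_pos hf hx
  have hdy := bdist_pos hf hy
  have hmx : 0 ≤ min (bdist Ω x / ‖x - y‖) 1 := by positivity
  have hmy : 0 ≤ min (bdist Ω y / ‖x - y‖) 1 := by positivity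
  have key : min (bdist Ω x / ‖x - y‖) 1 * min (bdist Ω y / ‖x - y‖) 1 * bdist Ω y
      ≤ 2 * bdist Ω x := by
    rcases le_total (bdist Ω y) (2 * ‖x - y‖) with h | h
    · calc _ ≤ bdist Ω x / ‖x - y‖ * 1 * (2 * ‖x - y‖) := by
            gcongr
            · exact min_le_left _ _
            · exact min_le_right _ _
        _ = 2 * bdist Ω x := by field_simp
    · have h1 := bdist_le_add (Ω := Ω) y x
      rw [norm_sub_rev] at h1
      calc _ ≤ 1 * 1 * bdist Ω y := by
            gcongr
            · exact min_le_right _ _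
            · exact min_le_right _ _
        _ ≤ 2 * bdist Ω x := by linarith
  have h2 := Real.rpow_le_rpow (by positivity) key hγ
  rw [Real.mul_rpow (by positivity) hdy.le, Real.mul_rpow hmx hmy,
    Real.mul_rpow (by norm_num) hdx.le] at h2
  unfold greenProfile
  calc _ = 1 / ‖x - y‖ ^ ((N : ℝ) - 2 * s) * (min (bdist Ω x / ‖x - y‖) 1 ^ γ
        * min (bdist Ω y / ‖x - y‖) 1 ^ γ * bdist Ω y ^ γ) := by ring
    _ ≤ 1 / ‖x - y‖ ^ ((N : ℝ) - 2 * s) * (2 ^ γ * bdist Ω x ^ γ) := by gcongr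
    _ = _ := by rw [Real.rpow_neg hr.le]; ring

end Geometry

/-! ### Riesz kernels -/

section Riesz

variable {N : ℕ}

/-- The Riesz kernel `|z|^{-β}`, with the value `0` at the origin. -/
def rieszKernel (β : ℝ) (z : Eucl N) : ℝ≥0∞ :=
  if z = 0 then 0 else ENNReal.ofReal (‖z‖ ^ (-β))

@[fun_prop]
theorem measurable_rieszKernel (β : ℝ) : Measurable (rieszKernel (N := N) β) := by
  unfold rieszKernel
  exact Measurable.ite (measurableSet_singleton 0) measurable_const (by fun_prop)

theorem rieszKernel_neg (β : ℝ) (z : Eucl N) : rieszKernel β (-z) = rieszKernel β z := by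
  simp [rieszKernel]

theorem rieszKernel_rpow (β : ℝ) {q : ℝ} (hq : 0 < q) (z : Eucl N) :
    rieszKernel β z ^ q = rieszKernel (β * q) z := by
  unfold rieszKernel
  split_ifs with h
  · exact ENNReal.zero_rpow_of_pos hq
  · have : 0 < ‖z‖ := norm_pos_iff.2 h
    rw [ENNReal.ofReal_rpow_of_nonneg (by positivity) hq.le, ← Real.rpow_mul this.le, neg_mul]

theorem lintegral_rieszKernel_ball (hN : 0 < N) {β : ℝ} (hβ : β < N) (R : ℝ) :
    ∫⁻ z in Metric.ball (0 : Eucl N) R, rieszKernel β z < ∞ := by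
  have h1 : IntegrableOn (fun z : Eucl N => ‖z‖ ^ (-β)) (Metric.ball 0 R) volume := by
    refine integrableOn_ball_of_norm_le_rpow (C := 1) (α := β) ?_ ?_ ?_ ?_
    · simpa using Nat.succ_le_of_lt hN
    · simpa using hβ
    · refine Eventually.of_forall fun z => ?_
      rw [Real.norm_eq_abs, abs_of_nonneg (by positivity), one_mul]
    · exact Measurable.aestronglyMeasurable (by fun_prop)
  refine lt_of_le_of_lt (lintegral_mono fun z => ?_) h1.lintegral_lt_top
  unfold rieszKernel
  split_ifs
  · exact zero_le
  · exact le_rfl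

theorem setLIntegral_ball_sub (f : Eucl N → ℝ≥0∞) (x : Eucl N) (R : ℝ) :
    ∫⁻ y in Metric.ball x R, f (x - y) = ∫⁻ z in Metric.ball (0 : Eucl N) R, f z := by
  rw [← lintegral_indicator Metric.isOpen_ball.measurableSet,
    ← lintegral_indicator Metric.isOpen_ball.measurableSet,
    ← lintegral_sub_left_eq_self ((Metric.ball (0 : Eucl N) R).indicator f) x]
  refine lintegral_congr fun y => ?_
  by_cases h : y ∈ Metric.ball x R
  · rw [Set.indicator_of_mem h, Set.indicator_of_mem]
    rwa [mem_ball_zero_iff, norm_sub_rev, ← dist_eq_norm]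
  · rw [Set.indicator_of_notMem h, Set.indicator_of_notMem]
    rwa [mem_ball_zero_iff, norm_sub_rev, ← dist_eq_norm]

/-- Uniform bound for the Riesz potential of a bounded set. -/
theorem exists_lintegral_rieszKernel_le (hN : 0 < N) {E : Set (Eucl N)}
    (hE : Bornology.IsBounded E) {β : ℝ} (hβ : β < N) :
    ∃ A : ℝ≥0∞, A < ∞ ∧ ∀ x ∈ E, ∫⁻ y in E, rieszKernel β (x - y) ≤ A := by
  obtain ⟨R, hR⟩ := hE.subset_ball 0
  refine ⟨∫⁻ z in Metric.ball (0 : Eucl N) (2 * R), rieszKernel β z,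
    lintegral_rieszKernel_ball hN hβ _, fun x hx => ?_⟩
  rw [← setLIntegral_ball_sub _ x]
  refine lintegral_mono_set fun y hy => ?_
  have h1 := hR hx
  have h2 := hR hy
  rw [mem_ball_zero_iff] at h1 h2
  rw [Metric.mem_ball, dist_eq_norm]
  have := norm_sub_le y x
  linarith

/-- The Riesz potential of small balls is uniformly small. -/
theorem exists_lintegral_rieszKernel_ball_le (hN : 0 < N) {β : ℝ} (hβ : β < N) {η : ℝ≥0∞}
    (hη : η ≠ 0) :
    ∃ ε > 0, ∀ x : Eucl N, ∫⁻ y in Metric.ball x ε, rieszKernel β (x - y) ≤ η := by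
  have hfin := lintegral_rieszKernel_ball hN hβ 1
  obtain ⟨δ, hδ, h⟩ := exists_pos_setLIntegral_lt_of_measure_lt hfin.ne hη
  have hlim : Tendsto (fun ε : ℝ => volume (Metric.ball (0 : Eucl N) ε)) (𝓝[>] 0) (𝓝 0) := by
    have e : (fun ε : ℝ => volume (Metric.ball (0 : Eucl N) ε)) =ᶠ[𝓝[>] 0]
        fun ε => ENNReal.ofReal (ε ^ N) * volume (Metric.ball (0 : Eucl N) 1) := by
      have : Nonempty (Fin N) := ⟨⟨0, hN⟩⟩
      filter_upwards [self_mem_nhdsWithin] with ε hε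
      rw [Measure.addHaar_ball volume 0 (le_of_lt hε)]
      simp
    rw [tendsto_congr' e]
    have h1 : Tendsto (fun ε : ℝ => ENNReal.ofReal (ε ^ N)) (𝓝 0) (𝓝 0) := by
      have : Continuous fun ε : ℝ => ENNReal.ofReal (ε ^ N) :=
        ENNReal.continuous_ofReal.comp (continuous_pow N)
      simpa [hN.ne'] using this.tendsto 0
    have := ENNReal.Tendsto.mul_const (b := volume (Metric.ball (0 : Eucl N) 1))
      (h1.mono_left (nhdsWithin_le_nhds (s := Set.Ioi 0)))
      (Or.inr (measure_ball_lt_top (μ := volume)).ne)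
    simpa using this
  obtain ⟨ε, ⟨h1, h2⟩, h3⟩ := ((((hlim.eventually (gt_mem_nhds hδ))).and
    (Ioo_mem_nhdsGT (one_pos (α := ℝ)))).and self_mem_nhdsWithin).exists
  refine ⟨ε, h3, fun x => ?_⟩
  rw [setLIntegral_ball_sub (rieszKernel β) x]
  have h4 := h (Metric.ball 0 ε) ((Measure.restrict_apply_le _ _).trans_lt h1)
  rw [Measure.restrict_restrict Metric.isOpen_ball.measurableSet,
    Set.inter_eq_self_of_subset_left (Metric.ball_subset_ball h2.2.le)] at h4
  exact h4.le

end Riesz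

/-! ### The Green kernel with values in `[0, ∞]` -/

section Kernel

variable {N : ℕ} {Ω : TopologicalSpace.Opens (Eucl N)} {L : Test Ω →ₗ[ℝ] L2 Ω} {s γ : ℝ}
  {G : Eucl N → Eucl N → ℝ}

open Classical in
/-- The Green function, set to `0` on the diagonal and outside `Ω × Ω`. -/
def greenKernel (Ω : TopologicalSpace.Opens (Eucl N)) (G : Eucl N → Eucl N → ℝ)
    (x y : Eucl N) : ℝ≥0∞ :=
  if x ∈ Ω ∧ y ∈ Ω ∧ x ≠ y then ENNReal.ofReal (G x y) else 0

theorem greenKernel_of_mem {x y : Eucl N} (hx : x ∈ Ω) (hy : y ∈ Ω) (hxy : x ≠ y) :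
    greenKernel Ω G x y = ENNReal.ofReal (G x y) := by
  simp [greenKernel, hx, hy, hxy]

theorem greenKernel_lt_top (x y : Eucl N) : greenKernel Ω G x y < ∞ := by
  unfold greenKernel
  split_ifs
  · exact ENNReal.ofReal_lt_top
  · exact ENNReal.zero_lt_top

namespace IsGreenFunction

theorem measurable_kernel (hG : IsGreenFunction L s γ G) :
    Measurable (Function.uncurry (greenKernel Ω G)) := by
  unfold greenKernel
  refine Measurable.ite ?_ (ENNReal.measurable_ofReal.comp hG.measurable) measurable_const
  have hΩ : MeasurableSet (Ω : Set (Eucl N)) := Ω.isOpen.measurableSet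
  exact (measurable_fst hΩ).inter ((measurable_snd hΩ).inter
    (measurableSet_eq_fun measurable_fst measurable_snd).compl)

theorem kernel_symm (hG : IsGreenFunction L s γ G) (x y : Eucl N) :
    greenKernel Ω G x y = greenKernel Ω G y x := by
  by_cases h : x ∈ Ω ∧ y ∈ Ω ∧ x ≠ y
  · rw [greenKernel_of_mem h.1 h.2.1 h.2.2, greenKernel_of_mem h.2.1 h.1 h.2.2.symm,
      hG.symm x h.1 y h.2.1 h.2.2]
  · have h' : ¬ (y ∈ Ω ∧ x ∈ Ω ∧ y ≠ x) := fun h' => h ⟨h'.2.1, h'.1, h'.2.2.symm⟩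
    simp only [greenKernel, if_neg h, if_neg h']

theorem kernel_pos (hG : IsGreenFunction L s γ G) {x y : Eucl N} (hx : x ∈ Ω) (hy : y ∈ Ω)
    (hxy : x ≠ y) : 0 < greenKernel Ω G x y := by
  rw [greenKernel_of_mem hx hy hxy]
  exact ENNReal.ofReal_pos.2 (hG.pos x hx y hy hxy)

theorem kernel_le (hG : IsGreenFunction L s γ G)
    (hf : (frontier (Ω : Set (Eucl N))).Nonempty) :
    ∃ C : ℝ, 0 < C ∧ ∀ a : ℝ, 0 ≤ a → a ≤ γ → ∀ x ∈ Ω, ∀ y ∈ Ω, greenKernel Ω G x y ≤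
      ENNReal.ofReal (C * bdist Ω x ^ a * bdist Ω y ^ a)
        * rieszKernel ((N : ℝ) - 2 * s + 2 * a) (x - y) := by
  obtain ⟨C, hC, h⟩ := hG.estimate
  refine ⟨C, hC, fun a ha haγ x hx y hy => ?_⟩
  by_cases hxy : x = y
  · simp [greenKernel, hxy]
  have hdx := bdist_pos hf hx
  have hdy := bdist_pos hf hy
  rw [greenKernel_of_mem hx hy hxy, rieszKernel, if_neg (sub_ne_zero.2 hxy),
    ← ENNReal.ofReal_mul (by positivity)]
  refine ENNReal.ofReal_le_ofReal ((h x hx y hy hxy).2.trans ?_)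
  rw [mul_assoc, mul_assoc]
  gcongr
  rw [← mul_assoc]
  exact greenProfile_le hf ha haγ hx hy hxy

theorem kernel_mul_le (hG : IsGreenFunction L s γ G) (hγ : 0 ≤ γ)
    (hf : (frontier (Ω : Set (Eucl N))).Nonempty) :
    ∃ C : ℝ, 0 < C ∧ ∀ x ∈ Ω, ∀ y ∈ Ω,
      greenKernel Ω G x y * ENNReal.ofReal (bdist Ω y ^ γ) ≤
      ENNReal.ofReal (C * bdist Ω x ^ γ) * rieszKernel ((N : ℝ) - 2 * s) (x - y) := by
  obtain ⟨C, hC, h⟩ := hG.estimate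
  refine ⟨C * 2 ^ γ, by positivity, fun x hx y hy => ?_⟩
  by_cases hxy : x = y
  · simp [greenKernel, hxy]
  have hdx := bdist_pos hf hx
  have hdy := bdist_pos hf hy
  rw [greenKernel_of_mem hx hy hxy, rieszKernel, if_neg (sub_ne_zero.2 hxy),
    ← ENNReal.ofReal_mul (hG.pos x hx y hy hxy).le, ← ENNReal.ofReal_mul (by positivity)]
  refine ENNReal.ofReal_le_ofReal ?_
  have h1 := greenProfile_mul_le (s := s) hf hγ hx hy hxy
  calc G x y * bdist Ω y ^ γ ≤ C * greenProfile Ω s γ x y * bdist Ω y ^ γ := by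
        gcongr
        exact (h x hx y hy hxy).2
    _ = C * (greenProfile Ω s γ x y * bdist Ω y ^ γ) := by ring
    _ ≤ C * (2 ^ γ * bdist Ω x ^ γ * ‖x - y‖ ^ (-((N : ℝ) - 2 * s))) := by gcongr
    _ = _ := by ring

/-- `sup_x ∫_Ω G(x, y) dy < ∞`. -/
theorem exists_lintegral_kernel_le (hG : IsGreenFunction L s γ G) (hs : 0 < s) (hγ : 0 ≤ γ)
    (hN : 0 < N) (hf : (frontier (Ω : Set (Eucl N))).Nonempty)
    (hb : Bornology.IsBounded (Ω : Set (Eucl N))) :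
    ∃ A : ℝ≥0∞, A < ∞ ∧ ∀ x ∈ Ω, ∫⁻ y in (Ω : Set (Eucl N)), greenKernel Ω G x y ≤ A := by
  obtain ⟨C, hC, h⟩ := hG.kernel_le hf
  obtain ⟨A, hA, h2⟩ := exists_lintegral_rieszKernel_le hN hb
    (β := (N : ℝ) - 2 * s + 2 * 0) (by linarith)
  refine ⟨ENNReal.ofReal C * A, ENNReal.mul_lt_top ENNReal.ofReal_lt_top hA, fun x hx => ?_⟩
  calc _ ≤ ∫⁻ y in (Ω : Set (Eucl N)),
        ENNReal.ofReal C * rieszKernel ((N : ℝ) - 2 * s + 2 * 0) (x - y) := by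
        refine setLIntegral_mono (by fun_prop) fun y hy => ?_
        simpa using h 0 le_rfl hγ x hx y hy
    _ ≤ _ := by
        rw [lintegral_const_mul _ (by fun_prop)]
        gcongr
        exact h2 x hx

/-- The part of `∫_Ω G(x, y) dy` near the diagonal is uniformly small. -/
theorem exists_lintegral_kernel_ball_le (hG : IsGreenFunction L s γ G) (hs : 0 < s) (hγ : 0 ≤ γ)
    (hN : 0 < N) (hf : (frontier (Ω : Set (Eucl N))).Nonempty) {η : ℝ≥0∞} (hη : η ≠ 0) :
    ∃ ε > 0, ∀ x ∈ Ω, ∫⁻ y in (Ω : Set (Eucl N)) ∩ Metric.ball x ε, greenKernel Ω G x y ≤ η := by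
  obtain ⟨C, hC, h⟩ := hG.kernel_le hf
  have hC' : ENNReal.ofReal C ≠ 0 := by simpa using hC
  obtain ⟨ε, hε, h2⟩ := exists_lintegral_rieszKernel_ball_le hN
    (β := (N : ℝ) - 2 * s + 2 * 0) (by linarith) (η := η / ENNReal.ofReal C)
    (by simp [ENNReal.div_eq_zero_iff, hη])
  refine ⟨ε, hε, fun x hx => ?_⟩
  calc _ ≤ ∫⁻ y in (Ω : Set (Eucl N)) ∩ Metric.ball x ε,
        ENNReal.ofReal C * rieszKernel ((N : ℝ) - 2 * s + 2 * 0) (x - y) := by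
        refine setLIntegral_mono (by fun_prop) fun y hy => ?_
        simpa using h 0 le_rfl hγ x hx y hy.1
    _ ≤ ENNReal.ofReal C * (η / ENNReal.ofReal C) := by
        rw [lintegral_const_mul _ (by fun_prop)]
        gcongr
        exact (lintegral_mono_set Set.inter_subset_right).trans (h2 x)
    _ = η := ENNReal.mul_div_cancel hC' ENNReal.ofReal_ne_top

theorem kernel_bounded_off_diagonal (hG : IsGreenFunction L s γ G) (hγ : 0 ≤ γ)
    (hN : 2 * s < N) (hf : (frontier (Ω : Set (Eucl N))).Nonempty) {ε : ℝ} (hε : 0 < ε) :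
    ∃ B : ℝ, 0 ≤ B ∧ ∀ x ∈ Ω, ∀ y ∈ Ω, y ∉ Metric.ball x ε →
      greenKernel Ω G x y ≤ ENNReal.ofReal B := by
  obtain ⟨C, hC, h⟩ := hG.kernel_le hf
  refine ⟨C * ε ^ (-((N : ℝ) - 2 * s + 2 * 0)), by positivity, fun x hx y hy hxy => ?_⟩
  refine (h 0 le_rfl hγ x hx y hy).trans ?_
  rw [Metric.mem_ball, not_lt, dist_eq_norm, norm_sub_rev] at hxy
  have : x - y ≠ 0 := by
    intro h0
    rw [h0, norm_zero] at hxy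
    linarith
  rw [Real.rpow_zero, Real.rpow_zero, mul_one, mul_one, rieszKernel, if_neg this,
    ← ENNReal.ofReal_mul hC.le]
  refine ENNReal.ofReal_le_ofReal ?_
  gcongr C * ?_
  exact Real.rpow_le_rpow_of_nonpos hε hxy (by linarith)

/-- `∫_Ω G(x, y) δ(y)^γ dy ≤ A δ(x)^γ`. -/
theorem exists_lintegral_kernel_mul_le (hG : IsGreenFunction L s γ G) (hs : 0 < s) (hγ : 0 ≤ γ)
    (hN : 0 < N) (hf : (frontier (Ω : Set (Eucl N))).Nonempty)
    (hb : Bornology.IsBounded (Ω : Set (Eucl N))) :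
    ∃ A : ℝ≥0∞, A < ∞ ∧ ∀ x ∈ Ω, ∫⁻ y in (Ω : Set (Eucl N)),
      greenKernel Ω G x y * ENNReal.ofReal (bdist Ω y ^ γ)
        ≤ A * ENNReal.ofReal (bdist Ω x ^ γ) := by
  obtain ⟨C, hC, h⟩ := hG.kernel_mul_le hγ hf
  obtain ⟨A, hA, h2⟩ := exists_lintegral_rieszKernel_le hN hb
    (β := (N : ℝ) - 2 * s) (by linarith)
  refine ⟨ENNReal.ofReal C * A, ENNReal.mul_lt_top ENNReal.ofReal_lt_top hA, fun x hx => ?_⟩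
  calc _ ≤ ∫⁻ y in (Ω : Set (Eucl N)),
        ENNReal.ofReal (C * bdist Ω x ^ γ) * rieszKernel ((N : ℝ) - 2 * s) (x - y) :=
        setLIntegral_mono (by fun_prop) fun y hy => h x hx y hy
    _ ≤ ENNReal.ofReal (C * bdist Ω x ^ γ) * A := by
        rw [lintegral_const_mul _ (by fun_prop)]
        gcongr
        exact h2 x hx
    _ = _ := by rw [ENNReal.ofReal_mul hC.le]; ring

end IsGreenFunction

end Kernel

/-! ### The energy space as a Hilbert space -/

section EnergySpace

variable {N : ℕ} {Ω : TopologicalSpace.Opens (Eucl N)} {L : Test Ω →ₗ[ℝ] L2 Ω}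

/-- A copy of `C_c^∞(Ω)`, to carry the seminorm of the quadratic form. -/
def PreEnergy (Ω : TopologicalSpace.Opens (Eucl N)) : Type := Test Ω

instance : AddCommGroup (PreEnergy Ω) := inferInstanceAs (AddCommGroup (Test Ω))

instance : Module ℝ (PreEnergy Ω) := inferInstanceAs (Module ℝ (Test Ω))

/-- The quadratic form as a semi-inner product. -/
abbrev preEnergyCore (hL : IsPositiveSymmetric L) :
    PreInnerProductSpace.Core ℝ (PreEnergy Ω) where
  inner φ ψ := form L φ ψ
  conj_inner_symm φ ψ := hL.symm ψ φ
  re_inner_nonneg φ := hL.nonneg φ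
  add_left φ ψ χ := by
    have := (form L).map_add φ ψ
    exact congrArg (fun l => l χ) this
  smul_left φ ψ r := by
    have := (form L).map_smul r φ
    exact congrArg (fun l => l ψ) this

theorem formApprox_const (φ : Test Ω) : FormApprox L (fun _ => φ) (testToL2 Ω φ) :=
  ⟨tendsto_const_nhds, fun ε hε => ⟨0, fun _ _ _ _ => by simpa using hε⟩⟩

theorem testToL2_mem_formDomain (φ : Test Ω) : testToL2 Ω φ ∈ formDomain L :=
  ⟨_, formApprox_const φ⟩

/-- If the form controls the `L²` norm, the form domain is the injective image of a Hilbert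
space. -/
theorem exists_energySpace (hL : IsPositiveSymmetric L) {A : ℝ} (hA : 0 ≤ A)
    (h : ∀ φ, ‖testToL2 Ω φ‖ ^ 2 ≤ A * form L φ φ) :
    ∃ (H : Type) (_ : NormedAddCommGroup H) (_ : InnerProductSpace ℝ H) (_ : CompleteSpace H)
      (J : H →L[ℝ] L2 Ω), (∀ h, J h ∈ formDomain L) ∧ (∀ u ∈ formDomain L, ∃ h, J h = u) ∧
        ∀ h k, formInner L (J h) (J k) = inner ℝ h k := by
  let c := preEnergyCore hL
  let : SeminormedAddCommGroup (PreEnergy Ω) :=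
    @InnerProductSpace.Core.toSeminormedAddCommGroup ℝ _ _ _ _ c
  let : InnerProductSpace ℝ (PreEnergy Ω) := InnerProductSpace.ofCore c
  have hin : ∀ φ ψ : PreEnergy Ω, inner ℝ φ ψ = form L φ ψ := fun _ _ => rfl
  have hnorm : ∀ φ : PreEnergy Ω, ‖φ‖ ^ 2 = form L φ φ := fun φ => by
    rw [← hin, real_inner_self_eq_norm_sq]
  let T : PreEnergy Ω →ₗ[ℝ] L2 Ω :=
    { toFun := fun φ => testToL2 Ω φ
      map_add' := fun φ ψ => (testToL2 Ω).map_add φ ψ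
      map_smul' := fun r φ => (testToL2 Ω).map_smul r φ }
  let J₀ : PreEnergy Ω →L[ℝ] L2 Ω := T.mkContinuous (√A) fun φ => by
    refine abs_le_of_sq_le_sq' ?_ (by positivity) |>.2
    rw [mul_pow, Real.sq_sqrt hA, hnorm]
    exact h φ
  let e : PreEnergy Ω →L[ℝ] UniformSpace.Completion (PreEnergy Ω) :=
    UniformSpace.Completion.toComplL
  have hdense : DenseRange e := UniformSpace.Completion.denseRange_coe
  have hind : IsUniformInducing e := UniformSpace.Completion.isUniformInducing_coe _
  let J : UniformSpace.Completion (PreEnergy Ω) →L[ℝ] L2 Ω := J₀.extend e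
  have hJ : ∀ φ : PreEnergy Ω, J (e φ) = testToL2 Ω φ := fun φ =>
    ContinuousLinearMap.extend_eq J₀ hdense hind φ
  have heinner : ∀ φ ψ : PreEnergy Ω, inner ℝ (e φ) (e ψ) = form L φ ψ := fun φ ψ =>
    UniformSpace.Completion.inner_coe φ ψ
  have henorm : ∀ φ : PreEnergy Ω, ‖e φ‖ ^ 2 = form L φ φ := fun φ => by
    rw [← heinner, real_inner_self_eq_norm_sq]
  -- A sequence converging to x in the abstract completion is also an approximating sequence of J x,
  -- so the two descriptions of ℍ can be compared along common sequences.
  have happ : ∀ x, ∃ φ : ℕ → Test Ω, Tendsto (fun n => e (φ n)) atTop (𝓝 x) ∧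
      FormApprox L φ (J x) := by
    intro x
    obtain ⟨y, hy, hlim⟩ := mem_closure_iff_seq_limit.1 (hdense x)
    choose φ hφ using hy
    have hlim' : Tendsto (fun n => e (φ n)) atTop (𝓝 x) := by
      simpa only [hφ] using hlim
    refine ⟨φ, hlim', ?_, ?_⟩
    · have := (J.continuous.tendsto x).comp hlim'
      refine this.congr fun n => hJ (φ n)
    · intro ε hε
      have hc := hlim'.cauchySeq
      rw [Metric.cauchySeq_iff] at hc
      obtain ⟨n₀, h₀⟩ := hc (√ε) (Real.sqrt_pos.2 hε)
      refine ⟨n₀, fun m hm n hn => ?_⟩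
      have h1 := h₀ m hm n hn
      rw [dist_eq_norm, ← map_sub] at h1
      refine lt_of_eq_of_lt (henorm (φ m - φ n)).symm ?_
      calc ‖e (φ m - φ n)‖ ^ 2 < √ε ^ 2 := by gcongr
        _ = ε := Real.sq_sqrt hε.le
  refine ⟨UniformSpace.Completion (PreEnergy Ω), inferInstance, inferInstance, inferInstance, J,
    fun x => ?_, fun u hu => ?_, fun x y => ?_⟩
  · obtain ⟨φ, -, hφ⟩ := happ x
    exact ⟨φ, hφ⟩
  · obtain ⟨φ₀, hφ⟩ := hu
    obtain ⟨φ, rfl⟩ : ∃ φ : ℕ → PreEnergy Ω, φ = φ₀ := ⟨φ₀, rfl⟩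
    -- The second clause of `FormApprox` is exactly the Cauchy property in the completion; its limit
    -- is the preimage.
    have hc : CauchySeq fun n => e (φ n) := by
      rw [Metric.cauchySeq_iff]
      intro ε hε
      obtain ⟨n₀, h₀⟩ := hφ.2 (ε ^ 2) (by positivity)
      refine ⟨n₀, fun m hm n hn => ?_⟩
      rw [dist_eq_norm, ← map_sub]
      refine lt_of_pow_lt_pow_left₀ 2 hε.le ?_
      exact lt_of_eq_of_lt (henorm _) (h₀ m hm n hn)
    obtain ⟨x, hx⟩ := cauchySeq_tendsto_of_complete hc
    refine ⟨x, tendsto_nhds_unique ?_ hφ.1⟩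
    exact ((J.continuous.tendsto x).comp hx).congr fun n => hJ (φ n)
  · obtain ⟨φ, hφ, hφ'⟩ := happ x
    obtain ⟨ψ, hψ, hψ'⟩ := happ y
    refine tendsto_nhds_unique (form_tendsto_formInner hL hφ' hψ') ?_
    exact (hφ.inner hψ).congr fun n => heinner _ _

end EnergySpace

/-! ### The Green operator on `L²` -/

section GreenOperator

variable {N : ℕ} {Ω : TopologicalSpace.Opens (Eucl N)} {L : Test Ω →ₗ[ℝ] L2 Ω} {s γ : ℝ}
  {G : Eucl N → Eucl N → ℝ}

/-- `∫_Ω G(x, y) f(y) dy` for `f ≥ 0`, with values in `[0, ∞]`. -/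
def greenPotential (Ω : TopologicalSpace.Opens (Eucl N)) (G : Eucl N → Eucl N → ℝ)
    (f : Eucl N → ℝ≥0∞) (x : Eucl N) : ℝ≥0∞ :=
  ∫⁻ y in (Ω : Set (Eucl N)), greenKernel Ω G x y * f y

theorem ae_ne_restrict (hN : 0 < N) (x : Eucl N) :
    ∀ᵐ y ∂volume.restrict (Ω : Set (Eucl N)), y ≠ x := by
  have : Nonempty (Fin N) := ⟨⟨0, hN⟩⟩
  refine ae_restrict_of_ae ?_
  rw [ae_iff]
  simp

theorem greenOp_eq (hG : IsGreenFunction L s γ G) (hN : 0 < N) (f : Eucl N → ℝ) {x : Eucl N}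
    (hx : x ∈ Ω) :
    greenOp Ω G f x = ∫ y in (Ω : Set (Eucl N)), (greenKernel Ω G x y).toReal * f y := by
  refine integral_congr_ae ?_
  filter_upwards [ae_ne_restrict hN x, ae_restrict_mem Ω.isOpen.measurableSet] with y hy hyΩ
  rw [greenKernel_of_mem hx hyΩ hy.symm, ENNReal.toReal_ofReal (hG.pos x hx y hyΩ hy.symm).le]

theorem enorm_kernel_mul (x y : Eucl N) (t : ℝ) :
    ‖(greenKernel Ω G x y).toReal * t‖ₑ = greenKernel Ω G x y * ‖t‖ₑ := by
  rw [enorm_mul, Real.enorm_eq_ofReal ENNReal.toReal_nonneg,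
    ENNReal.ofReal_toReal (greenKernel_lt_top x y).ne]

theorem enorm_greenOp_le (hG : IsGreenFunction L s γ G) (hN : 0 < N) (f : Eucl N → ℝ) {x : Eucl N}
    (hx : x ∈ Ω) : ‖greenOp Ω G f x‖ₑ ≤ greenPotential Ω G (fun y => ‖f y‖ₑ) x := by
  rw [greenOp_eq hG hN f hx]
  refine (enorm_integral_le_lintegral_enorm _).trans (le_of_eq ?_)
  exact lintegral_congr fun y => enorm_kernel_mul x y (f y)

theorem measurable_kernel_left (hG : IsGreenFunction L s γ G) (x : Eucl N) :
    Measurable (greenKernel Ω G x) := hG.measurable_kernel.of_uncurry_left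

theorem measurable_greenPotential (hG : IsGreenFunction L s γ G) {f : Eucl N → ℝ≥0∞}
    (hf : Measurable f) : Measurable (greenPotential Ω G f) := by
  unfold greenPotential
  refine Measurable.lintegral_prod_right ?_
  exact hG.measurable_kernel.mul (hf.comp measurable_snd)

theorem greenPotential_congr {f g : Eucl N → ℝ≥0∞}
    (h : f =ᵐ[volume.restrict (Ω : Set (Eucl N))] g) (x : Eucl N) :
    greenPotential Ω G f x = greenPotential Ω G g x := by
  refine lintegral_congr_ae ?_
  filter_upwards [h] with y hy
  rw [hy]

theorem aemeasurable_greenPotential (hG : IsGreenFunction L s γ G) {f : Eucl N → ℝ≥0∞}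
    (hf : AEMeasurable f (volume.restrict (Ω : Set (Eucl N)))) :
    Measurable (greenPotential Ω G f) := by
  have : greenPotential Ω G f = greenPotential Ω G (hf.mk f) :=
    funext fun x => greenPotential_congr hf.ae_eq_mk x
  rw [this]
  exact measurable_greenPotential hG hf.measurable_mk

theorem mul_greenPotential (hG : IsGreenFunction L s γ G) {f : Eucl N → ℝ≥0∞}
    (hf : AEMeasurable f (volume.restrict (Ω : Set (Eucl N)))) (c : ℝ≥0∞) (x : Eucl N) :
    c * greenPotential Ω G f x
      = ∫⁻ y in (Ω : Set (Eucl N)), c * (greenKernel Ω G x y * f y) :=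
  (lintegral_const_mul'' c ((measurable_kernel_left hG x).aemeasurable.mul hf)).symm

theorem greenPotential_symm (hG : IsGreenFunction L s γ G) {f g : Eucl N → ℝ≥0∞}
    (hf : AEMeasurable f (volume.restrict (Ω : Set (Eucl N))))
    (hg : AEMeasurable g (volume.restrict (Ω : Set (Eucl N)))) :
    ∫⁻ x in (Ω : Set (Eucl N)), f x * greenPotential Ω G g x
      = ∫⁻ x in (Ω : Set (Eucl N)), g x * greenPotential Ω G f x := by
  simp only [mul_greenPotential hG hf, mul_greenPotential hG hg]
  rw [lintegral_lintegral_swap]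
  · refine lintegral_congr fun y => lintegral_congr fun x => ?_
    rw [hG.kernel_symm x y]; ring
  · exact (hf.comp_fst).mul (hG.measurable_kernel.aemeasurable.mul hg.comp_snd)

/-- Weighted Schur test. -/
theorem schur_test (hG : IsGreenFunction L s γ G) {f ω : Eucl N → ℝ≥0∞}
    (hf : AEMeasurable f (volume.restrict (Ω : Set (Eucl N))))
    (hω : AEMeasurable ω (volume.restrict (Ω : Set (Eucl N))))
    (hω0 : ∀ᵐ x ∂volume.restrict (Ω : Set (Eucl N)), ω x ≠ 0 ∧ ω x ≠ ∞) :
    ∫⁻ x in (Ω : Set (Eucl N)), f x * greenPotential Ω G f x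
      ≤ ∫⁻ x in (Ω : Set (Eucl N)), f x ^ 2 / ω x * greenPotential Ω G ω x := by
  set ν := volume.restrict (Ω : Set (Eucl N))
  have hg : AEMeasurable (fun x => f x ^ 2 / ω x) ν := (hf.pow_const 2).div hω
  -- The difference of the two sides is (ad - cb)²/(bd) when all values are finite.
  have key : ∀ a b c d : ℝ≥0∞, b ≠ 0 → b ≠ ∞ → d ≠ 0 → d ≠ ∞ →
      2 * (a * c) ≤ a ^ 2 / b * d + c ^ 2 / d * b := by
    intro a b c d hb hb' hd hd'
    rcases eq_or_ne a ∞ with rfl | ha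
    · have : (∞ : ℝ≥0∞) ^ 2 / b * d = ∞ := by
        rw [ENNReal.top_pow two_ne_zero, ENNReal.top_div_of_ne_top hb', ENNReal.top_mul hd]
      rw [this]; simp
    rcases eq_or_ne c ∞ with rfl | hc
    · have : (∞ : ℝ≥0∞) ^ 2 / d * b = ∞ := by
        rw [ENNReal.top_pow two_ne_zero, ENNReal.top_div_of_ne_top hd', ENNReal.top_mul hb]
      rw [this]; simp
    lift a to NNReal using ha
    lift b to NNReal using hb'
    lift c to NNReal using hc
    lift d to NNReal using hd'
    have hb0 : b ≠ 0 := by simpa using hb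
    have hd0 : d ≠ 0 := by simpa using hd
    rw [← ENNReal.coe_pow, ← ENNReal.coe_pow, ← ENNReal.coe_div hb0, ← ENNReal.coe_div hd0]
    norm_cast
    rw [← NNReal.coe_le_coe]
    push_cast
    have hb1 : (0 : ℝ) < b := by positivity
    have hd1 : (0 : ℝ) < d := by positivity
    have : (a : ℝ) ^ 2 / b * d + c ^ 2 / d * b - 2 * (a * c) = (a * d - c * b) ^ 2 / (b * d) := by
      field_simp; ring
    have h2 : 0 ≤ ((a : ℝ) * d - c * b) ^ 2 / (b * d) := by positivity
    linarith
  -- Insert `key` under the double integral. By symmetry of the kernel the two resulting terms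
  -- coincide, which cancels the factor 2.
  have h1 : 2 * ∫⁻ x, f x * greenPotential Ω G f x ∂ν
      ≤ ∫⁻ x, f x ^ 2 / ω x * greenPotential Ω G ω x ∂ν
        + ∫⁻ x, ω x * greenPotential Ω G (fun x => f x ^ 2 / ω x) x ∂ν := by
    have m1 : AEMeasurable (fun x => f x ^ 2 / ω x * greenPotential Ω G ω x) ν :=
      hg.mul (aemeasurable_greenPotential hG hω).aemeasurable
    rw [← lintegral_const_mul' _ _ ENNReal.ofNat_ne_top, ← lintegral_add_left' m1]
    refine lintegral_mono_ae ?_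
    filter_upwards [hω0] with x hx
    have m2 : AEMeasurable (fun y => f x ^ 2 / ω x * (greenKernel Ω G x y * ω y)) ν :=
      ((measurable_kernel_left hG x).aemeasurable.mul hω).const_mul _
    rw [mul_greenPotential hG hf, mul_greenPotential hG hω, mul_greenPotential hG hg,
      ← lintegral_const_mul' _ _ ENNReal.ofNat_ne_top, ← lintegral_add_left' m2]
    refine lintegral_mono_ae ?_
    filter_upwards [hω0] with y hy
    calc 2 * (f x * (greenKernel Ω G x y * f y)) = greenKernel Ω G x y * (2 * (f x * f y)) := by
          ring
      _ ≤ greenKernel Ω G x y * (f x ^ 2 / ω x * ω y + f y ^ 2 / ω y * ω x) := by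
          gcongr
          exact key _ _ _ _ hx.1 hx.2 hy.1 hy.2
      _ = _ := by ring
  rw [greenPotential_symm hG hω hg, ← two_mul] at h1
  exact (ENNReal.mul_le_mul_iff_right two_ne_zero ENNReal.ofNat_ne_top).1 h1

end GreenOperator

/-! ### The Green function as kernel of the solution operator, and duality -/

section Representation

variable {N : ℕ} {Ω : TopologicalSpace.Opens (Eucl N)} {L : Test Ω →ₗ[ℝ] L2 Ω} {s γ : ℝ}
  {G : Eucl N → Eucl N → ℝ}

/-- Schur test for a symmetric kernel with bounded marginals. -/
theorem lintegral_mul_kernel_le {X : Type*} [MeasurableSpace X] {ν : Measure X} [SFinite ν]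
    {K : X → X → ℝ≥0∞} (hK : Measurable (Function.uncurry K)) (hs : ∀ x y, K x y = K y x)
    {A : ℝ≥0∞} (hA : ∀ᵐ x ∂ν, ∫⁻ y, K x y ∂ν ≤ A) {f g : X → ℝ≥0∞} (hf : AEMeasurable f ν)
    (hg : AEMeasurable g ν) :
    ∫⁻ x, f x * ∫⁻ y, K x y * g y ∂ν ∂ν ≤ A * (∫⁻ x, f x ^ 2 ∂ν) + A * ∫⁻ x, g x ^ 2 ∂ν := by
  have key : ∀ a b : ℝ≥0∞, a * b ≤ a ^ 2 + b ^ 2 := fun a b => by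
    rw [sq, sq]
    rcases le_total a b with h | h
    · exact (mul_le_mul' h le_rfl).trans le_add_self
    · exact (mul_le_mul' le_rfl h).trans le_self_add
  have hm : ∀ x, AEMeasurable (fun y => K x y) ν := fun x =>
    (hK.of_uncurry_left (x := x)).aemeasurable
  have hb : ∀ h : X → ℝ≥0∞, AEMeasurable h ν →
      ∫⁻ x, ∫⁻ y, h x ^ 2 * K x y ∂ν ∂ν ≤ A * ∫⁻ x, h x ^ 2 ∂ν := fun h hh => by
    rw [← lintegral_const_mul'' _ (hh.pow_const 2)]
    refine lintegral_mono_ae ?_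
    filter_upwards [hA] with x hx
    rw [lintegral_const_mul'' _ (hm x), mul_comm]
    gcongr
  have m1 : AEMeasurable (Function.uncurry fun x y => f x ^ 2 * K x y) (ν.prod ν) :=
    (hf.comp_fst.pow_const 2).mul hK.aemeasurable
  have m2 : AEMeasurable (Function.uncurry fun x y => g y ^ 2 * K x y) (ν.prod ν) :=
    (hg.comp_snd.pow_const 2).mul hK.aemeasurable
  calc ∫⁻ x, f x * ∫⁻ y, K x y * g y ∂ν ∂ν
      ≤ ∫⁻ x, (∫⁻ y, f x ^ 2 * K x y ∂ν) + ∫⁻ y, g y ^ 2 * K x y ∂ν ∂ν := by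
        refine lintegral_mono fun x => ?_
        have m3 : AEMeasurable (fun y => K x y * g y) ν := (hm x).mul hg
        rw [← lintegral_const_mul'' _ m3, ← lintegral_add_left' ((hm x).const_mul _)]
        refine lintegral_mono fun y => ?_
        calc f x * (K x y * g y) = f x * g y * K x y := by ring
          _ ≤ (f x ^ 2 + g y ^ 2) * K x y := by
            gcongr
            exact key _ _
          _ = _ := by ring
    _ = (∫⁻ x, ∫⁻ y, f x ^ 2 * K x y ∂ν ∂ν) + ∫⁻ y, ∫⁻ x, g y ^ 2 * K y x ∂ν ∂ν := by
        have m4 : AEMeasurable (fun x => ∫⁻ y, f x ^ 2 * K x y ∂ν) ν := m1.lintegral_prod_right'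
        rw [lintegral_add_left' m4, lintegral_lintegral_swap m2]
        simp only [hs]
    _ ≤ _ := add_le_add (hb f hf) (hb g hg)

theorem lintegral_mul_greenPotential_le (hG : IsGreenFunction L s γ G) {A : ℝ≥0∞}
    (hA : ∀ x ∈ Ω, ∫⁻ y in (Ω : Set (Eucl N)), greenKernel Ω G x y ≤ A) {f g : Eucl N → ℝ≥0∞}
    (hf : AEMeasurable f (volume.restrict (Ω : Set (Eucl N))))
    (hg : AEMeasurable g (volume.restrict (Ω : Set (Eucl N)))) :
    ∫⁻ x in (Ω : Set (Eucl N)), f x * greenPotential Ω G g x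
      ≤ A * (∫⁻ x in (Ω : Set (Eucl N)), f x ^ 2) + A * ∫⁻ x in (Ω : Set (Eucl N)), g x ^ 2 := by
  refine lintegral_mul_kernel_le hG.measurable_kernel hG.kernel_symm ?_ hf hg
  filter_upwards [ae_restrict_mem Ω.isOpen.measurableSet] with x hx using hA x hx

theorem stronglyMeasurable_greenOp (hG : IsGreenFunction L s γ G) {f : Eucl N → ℝ}
    (hf : AEStronglyMeasurable f (volume.restrict (Ω : Set (Eucl N)))) :
    StronglyMeasurable (greenOp Ω G f) := by
  have e : greenOp Ω G f = greenOp Ω G (hf.mk f) := by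
    funext x
    refine integral_congr_ae ?_
    filter_upwards [hf.ae_eq_mk] with y hy
    rw [hy]
  rw [e]
  have : StronglyMeasurable (Function.uncurry fun x y => G x y * hf.mk f y) :=
    (hG.measurable.mul (hf.stronglyMeasurable_mk.measurable.comp
      measurable_snd)).stronglyMeasurable
  exact this.integral_prod_right

/-- Symmetry of the Green operator. -/
theorem integral_mul_greenOp_symm (hG : IsGreenFunction L s γ G) (hN : 0 < N) {f g : Eucl N → ℝ}
    (hf : AEStronglyMeasurable f (volume.restrict (Ω : Set (Eucl N))))
    (hg : AEStronglyMeasurable g (volume.restrict (Ω : Set (Eucl N))))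
    (hfin : ∫⁻ x in (Ω : Set (Eucl N)), ‖f x‖ₑ * greenPotential Ω G (fun y => ‖g y‖ₑ) x < ∞) :
    ∫ x in (Ω : Set (Eucl N)), f x * greenOp Ω G g x
      = ∫ x in (Ω : Set (Eucl N)), g x * greenOp Ω G f x := by
  set ν := volume.restrict (Ω : Set (Eucl N)) with hν
  have hΩ : MeasurableSet (Ω : Set (Eucl N)) := Ω.isOpen.measurableSet
  have hK : Measurable fun z : Eucl N × Eucl N => (greenKernel Ω G z.1 z.2).toReal :=
    hG.measurable_kernel.ennreal_toReal
  have e1 : ∫ x, f x * greenOp Ω G g x ∂ν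
      = ∫ x, ∫ y, f x * ((greenKernel Ω G x y).toReal * g y) ∂ν ∂ν := by
    refine setIntegral_congr_fun hΩ fun x hx => ?_
    simp only [greenOp_eq hG hN g hx, integral_const_mul, hν]
  have e2 : ∫ x, g x * greenOp Ω G f x ∂ν
      = ∫ y, ∫ x, f x * ((greenKernel Ω G x y).toReal * g y) ∂ν ∂ν := by
    refine setIntegral_congr_fun hΩ fun y hy => ?_
    simp only [greenOp_eq hG hN f hy]
    rw [← integral_const_mul]
    refine integral_congr_ae (Eventually.of_forall fun x => ?_)
    simp only [hG.kernel_symm y x]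
    ring
  rw [e1, e2]
  refine integral_integral_swap ⟨?_, ?_⟩
  · exact hf.comp_fst.mul (hK.aestronglyMeasurable.mul hg.comp_snd)
  · rw [hasFiniteIntegral_iff_enorm, lintegral_prod]
    · refine lt_of_le_of_lt (le_of_eq ?_) hfin
      refine lintegral_congr fun x => ?_
      rw [mul_greenPotential hG hg.enorm]
      refine lintegral_congr fun y => ?_
      simp only [Function.uncurry_apply_pair]
      rw [enorm_mul, enorm_kernel_mul]
    · exact (hf.comp_fst.mul (hK.aestronglyMeasurable.mul hg.comp_snd)).enorm

theorem lintegral_enorm_sq (f : L2 Ω) :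
    ∫⁻ x in (Ω : Set (Eucl N)), ‖f x‖ₑ ^ 2 = ENNReal.ofReal (‖f‖ ^ 2) := by
  rw [← real_inner_self_eq_norm_sq, L2.inner_def,
    ofReal_integral_eq_lintegral_ofReal (L2.integrable_inner f f)]
  · refine lintegral_congr fun x => ?_
    rw [Real.enorm_eq_ofReal_abs, ← ENNReal.ofReal_pow (abs_nonneg _), sq_abs,
      real_inner_self_eq_norm_sq, Real.norm_eq_abs, sq_abs]
  · refine Eventually.of_forall fun x => ?_
    simp only [Pi.zero_apply]
    exact real_inner_self_nonneg

theorem inner_L2_eq (f g : L2 Ω) :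
    inner ℝ f g = ∫ x in (Ω : Set (Eucl N)), f x * g x := by
  rw [L2.inner_def]
  refine integral_congr_ae (Eventually.of_forall fun x => ?_)
  simp [mul_comm]

theorem testToL2_ae (φ : Test Ω) :
    testToL2 Ω φ =ᵐ[volume.restrict (Ω : Set (Eucl N))] φ := (test_memLp φ).coeFn_toLp

theorem greenOp_congr {f g : Eucl N → ℝ}
    (h : f =ᵐ[volume.restrict (Ω : Set (Eucl N))] g) : greenOp Ω G f = greenOp Ω G g := by
  funext x
  refine integral_congr_ae ?_
  filter_upwards [h] with y hy
  rw [hy]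

/-- If `u` is a.e. equal to `𝔾[f]` then `|⟨f, u⟩| ≤ ∫ |f| 𝔾[|f|]`. -/
theorem ofReal_abs_inner_le (hG : IsGreenFunction L s γ G) (hN : 0 < N) {f u : L2 Ω}
    (hu : u =ᵐ[volume.restrict (Ω : Set (Eucl N))] greenOp Ω G f) (g : L2 Ω) :
    ENNReal.ofReal |inner ℝ g u| ≤ ∫⁻ x in (Ω : Set (Eucl N)),
      ‖g x‖ₑ * greenPotential Ω G (fun y => ‖f y‖ₑ) x := by
  rw [inner_L2_eq, ← Real.enorm_eq_ofReal_abs]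
  refine (enorm_integral_le_lintegral_enorm _).trans (lintegral_mono_ae ?_)
  filter_upwards [hu, ae_restrict_mem Ω.isOpen.measurableSet] with x hx hxΩ
  rw [enorm_mul, hx]
  gcongr
  exact enorm_greenOp_le hG hN f hxΩ

theorem aemeasurable_enorm (f : L2 Ω) :
    AEMeasurable (fun x => ‖f x‖ₑ) (volume.restrict (Ω : Set (Eucl N))) :=
  (Lp.aestronglyMeasurable f).enorm

/-- The quadratic form controls the `L²` norm. -/
theorem norm_testToL2_sq_le (hL : IsPositiveSymmetric L) (hG : IsGreenFunction L s γ G)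
    (hN : 0 < N) {A : ℝ} (hA0 : 0 ≤ A)
    (hA : ∀ x ∈ Ω, ∫⁻ y in (Ω : Set (Eucl N)), greenKernel Ω G x y ≤ ENNReal.ofReal A)
    (φ : Test Ω) : ‖testToL2 Ω φ‖ ^ 2 ≤ (2 * A) * form L φ φ := by
  -- With u = 𝔾[φ] one has ‖φ‖² = ⟨u, φ⟩_ℍ and ⟨u, u⟩_ℍ = ∫ φ u ≤ 2A‖φ‖² by Schur's test;
  -- Cauchy–Schwarz in ℍ then gives the bound.
  obtain ⟨u, hu, ⟨a, ha⟩, hsol⟩ := hG.solves φ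
  set f := testToL2 Ω φ with hf
  have h1 : formInner L u f = ‖f‖ ^ 2 := by
    rw [hsol f (testToL2_mem_formDomain φ), real_inner_self_eq_norm_sq]
  have h2 : formInner L u u = inner ℝ f u := hsol u ⟨a, ha⟩
  have h3 : formInner L u f ^ 2 ≤ formInner L u u * form L φ φ := by
    refine le_of_tendsto_of_tendsto'
      ((form_tendsto_formInner hL ha (formApprox_const φ)).pow 2)
      ((form_tendsto_formInner hL ha ha).mul_const _) fun n => ?_
    exact form_cauchySchwarz hL _ _
  have h4 : |inner ℝ f u| ≤ 2 * A * ‖f‖ ^ 2 := by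
    have hu' : u =ᵐ[volume.restrict (Ω : Set (Eucl N))] greenOp Ω G f := by
      rw [greenOp_congr (testToL2_ae φ)]
      exact hu
    have h5 := (ofReal_abs_inner_le hG hN hu' f).trans (lintegral_mul_greenPotential_le hG hA
      (aemeasurable_enorm f) (aemeasurable_enorm f))
    rw [lintegral_enorm_sq, ← ENNReal.ofReal_mul hA0,
      ← ENNReal.ofReal_add (by positivity) (by positivity),
      ENNReal.ofReal_le_ofReal_iff (by positivity)] at h5
    linarith
  rw [h1, h2] at h3
  have h6 := hL.nonneg φ
  have h7 : (‖f‖ ^ 2) ^ 2 ≤ (2 * A * ‖f‖ ^ 2) * form L φ φ :=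
    h3.trans (mul_le_mul_of_nonneg_right ((le_abs_self _).trans h4) h6)
  rcases eq_or_lt_of_le (sq_nonneg ‖f‖) with h8 | h8
  · rw [← h8]; positivity
  · refine le_of_mul_le_mul_left ?_ h8
    calc ‖f‖ ^ 2 * ‖f‖ ^ 2 = (‖f‖ ^ 2) ^ 2 := by ring
      _ ≤ _ := h7
      _ = _ := by ring

variable {H : Type*} [NormedAddCommGroup H] [InnerProductSpace ℝ H]

/-- `J` identifies the Hilbert space `H` with `ℍ(Ω)`. -/
structure IsEnergySpace (L : Test Ω →ₗ[ℝ] L2 Ω) (J : H →L[ℝ] L2 Ω) : Prop where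
  mem : ∀ h, J h ∈ formDomain L
  surj : ∀ u ∈ formDomain L, ∃ h, J h = u
  inner_eq : ∀ h k, formInner L (J h) (J k) = inner ℝ h k

variable [CompleteSpace H] {J : H →L[ℝ] L2 Ω}

/-- The equation 𝓛 u = φ with u = J h reads ⟨h, k⟩ = ⟨φ, J k⟩ for all k, that is, h = J† φ. Hence J
J† is the solution operator. -/
theorem IsEnergySpace.adjoint_test (hE : IsEnergySpace L J) (hG : IsGreenFunction L s γ G)
    (φ : Test Ω) :
    J (adjoint J (testToL2 Ω φ)) =ᵐ[volume.restrict (Ω : Set (Eucl N))] greenOp Ω G φ := by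
  obtain ⟨u, hu, hmem, hsol⟩ := hG.solves φ
  obtain ⟨h, rfl⟩ := hE.surj u hmem
  have : h = adjoint J (testToL2 Ω φ) := by
    refine ext_inner_right ℝ fun k => ?_
    rw [ContinuousLinearMap.adjoint_inner_left, ← hE.inner_eq, hsol _ (hE.mem k)]
  rw [← this]
  exact hu

/-- The Green function represents the solution operator on `L²`. -/
theorem IsEnergySpace.adjoint_ae (hE : IsEnergySpace L J) (hG : IsGreenFunction L s γ G)
    (hN : 0 < N) (hb : Bornology.IsBounded (Ω : Set (Eucl N))) {A : ℝ≥0∞} (hA' : A < ∞)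
    (hA : ∀ x ∈ Ω, ∫⁻ y in (Ω : Set (Eucl N)), greenKernel Ω G x y ≤ A) (f : L2 Ω) :
    J (adjoint J f) =ᵐ[volume.restrict (Ω : Set (Eucl N))] greenOp Ω G f := by
  set ν := volume.restrict (Ω : Set (Eucl N)) with hν
  have hΩ : MeasurableSet (Ω : Set (Eucl N)) := Ω.isOpen.measurableSet
  have hfin : IsFiniteMeasure ν := ⟨by
    rw [hν, Measure.restrict_apply_univ]; exact hb.measure_lt_top⟩
  set w := J (adjoint J f) with hw
  have hsq : ∀ g : L2 Ω, ∫⁻ x, ‖g x‖ₑ ^ 2 ∂ν < ∞ := fun g => by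
    rw [hν, lintegral_enorm_sq]; exact ENNReal.ofReal_lt_top
  have hGf : Integrable (greenOp Ω G f) ν := by
    refine ⟨(stronglyMeasurable_greenOp hG
      (Lp.aestronglyMeasurable f)).aestronglyMeasurable, ?_⟩
    rw [hasFiniteIntegral_iff_enorm]
    calc ∫⁻ x, ‖greenOp Ω G f x‖ₑ ∂ν
        ≤ ∫⁻ x, 1 * greenPotential Ω G (fun y => ‖f y‖ₑ) x ∂ν := by
          refine lintegral_mono_ae ?_
          filter_upwards [ae_restrict_mem hΩ] with x hx
          rw [one_mul]
          exact enorm_greenOp_le hG hN f hx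
      _ ≤ A * ∫⁻ _, 1 ^ 2 ∂ν + A * ∫⁻ x, ‖f x‖ₑ ^ 2 ∂ν :=
          lintegral_mul_greenPotential_le hG hA aemeasurable_const (aemeasurable_enorm f)
      _ < ∞ := by
          refine ENNReal.add_lt_top.2 ⟨ENNReal.mul_lt_top hA' ?_, ENNReal.mul_lt_top hA' (hsq f)⟩
          simp
  have hwi : Integrable w ν := (Lp.memLp w).integrable one_le_two
  have hd : IntegrableOn (fun x => w x - greenOp Ω G f x) (Ω : Set (Eucl N)) volume :=
    hwi.sub hGf
  -- Two functions are compared against smooth compactly supported g. Both J J† and 𝔾 are symmetric,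
  -- so each can be moved onto g, where they agree by `adjoint_test`.
  have key := Ω.isOpen.ae_eq_zero_of_integral_contDiff_smul_eq_zero (μ := volume)
    hd.locallyIntegrableOn ?_
  · rw [EventuallyEq, ae_restrict_iff' hΩ]
    filter_upwards [key] with x hx hxΩ
    exact sub_eq_zero.1 (hx hxΩ)
  · intro g hg hgc hgs
    let φ : Test Ω := ⟨g, hg, hgc, hgs⟩
    have hφ : (φ : Eucl N → ℝ) = g := rfl
    have h0 : ∫ x, g x • (w x - greenOp Ω G f x) = ∫ x, g x • (w x - greenOp Ω G f x) ∂ν := by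
      refine (setIntegral_eq_integral_of_forall_compl_eq_zero fun x hx => ?_).symm
      have : g x = 0 := image_eq_zero_of_notMem_tsupport fun h => hx (hgs h)
      rw [this, zero_smul]
    obtain ⟨M, hM⟩ := hgc.exists_bound_of_continuous hg.continuous
    have hgm : AEStronglyMeasurable g ν := hg.continuous.aestronglyMeasurable
    have i1 : Integrable (fun x => g x * w x) ν :=
      hwi.bdd_mul hgm (Eventually.of_forall hM)
    have i2 : Integrable (fun x => g x * greenOp Ω G f x) ν :=
      hGf.bdd_mul hgm (Eventually.of_forall hM)
    rw [h0]
    simp only [smul_eq_mul, mul_sub]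
    rw [integral_sub i1 i2, sub_eq_zero]
    have h1 : ∫ x, g x * w x ∂ν = inner ℝ (testToL2 Ω φ) w := by
      rw [inner_L2_eq]
      refine integral_congr_ae ?_
      filter_upwards [testToL2_ae φ] with x hx
      rw [hx]; rfl
    have h2 : (inner ℝ (testToL2 Ω φ) w : ℝ) = inner ℝ f (J (adjoint J (testToL2 Ω φ))) := by
      rw [hw, ← ContinuousLinearMap.adjoint_inner_left, real_inner_comm,
        ContinuousLinearMap.adjoint_inner_left]
    rw [h1, h2, inner_L2_eq]
    have h3 : ∫ x, f x * J (adjoint J (testToL2 Ω φ)) x ∂ν = ∫ x, f x * greenOp Ω G g x ∂ν := by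
      refine integral_congr_ae ?_
      filter_upwards [hE.adjoint_test hG φ] with x hx
      rw [hx, hφ]
    rw [h3]
    refine integral_mul_greenOp_symm hG hN (Lp.aestronglyMeasurable f) hgm ?_
    refine (lintegral_mul_greenPotential_le hG hA (aemeasurable_enorm f) hgm.enorm).trans_lt ?_
    refine ENNReal.add_lt_top.2 ⟨ENNReal.mul_lt_top hA' (hsq f), ENNReal.mul_lt_top hA' ?_⟩
    have := hsq (testToL2 Ω φ)
    rwa [lintegral_congr_ae (g := fun x => ‖g x‖ₑ ^ 2)] at this
    filter_upwards [testToL2_ae φ] with x hx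
    rw [hx, hφ]

/-- The data that the analysis of the problem uses. -/
structure IsGreenSetting (L : Test Ω →ₗ[ℝ] L2 Ω) (s γ : ℝ) (G : Eucl N → Eucl N → ℝ)
    (J : H →L[ℝ] L2 Ω) : Prop where
  green : IsGreenFunction L s γ G
  energy : IsEnergySpace L J
  dim_pos : 0 < N
  s_pos : 0 < s
  γ_pos : 0 < γ
  two_s_lt : 2 * s < N
  frontier : (frontier (Ω : Set (Eucl N))).Nonempty
  bounded : Bornology.IsBounded (Ω : Set (Eucl N))

namespace IsGreenSetting

theorem adjoint_ae (S : IsGreenSetting L s γ G J) (f : L2 Ω) :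
    J (adjoint J f) =ᵐ[volume.restrict (Ω : Set (Eucl N))] greenOp Ω G f := by
  obtain ⟨A, hA', hA⟩ := S.green.exists_lintegral_kernel_le S.s_pos S.γ_pos.le S.dim_pos S.frontier
    S.bounded
  exact S.energy.adjoint_ae S.green S.dim_pos S.bounded hA' hA f

/-- ‖J† f‖² = ⟨f, J J† f⟩ = ∫ f 𝔾[f]. -/
theorem ofReal_norm_adjoint_sq_le (S : IsGreenSetting L s γ G J) (f : L2 Ω) :
    ENNReal.ofReal (‖adjoint J f‖ ^ 2) ≤ ∫⁻ x in (Ω : Set (Eucl N)),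
      ‖f x‖ₑ * greenPotential Ω G (fun y => ‖f y‖ₑ) x := by
  have h := ofReal_abs_inner_le S.green S.dim_pos (S.adjoint_ae f) f
  rwa [← ContinuousLinearMap.adjoint_inner_left, real_inner_self_eq_norm_sq,
    abs_of_nonneg (by positivity)] at h

/-- Duality between `ℍ(Ω)` and the Green energy. -/
theorem sq_integral_le (S : IsGreenSetting L s γ G J) {f : Eucl N → ℝ}
    (hf : MemLp f 2 (volume.restrict (Ω : Set (Eucl N)))) (h : H) {M : ℝ} (hM0 : 0 ≤ M)
    (hM : ∫⁻ x in (Ω : Set (Eucl N)), ‖f x‖ₑ * greenPotential Ω G (fun y => ‖f y‖ₑ) x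
      ≤ ENNReal.ofReal M) :
    (∫ x in (Ω : Set (Eucl N)), f x * J h x) ^ 2 ≤ M * ‖h‖ ^ 2 := by
  have e1 : ∫ x in (Ω : Set (Eucl N)), f x * J h x = inner ℝ (adjoint J (hf.toLp f)) h := by
    rw [ContinuousLinearMap.adjoint_inner_left, inner_L2_eq]
    refine integral_congr_ae ?_
    filter_upwards [hf.coeFn_toLp] with x hx
    rw [hx]
  have h1 := S.ofReal_norm_adjoint_sq_le (hf.toLp f)
  have e2 : (fun y => ‖hf.toLp f y‖ₑ) =ᵐ[volume.restrict (Ω : Set (Eucl N))]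
      fun y => ‖f y‖ₑ := by
    filter_upwards [hf.coeFn_toLp] with x hx
    rw [hx]
  have h2 : ∫⁻ x in (Ω : Set (Eucl N)), ‖hf.toLp f x‖ₑ
      * greenPotential Ω G (fun y => ‖hf.toLp f y‖ₑ) x ≤ ENNReal.ofReal M := by
    refine le_trans (le_of_eq (lintegral_congr_ae ?_)) hM
    filter_upwards [hf.coeFn_toLp] with x hx
    rw [greenPotential_congr e2, hx]
  have h3 := h1.trans h2
  rw [ENNReal.ofReal_le_ofReal_iff hM0] at h3
  rw [e1]
  calc (inner ℝ (adjoint J (hf.toLp f)) h) ^ 2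
      = |inner ℝ (adjoint J (hf.toLp f)) h| ^ 2 := (sq_abs _).symm
    _ ≤ (‖adjoint J (hf.toLp f)‖ * ‖h‖) ^ 2 := by
        gcongr
        exact abs_real_inner_le_norm _ _
    _ = ‖adjoint J (hf.toLp f)‖ ^ 2 * ‖h‖ ^ 2 := by ring
    _ ≤ M * ‖h‖ ^ 2 := by gcongr

end IsGreenSetting

end Representation

/-! ### A weighted Sobolev inequality -/

/-- Pointwise form of Young's convolution inequality. -/
theorem young_pointwise {p : ℝ} (hp : 1 < p) (a b k : ℝ≥0∞) :
    a ^ (1 - 1 / (2 * p)) * k * b ^ (1 - 1 / (2 * p)) ≤ a * b + a * k ^ p + b * k ^ p := by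
  have hp0 : 0 < p := by linarith
  set β := 1 / (2 * p) with hβ
  set α := 1 - 1 / p with hα
  have hβ0 : 0 ≤ β := by positivity
  have hα0 : 0 ≤ α := by
    rw [hα, sub_nonneg, div_le_one hp0]; exact hp.le
  have e1 : 1 - β = α + β := by
    rw [hα, hβ]; field_simp; ring
  have e2 : p * β + p * β = 1 := by rw [hβ]; field_simp; ring
  have e3 : α + β + β = 1 := by rw [hα, hβ]; field_simp; ring
  have hk : k = k ^ (p * β) * k ^ (p * β) := by
    rw [← ENNReal.rpow_add_of_nonneg _ _ (by positivity) (by positivity), e2, ENNReal.rpow_one]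
  set M := a * b + a * k ^ p + b * k ^ p with hM
  -- With α = 1 - 1/p, β = 1/(2p) and α + 2β = 1, the left side is a weighted geometric mean of the
  -- three summands on the right.
  calc a ^ (1 - β) * k * b ^ (1 - β)
      = (a * b) ^ α * (a * k ^ p) ^ β * (b * k ^ p) ^ β := by
        rw [e1, ENNReal.rpow_add_of_nonneg _ _ hα0 hβ0, ENNReal.rpow_add_of_nonneg _ _ hα0 hβ0,
          ENNReal.mul_rpow_of_nonneg _ _ hα0, ENNReal.mul_rpow_of_nonneg _ _ hβ0,
          ENNReal.mul_rpow_of_nonneg _ _ hβ0, ← ENNReal.rpow_mul]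
        nth_rewrite 1 [hk]
        ring
    _ ≤ M ^ α * M ^ β * M ^ β := by
        gcongr
        · exact (le_self_add.trans le_self_add)
        · exact (le_add_self.trans le_self_add)
        · exact le_add_self
    _ = M := by
        rw [← ENNReal.rpow_add_of_nonneg _ _ hα0 hβ0,
          ← ENNReal.rpow_add_of_nonneg _ _ (by positivity) hβ0, e3, ENNReal.rpow_one]

section Embedding

variable {N : ℕ} {Ω : TopologicalSpace.Opens (Eucl N)} {L : Test Ω →ₗ[ℝ] L2 Ω} {s γ : ℝ}
  {G : Eucl N → Eucl N → ℝ} {H : Type*} [NormedAddCommGroup H] [InnerProductSpace ℝ H]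
  {J : H →L[ℝ] L2 Ω}

namespace IsGreenSetting

theorem isFiniteMeasure (S : IsGreenSetting L s γ G J) :
    IsFiniteMeasure (volume.restrict (Ω : Set (Eucl N))) :=
  ⟨by rw [Measure.restrict_apply_univ]; exact S.bounded.measure_lt_top⟩

/-- Young's inequality for the Green energy, in a weighted Lebesgue space. -/
theorem exists_green_energy_le (S : IsGreenSetting L s γ G J) {p : ℝ} (hp : 1 < p)
    (hpS : p * (N + γ - 2 * s) < N + γ) :
    ∃ C A : ℝ, 0 < C ∧ 0 ≤ A ∧ ∀ (f : Eucl N → ℝ) (P : Eucl N → ℝ≥0∞),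
      AEMeasurable P (volume.restrict (Ω : Set (Eucl N))) →
      (∀ x ∈ Ω, ‖f x‖ₑ * ENNReal.ofReal (bdist Ω x ^ (γ * (p - 1) / (2 * p)))
        = P x ^ (1 - 1 / (2 * p))) →
      ∫⁻ x in (Ω : Set (Eucl N)), ‖f x‖ₑ * greenPotential Ω G (fun y => ‖f y‖ₑ) x
        ≤ ENNReal.ofReal C * ((∫⁻ x in (Ω : Set (Eucl N)), P x) ^ 2
          + ENNReal.ofReal A * ∫⁻ x in (Ω : Set (Eucl N)), P x) := by
  have hp0 : 0 < p := by linarith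
  have hγ := S.γ_pos
  set a := γ * (p - 1) / (2 * p) with ha
  have ha0 : 0 ≤ a := by
    have : 0 ≤ p - 1 := by linarith
    positivity
  have haγ : a ≤ γ := by
    rw [ha, div_le_iff₀ (by positivity)]
    nlinarith
  set β := (N : ℝ) - 2 * s + 2 * a with hβ
  -- Subcriticality enters here: for this a, the condition βp < N is p(N + γ - 2s) < N + γ, and it
  -- makes the p-th power of the Riesz kernel integrable.
  have hβp : β * p < N := by
    have : β * p = (N - 2 * s) * p + γ * (p - 1) := by
      rw [hβ, ha]; field_simp
    rw [this]; linarith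
  obtain ⟨C, hC, hker⟩ := S.green.kernel_le S.frontier
  obtain ⟨A, hA', hA⟩ := exists_lintegral_rieszKernel_le S.dim_pos S.bounded hβp
  refine ⟨C, 2 * A.toReal, hC, by positivity, fun f P hP hfP => ?_⟩
  have hfin := S.isFiniteMeasure
  have hΩ : MeasurableSet (Ω : Set (Eucl N)) := Ω.isOpen.measurableSet
  set ν := volume.restrict (Ω : Set (Eucl N)) with hν
  set I := ∫⁻ x, P x ∂ν with hI
  have hkm : ∀ x : Eucl N, Measurable fun y => rieszKernel β (x - y) ^ p := fun x => by fun_prop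
  have hkm2 : Measurable fun z : Eucl N × Eucl N => rieszKernel β (z.1 - z.2) ^ p := by fun_prop
  have hkA : ∀ x ∈ Ω, ∫⁻ y, rieszKernel β (x - y) ^ p ∂ν ≤ A := fun x hx => by
    simp only [rieszKernel_rpow β hp0]
    exact hA x hx
  have hsymm : ∫⁻ x, ∫⁻ y, P y * rieszKernel β (x - y) ^ p ∂ν ∂ν
      = ∫⁻ y, P y * ∫⁻ x, rieszKernel β (y - x) ^ p ∂ν ∂ν := by
    rw [lintegral_lintegral_swap]
    · refine lintegral_congr fun y => ?_
      rw [← lintegral_const_mul _ (hkm y)]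
      refine lintegral_congr fun x => ?_
      rw [← rieszKernel_neg β (y - x), neg_sub]
    · exact hP.comp_snd.mul hkm2.aemeasurable
  have hbound : ∫⁻ y, P y * ∫⁻ x, rieszKernel β (y - x) ^ p ∂ν ∂ν ≤ A * I := by
    rw [hI, ← lintegral_const_mul'' _ hP]
    refine setLIntegral_mono_ae' hΩ (Eventually.of_forall fun y hy => ?_)
    rw [mul_comm]
    gcongr
    exact hkA y hy
  have m1 : AEMeasurable (fun x => ∫⁻ y, P x * P y ∂ν) ν := by
    have : AEMeasurable (Function.uncurry fun x y => P x * P y) (ν.prod ν) :=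
      hP.comp_fst.mul hP.comp_snd
    exact this.lintegral_prod_right'
  have m2 : AEMeasurable (fun x => ∫⁻ y, P x * rieszKernel β (x - y) ^ p ∂ν) ν := by
    have : AEMeasurable (Function.uncurry fun x y => P x * rieszKernel β (x - y) ^ p)
      (ν.prod ν) := hP.comp_fst.mul hkm2.aemeasurable
    exact this.lintegral_prod_right'
  calc ∫⁻ x, ‖f x‖ₑ * greenPotential Ω G (fun y => ‖f y‖ₑ) x ∂ν
      ≤ ∫⁻ x, ∫⁻ y, ENNReal.ofReal C * (P x * P y + P x * rieszKernel β (x - y) ^ p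
          + P y * rieszKernel β (x - y) ^ p) ∂ν ∂ν := by
        refine setLIntegral_mono_ae' hΩ (Eventually.of_forall fun x hx => ?_)
        unfold greenPotential
        rw [← lintegral_const_mul' _ _ enorm_ne_top]
        refine setLIntegral_mono_ae' hΩ (Eventually.of_forall fun y hy => ?_)
        have hdx := bdist_pos S.frontier hx
        have hdy := bdist_pos S.frontier hy
        calc ‖f x‖ₑ * (greenKernel Ω G x y * ‖f y‖ₑ)
            ≤ ‖f x‖ₑ * ((ENNReal.ofReal (C * bdist Ω x ^ a * bdist Ω y ^ a)
                * rieszKernel β (x - y)) * ‖f y‖ₑ) := by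
              gcongr
              exact hker a ha0 haγ x hx y hy
          _ = ENNReal.ofReal C * ((‖f x‖ₑ * ENNReal.ofReal (bdist Ω x ^ a))
                * rieszKernel β (x - y) * (‖f y‖ₑ * ENNReal.ofReal (bdist Ω y ^ a))) := by
              rw [ENNReal.ofReal_mul (by positivity), ENNReal.ofReal_mul hC.le]
              ring
          _ ≤ _ := by
              rw [hfP x hx, hfP y hy]
              gcongr
              exact young_pointwise hp _ _ _
    _ = ENNReal.ofReal C * (∫⁻ x, (∫⁻ y, P x * P y ∂ν)
          + (∫⁻ y, P x * rieszKernel β (x - y) ^ p ∂ν)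
          + ∫⁻ y, P y * rieszKernel β (x - y) ^ p ∂ν ∂ν) := by
        rw [← lintegral_const_mul' _ _ ENNReal.ofReal_ne_top]
        refine lintegral_congr fun x => ?_
        have m3 : AEMeasurable (fun y => P x * P y) ν := hP.const_mul _
        have m4 : AEMeasurable (fun y => P x * P y + P x * rieszKernel β (x - y) ^ p) ν :=
          m3.add ((hkm x).const_mul _).aemeasurable
        rw [lintegral_const_mul' _ _ ENNReal.ofReal_ne_top, lintegral_add_left' m4,
          lintegral_add_left' m3]
    _ ≤ ENNReal.ofReal C * (I ^ 2 + A * I + A * I) := by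
        gcongr
        have m5 : AEMeasurable (fun x => (∫⁻ y, P x * P y ∂ν)
            + ∫⁻ y, P x * rieszKernel β (x - y) ^ p ∂ν) ν := m1.add m2
        rw [lintegral_add_left' m5, lintegral_add_left' m1]
        gcongr
        · rw [sq, hI, ← lintegral_mul_const'' _ hP]
          refine lintegral_mono fun x => ?_
          rw [lintegral_const_mul'' _ hP]
        · refine le_trans (le_of_eq (lintegral_congr fun x => ?_)) hbound
          rw [lintegral_const_mul _ (hkm x)]
        · rw [hsymm]
          exact hbound
    _ = _ := by
        rw [ENNReal.ofReal_mul (by norm_num), ENNReal.ofReal_toReal hA'.ne]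
        simp only [ENNReal.ofReal_ofNat]
        ring

variable [CompleteSpace H]

/-- `ℍ(Ω)` is continuously embedded into `L^{2p}(Ω, δ^{-γ(p-1)})`. -/
theorem exists_weighted_bound (S : IsGreenSetting L s γ G J) {p : ℝ} (hp : 1 < p)
    (hpS : p * (N + γ - 2 * s) < N + γ) :
    ∃ r C : ℝ, 0 < r ∧ 0 ≤ C ∧ ∀ h : H, ‖h‖ ≤ r → ∫⁻ x in (Ω : Set (Eucl N)),
      ENNReal.ofReal (|J h x| ^ (2 * p) * bdist Ω x ^ (-(γ * (p - 1)))) ≤ ENNReal.ofReal C := by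
  obtain ⟨C, A, hC, hA, hgr⟩ := S.exists_green_energy_le hp hpS
  have hp0 : 0 < p := by linarith
  have hγ := S.γ_pos
  have hfin := S.isFiniteMeasure
  have hΩ : MeasurableSet (Ω : Set (Eucl N)) := Ω.isOpen.measurableSet
  -- This radius gives C‖h‖² ≤ 1/2, so that the quadratic term can be absorbed at the end.
  refine ⟨1 / √(2 * C), A, by positivity, hA, fun h hh => ?_⟩
  set ν := volume.restrict (Ω : Set (Eucl N)) with hν
  set φ : Eucl N → ℝ := fun x => J h x with hφ
  have hφm : Measurable φ := (Lp.stronglyMeasurable (J h)).measurable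
  set m := γ * (p - 1) with hm
  have hm0 : 0 ≤ m := mul_nonneg hγ.le (by linarith)
  let W : Eucl N → ℝ := fun x => |φ x| ^ (2 * p) * bdist Ω x ^ (-m)
  have hW0 : ∀ x, 0 ≤ W x := fun x => by
    have := bdist_nonneg (Ω := Ω) x
    positivity
  have hWm : Measurable W := by
    have := measurable_bdist (Ω := Ω)
    fun_prop
  -- Truncation in size and away from the boundary makes the integral finite beforehand, as
  -- absorption requires, and makes the dual function below square integrable.
  let E : ℕ → Set (Eucl N) := fun n => {x | |φ x| ≤ n} ∩ {x | 1 / ((n : ℝ) + 1) ≤ bdist Ω x}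
  have hEm : ∀ n, MeasurableSet (E n) := fun n => by
    have h1 : Measurable fun x => |φ x| := by fun_prop
    exact (measurableSet_le h1 measurable_const).inter
      (measurableSet_le measurable_const measurable_bdist)
  have hmono : Monotone E := by
    intro i j hij x hx
    have hij' : (i : ℝ) ≤ j := by exact_mod_cast hij
    have h1 : 1 / ((j : ℝ) + 1) ≤ 1 / ((i : ℝ) + 1) := by gcongr
    exact ⟨hx.1.trans hij', h1.trans hx.2⟩
  have hkey : ∀ n, ∫⁻ x in E n, ENNReal.ofReal (W x) ∂ν ≤ ENNReal.ofReal A := by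
    intro n
    have hn1 : (0 : ℝ) < (n : ℝ) + 1 := by positivity
    -- The extremal function of the duality: f φ = W on E n, and |f| δ^(m/(2p)) = W^(1 - 1/(2p)), as
    -- the Young estimate requires.
    let f : Eucl N → ℝ := (E n).indicator fun x => |φ x| ^ (2 * p - 2) * φ x * bdist Ω x ^ (-m)
    let P : Eucl N → ℝ≥0∞ := (E n).indicator fun x => ENNReal.ofReal (W x)
    have hPm : Measurable P := (hWm.ennreal_ofReal).indicator (hEm n)
    have hfm : Measurable f := by
      refine Measurable.indicator ?_ (hEm n)
      have := measurable_bdist (Ω := Ω)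
      fun_prop
    have habs : ∀ x, |(|φ x| ^ (2 * p - 2) * φ x * bdist Ω x ^ (-m))|
        = |φ x| ^ (2 * p - 1) * bdist Ω x ^ (-m) := fun x => by
      have := bdist_nonneg (Ω := Ω) x
      rw [abs_mul, abs_mul, abs_of_nonneg (a := |φ x| ^ (2 * p - 2)) (by positivity),
        abs_of_nonneg (a := bdist Ω x ^ (-m)) (by positivity)]
      congr 1
      have := Real.rpow_add_one' (x := |φ x|) (y := 2 * p - 2) (abs_nonneg _) (by linarith)
      rw [← this]; congr 1; ring
    have hf2 : MemLp f 2 ν := by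
      refine MemLp.of_bound hfm.aestronglyMeasurable
        ((n : ℝ) ^ (2 * p - 1) * (1 / ((n : ℝ) + 1)) ^ (-m)) (Eventually.of_forall fun x => ?_)
      by_cases hx : x ∈ E n
      · simp only [f, Set.indicator_of_mem hx, Real.norm_eq_abs, habs]
        have h1 : 0 < 1 / ((n : ℝ) + 1) := by positivity
        have h2 := bdist_nonneg (Ω := Ω) x
        gcongr ?_ * ?_
        · exact Real.rpow_le_rpow (abs_nonneg _) hx.1 (by linarith)
        · exact Real.rpow_le_rpow_of_nonpos h1 hx.2 (by linarith)
      · simp only [f, Set.indicator_of_notMem hx, norm_zero]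
        positivity
    have hfP : ∀ x ∈ Ω, ‖f x‖ₑ * ENNReal.ofReal (bdist Ω x ^ (γ * (p - 1) / (2 * p)))
        = P x ^ (1 - 1 / (2 * p)) := by
      intro x hxΩ
      have hd := bdist_pos S.frontier hxΩ
      have hexp : 0 < 1 - 1 / (2 * p) := by
        rw [sub_pos, div_lt_one (by positivity)]; linarith
      by_cases hx : x ∈ E n
      · simp only [f, P, Set.indicator_of_mem hx]
        rw [Real.enorm_eq_ofReal_abs, habs, ← ENNReal.ofReal_mul (by positivity),
          ENNReal.ofReal_rpow_of_nonneg (hW0 x) hexp.le]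
        congr 1
        simp only [W]
        rw [Real.mul_rpow (by positivity) (by positivity), ← Real.rpow_mul (abs_nonneg _),
          ← Real.rpow_mul hd.le, mul_assoc, ← Real.rpow_add hd]
        congr 2
        · field_simp
        · rw [hm]; field_simp; ring
      · simp only [f, P, Set.indicator_of_notMem hx]
        rw [ENNReal.zero_rpow_of_pos hexp]
        simp
    have hPI : ∫⁻ x, P x ∂ν = ∫⁻ x in E n, ENNReal.ofReal (W x) ∂ν :=
      lintegral_indicator (hEm n) _
    have hff : ∀ x, f x * φ x = (E n).indicator W x := fun x => by
      by_cases hx : x ∈ E n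
      · simp only [f, Set.indicator_of_mem hx, W]
        have : |φ x| ^ (2 * p) = |φ x| ^ (2 * p - 2) * (φ x * φ x) := by
          rw [← abs_mul_abs_self, ← sq, ← Real.rpow_natCast (|φ x|) 2,
            ← Real.rpow_add' (abs_nonneg _) (by push_cast; linarith)]
          congr 1; push_cast; ring
        rw [this]; ring
      · simp only [f, Set.indicator_of_notMem hx, zero_mul]
    have hIfin : ∫⁻ x in E n, ENNReal.ofReal (W x) ∂ν < ∞ := by
      have hb : ∀ x ∈ E n, W x ≤ (n : ℝ) ^ (2 * p) * (1 / ((n : ℝ) + 1)) ^ (-m) := fun x hx => by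
        have h1 : 0 < 1 / ((n : ℝ) + 1) := by positivity
        have h2 := bdist_nonneg (Ω := Ω) x
        simp only [W]
        gcongr ?_ * ?_
        · exact Real.rpow_le_rpow (abs_nonneg _) hx.1 (by linarith)
        · exact Real.rpow_le_rpow_of_nonpos h1 hx.2 (by linarith)
      refine lt_of_le_of_lt (setLIntegral_mono measurable_const fun x hx =>
        ENNReal.ofReal_le_ofReal (hb x hx)) ?_
      rw [lintegral_const]
      exact ENNReal.mul_lt_top ENNReal.ofReal_lt_top (measure_lt_top _ _)
    set I := (∫⁻ x in E n, ENNReal.ofReal (W x) ∂ν).toReal with hI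
    have hI0 : 0 ≤ I := ENNReal.toReal_nonneg
    have hIe : ∫⁻ x in E n, ENNReal.ofReal (W x) ∂ν = ENNReal.ofReal I :=
      (ENNReal.ofReal_toReal hIfin.ne).symm
    have hint : ∫ x, f x * φ x ∂ν = I := by
      simp only [hff]
      rw [integral_indicator (hEm n), integral_eq_lintegral_of_nonneg_ae
        (Eventually.of_forall hW0) hWm.aestronglyMeasurable]
    have h1 := hgr f P hPm.aemeasurable hfP
    rw [hPI, hIe, ← ENNReal.ofReal_pow hI0, ← ENNReal.ofReal_mul hA,
      ← ENNReal.ofReal_add (by positivity) (by positivity), ← ENNReal.ofReal_mul hC.le] at h1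
    have h2 : I ^ 2 ≤ C * (I ^ 2 + A * I) * ‖h‖ ^ 2 := by
      rw [← hint]
      exact hint ▸ S.sq_integral_le hf2 h (by positivity) h1
    have h3 : C * ‖h‖ ^ 2 ≤ 1 / 2 := by
      calc C * ‖h‖ ^ 2 ≤ C * (1 / √(2 * C)) ^ 2 := by gcongr
        _ = 1 / 2 := by
          rw [div_pow, Real.sq_sqrt (by positivity)]; field_simp
    -- Absorbing I²/2 leaves I ≤ A, uniformly in n.
    have h4 : I ^ 2 ≤ 1 / 2 * (I ^ 2 + A * I) := by
      calc I ^ 2 ≤ C * (I ^ 2 + A * I) * ‖h‖ ^ 2 := h2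
        _ = C * ‖h‖ ^ 2 * (I ^ 2 + A * I) := by ring
        _ ≤ _ := by gcongr
    rw [hIe]
    refine ENNReal.ofReal_le_ofReal ?_
    rcases eq_or_lt_of_le hI0 with h5 | h5
    · rw [← h5]; exact hA
    · have : I * I ≤ A * I := by nlinarith
      exact le_of_mul_le_mul_right this h5
  have hU : ∀ x ∈ Ω, x ∈ ⋃ n, E n := fun x hx => by
    have hd := bdist_pos S.frontier hx
    obtain ⟨n, hn⟩ := exists_nat_ge (max |φ x| (1 / bdist Ω x))
    refine Set.mem_iUnion.2 ⟨n, (le_max_left _ _).trans hn, ?_⟩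
    have h1 := (le_max_right _ _).trans hn
    rw [div_le_iff₀ hd] at h1
    rw [Set.mem_ofPred_eq, div_le_iff₀ (by positivity)]
    nlinarith
  calc ∫⁻ x, ENNReal.ofReal (W x) ∂ν
      = ∫⁻ x in ⋃ n, E n, ENNReal.ofReal (W x) ∂ν := by
        rw [Measure.restrict_eq_self_of_ae_mem]
        filter_upwards [ae_restrict_mem hΩ] with x hx using hU x hx
    _ = ⨆ n, ∫⁻ x in E n, ENNReal.ofReal (W x) ∂ν :=
        setLIntegral_iUnion_of_directed _ hmono.directed_le
    _ ≤ ENNReal.ofReal A := iSup_le hkey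

end IsGreenSetting

end Embedding

/-! ### Compactness -/

section Compactness

variable {N : ℕ} {Ω : TopologicalSpace.Opens (Eucl N)} {L : Test Ω →ₗ[ℝ] L2 Ω} {s γ : ℝ}
  {G : Eucl N → Eucl N → ℝ} {H : Type*} [NormedAddCommGroup H] [InnerProductSpace ℝ H]
  {J : H →L[ℝ] L2 Ω}

theorem IsEnergySpace.injective (hE : IsEnergySpace L J) : Function.Injective J := by
  refine (injective_iff_map_eq_zero J).2 fun h hh => ?_
  have h1 := hE.inner_eq h h
  have h2 := hE.inner_eq 0 h
  rw [hh] at h1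
  rw [map_zero, hh, inner_zero_left] at h2
  rw [h2] at h1
  exact inner_self_eq_zero.1 h1.symm

variable [CompleteSpace H]

/-- J is injective, so J† has dense range, and its domain L² is separable. Separability gives
sequential weak compactness. -/
theorem IsEnergySpace.separableSpace (hE : IsEnergySpace L J) :
    TopologicalSpace.SeparableSpace H := by
  have hd : DenseRange (adjoint J) := by
    have h1 : (LinearMap.range (adjoint J : L2 Ω →ₗ[ℝ] H)).topologicalClosure = ⊤ := by
      rw [Submodule.topologicalClosure_eq_top_iff]
      rw [ContinuousLinearMap.orthogonal_range, ContinuousLinearMap.adjoint_adjoint]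
      exact LinearMap.ker_eq_bot.2 hE.injective
    rw [← Submodule.dense_iff_topologicalClosure_eq_top] at h1
    exact h1
  have : Fact ((2 : ℝ≥0∞) ≠ ⊤) := ⟨by simp⟩
  have : TopologicalSpace.SeparableSpace (L2 Ω) := inferInstance
  exact hd.separableSpace (adjoint J).continuous

/-- Bounded sequences have weakly convergent subsequences. -/
theorem exists_weak_limit [TopologicalSpace.SeparableSpace H] (h : ℕ → H)
    (hh : ∀ n, ‖h n‖ ≤ 1) : ∃ k, ‖k‖ ≤ 1 ∧ ∃ φ : ℕ → ℕ, StrictMono φ ∧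
      ∀ ξ : H, Tendsto (fun n => inner ℝ (h (φ n) - k) ξ) atTop (𝓝 0) := by
  let e := InnerProductSpace.toDual ℝ H
  have hc := WeakDual.isSeqCompact_closedBall ℝ H (0 : StrongDual ℝ H) 1
  have hm : ∀ n, StrongDual.toWeakDual (e (h n))
      ∈ WeakDual.toStrongDual ⁻¹' Metric.closedBall (0 : StrongDual ℝ H) 1 := fun n => by
    simpa [e] using hh n
  obtain ⟨a, ha, φ, hφ, hlim⟩ := hc hm
  refine ⟨e.symm (WeakDual.toStrongDual a), ?_, φ, hφ, fun ξ => ?_⟩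
  · simpa using ha
  · have h1 := ((WeakDual.eval_continuous (𝕜 := ℝ) ξ).tendsto a).comp hlim
    have h2 : Tendsto (fun n => inner ℝ (h (φ n)) ξ) atTop (𝓝 (a ξ)) := by
      simpa [e, Function.comp_def] using h1
    have h3 : inner ℝ (e.symm (WeakDual.toStrongDual a)) ξ = a ξ := by
      simp [e]
    have h4 := h2.sub_const (a ξ)
    rw [sub_self] at h4
    simpa [inner_sub_left, h3] using h4

/-- Integrability of a is not needed: if it fails, the right side is infinite. -/
theorem enorm_integral_add_le {X : Type*} [MeasurableSpace X] {ν : Measure X} {a b : X → ℝ}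
    (ha : AEStronglyMeasurable a ν) (hb : Integrable b ν) :
    ‖∫ x, a x + b x ∂ν‖ₑ ≤ ∫⁻ x, ‖a x‖ₑ ∂ν + ‖∫ x, b x ∂ν‖ₑ := by
  by_cases h : Integrable a ν
  · rw [integral_add h hb]
    exact (enorm_add_le _ _).trans (add_le_add (enorm_integral_le_lintegral_enorm _) le_rfl)
  · have : ∫⁻ x, ‖a x‖ₑ ∂ν = ∞ := by
      by_contra h'
      exact h ⟨ha, by rw [hasFiniteIntegral_iff_enorm]; exact lt_top_iff_ne_top.2 h'⟩
    rw [this, top_add]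
    exact le_top

namespace IsGreenSetting

/-- Weakly null sequences are mapped to null sequences by `J†J`. -/
theorem tendsto_norm_adjoint (S : IsGreenSetting L s γ G J) {g : ℕ → H} {R : ℝ}
    (hg : ∀ n, ‖g n‖ ≤ R) (hw : ∀ ξ, Tendsto (fun n => inner ℝ (g n) ξ) atTop (𝓝 0)) :
    Tendsto (fun n => ‖adjoint J (J (g n))‖ ^ 2) atTop (𝓝 0) := by
  have hfin := S.isFiniteMeasure
  have hΩ : MeasurableSet (Ω : Set (Eucl N)) := Ω.isOpen.measurableSet
  set ν := volume.restrict (Ω : Set (Eucl N)) with hν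
  have hR : 0 ≤ R := (norm_nonneg _).trans (hg 0)
  set M := (‖J‖ * R) ^ 2 with hM
  have hM0 : 0 ≤ M := by positivity
  have hJM : ∀ n, ‖J (g n)‖ ^ 2 ≤ M := fun n => by
    have := J.le_opNorm (g n)
    have h2 := hg n
    rw [hM]
    gcongr
    exact this.trans (by gcongr)
  refine Metric.tendsto_atTop.2 fun η' hη' => ?_
  -- Chosen so that the near-diagonal contribution 3ηM is at most η'/4; the summand 1 covers M = 0.
  set η := η' / (4 * (3 * M + 1)) with hη
  have hη0 : 0 < η := by positivity
  obtain ⟨ε, hε, hnear⟩ := S.green.exists_lintegral_kernel_ball_le S.s_pos S.γ_pos.le S.dim_pos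
    S.frontier (η := ENNReal.ofReal η) (by simpa using hη0)
  obtain ⟨B, hB, hfar⟩ := S.green.kernel_bounded_off_diagonal S.γ_pos.le S.two_s_lt S.frontier hε
  have hK := S.green.measurable_kernel
  -- Split the kernel along |x-y| < ε. The near part K₁ has small marginals, uniformly in the
  -- sequence; the far part K₂ is bounded.
  let D : Set (Eucl N × Eucl N) := {z | dist z.2 z.1 < ε}
  have hD : MeasurableSet D := measurableSet_lt (by fun_prop) measurable_const
  let K₁ : Eucl N → Eucl N → ℝ≥0∞ :=
    fun x y => D.indicator (Function.uncurry (greenKernel Ω G)) (x, y)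
  let K₂ : Eucl N → Eucl N → ℝ≥0∞ :=
    fun x y => Dᶜ.indicator (Function.uncurry (greenKernel Ω G)) (x, y)
  have hK₁ : Measurable (Function.uncurry K₁) := hK.indicator hD
  have hK₂ : Measurable (Function.uncurry K₂) := hK.indicator hD.compl
  have hK₁x : ∀ x, Measurable (K₁ x) := fun x => hK₁.of_uncurry_left
  have hK₂x : ∀ x, Measurable (K₂ x) := fun x => hK₂.of_uncurry_left
  have hK₁s : ∀ x y, K₁ x y = K₁ y x := fun x y => by
    simp only [K₁, D, Set.indicator, Set.mem_ofPred_eq, Function.uncurry_apply_pair,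
      dist_comm x y, S.green.kernel_symm x y]
  have hK₁fin : ∀ x y, K₁ x y ≠ ∞ := fun x y => by
    simp only [K₁, Set.indicator, Function.uncurry_apply_pair]
    split_ifs
    · exact (greenKernel_lt_top x y).ne
    · simp
  have hK₂fin : ∀ x y, K₂ x y ≠ ∞ := fun x y => by
    simp only [K₂, Set.indicator, Function.uncurry_apply_pair]
    split_ifs
    · exact (greenKernel_lt_top x y).ne
    · simp
  have hadd : ∀ x y, greenKernel Ω G x y = K₁ x y + K₂ x y := fun x y =>
    (congrFun (Set.indicator_self_add_compl D (Function.uncurry (greenKernel Ω G))) (x, y)).symm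
  have hK₁A : ∀ᵐ x ∂ν, ∫⁻ y, K₁ x y ∂ν ≤ ENNReal.ofReal η := by
    filter_upwards [ae_restrict_mem hΩ] with x hx
    refine le_trans (le_of_eq ?_) (hnear x hx)
    have : K₁ x = (Metric.ball x ε).indicator (greenKernel Ω G x) := by
      funext y
      simp only [K₁, D, Set.indicator, Set.mem_ofPred_eq, Metric.mem_ball,
        Function.uncurry_apply_pair]
    rw [this, lintegral_indicator Metric.isOpen_ball.measurableSet, hν,
      Measure.restrict_restrict Metric.isOpen_ball.measurableSet, Set.inter_comm]
  have hK₂B : ∀ x ∈ Ω, ∀ y ∈ Ω, (K₂ x y).toReal ≤ B := fun x hx y hy => by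
    refine ENNReal.toReal_le_of_le_ofReal hB ?_
    simp only [K₂, Set.indicator, Function.uncurry_apply_pair]
    split_ifs with h
    · exact hfar x hx y hy h
    · simp
  let T : ℕ → Eucl N → ℝ := fun n x => ∫ y, (K₂ x y).toReal * J (g n) y ∂ν
  have hTm : ∀ n, Measurable (T n) := fun n => by
    have : StronglyMeasurable (Function.uncurry fun x y => (K₂ x y).toReal * J (g n) y) :=
      (hK₂.ennreal_toReal.mul ((Lp.stronglyMeasurable (J (g n))).measurable.comp
        measurable_snd)).stronglyMeasurable
    exact this.integral_prod_right.measurable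
  have hψ : ∀ x ∈ Ω, MemLp (fun y => (K₂ x y).toReal) 2 ν := fun x hx => by
    refine MemLp.of_bound (hK₂x x).ennreal_toReal.aestronglyMeasurable B ?_
    filter_upwards [ae_restrict_mem hΩ] with y hy
    rw [Real.norm_of_nonneg ENNReal.toReal_nonneg]
    exact hK₂B x hx y hy
  have hTi : ∀ x ∈ Ω, ∀ h : H, Integrable (fun y => (K₂ x y).toReal * J h y) ν :=
    fun x hx h => (hψ x hx).integrable_mul (Lp.memLp (J h))
  -- For fixed x the far part pairs g n with a fixed element of H, so weak convergence gives
  -- pointwise convergence to 0. The uniform bound below then permits dominated convergence.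
  have hTeq : ∀ x, ∀ hx : x ∈ Ω, ∀ n,
      T n x = inner ℝ (g n) (adjoint J ((hψ x hx).toLp _)) := fun x hx n => by
    rw [ContinuousLinearMap.adjoint_inner_right, inner_L2_eq]
    refine integral_congr_ae ?_
    filter_upwards [(hψ x hx).coeFn_toLp] with y hy
    rw [hy, mul_comm]
  set B' := B * ((ν Set.univ).toReal + M) with hB'
  have hTb : ∀ n, ∀ x ∈ Ω, |T n x| ≤ B' := fun n x hx => by
    have i2 : Integrable (fun y => J (g n) y * J (g n) y) ν :=
      (Lp.memLp (J (g n))).integrable_mul (Lp.memLp (J (g n)))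
    have h1 : ∫ y, J (g n) y * J (g n) y ∂ν ≤ M := by
      rw [← inner_L2_eq, real_inner_self_eq_norm_sq]; exact hJM n
    calc |T n x| ≤ ∫ y, |(K₂ x y).toReal * J (g n) y| ∂ν := abs_integral_le_integral_abs
      _ ≤ ∫ y, B * (1 + J (g n) y * J (g n) y) ∂ν := by
          refine integral_mono_ae (hTi x hx (g n)).abs
            (((integrable_const 1).add i2).const_mul B) ?_
          filter_upwards [ae_restrict_mem hΩ] with y hy
          rw [abs_mul, abs_of_nonneg ENNReal.toReal_nonneg]
          gcongr
          · exact hK₂B x hx y hy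
          · rw [abs_le]; constructor <;> nlinarith [sq_nonneg (J (g n) y + 1), sq_nonneg (J (g n) y - 1)]
      _ = B * ((ν Set.univ).toReal + ∫ y, J (g n) y * J (g n) y ∂ν) := by
          rw [integral_const_mul, integral_add (integrable_const 1) i2]
          simp [Measure.real]
      _ ≤ _ := by rw [hB']; gcongr
  have hT0 : Tendsto (fun n => ∫⁻ x, ENNReal.ofReal (T n x ^ 2) ∂ν) atTop (𝓝 0) := by
    have := tendsto_lintegral_of_dominated_convergence (μ := ν)
      (F := fun n x => ENNReal.ofReal (T n x ^ 2)) (f := fun _ => 0)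
      (fun _ => ENNReal.ofReal (B' ^ 2)) (fun n => ((hTm n).pow_const 2).ennreal_ofReal) ?_ ?_ ?_
    · simpa using this
    · intro n
      filter_upwards [ae_restrict_mem hΩ] with x hx
      refine ENNReal.ofReal_le_ofReal ?_
      rw [← sq_abs]
      have := hTb n x hx
      gcongr
    · rw [lintegral_const]
      exact ENNReal.mul_ne_top ENNReal.ofReal_ne_top (measure_ne_top _ _)
    · filter_upwards [ae_restrict_mem hΩ] with x hx
      have h1 : Tendsto (fun n => T n x) atTop (𝓝 0) := by
        simp only [hTeq x hx]
        exact hw _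
      simpa using ENNReal.tendsto_ofReal (h1.pow 2)
  have hmain : ∀ n, ENNReal.ofReal (‖adjoint J (J (g n))‖ ^ 2) ≤
      ENNReal.ofReal (3 * η * M) + ENNReal.ofReal η⁻¹ * ∫⁻ x, ENNReal.ofReal (T n x ^ 2) ∂ν := by
    intro n
    set f := J (g n) with hf
    have hsq : ∫⁻ x, ‖f x‖ₑ ^ 2 ∂ν ≤ ENNReal.ofReal M := by
      rw [hν, lintegral_enorm_sq]
      exact ENNReal.ofReal_le_ofReal (hJM n)
    have e1 : ‖adjoint J f‖ ^ 2 = ∫ x, f x * greenOp Ω G f x ∂ν := by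
      rw [← real_inner_self_eq_norm_sq, ContinuousLinearMap.adjoint_inner_left, inner_L2_eq]
      refine integral_congr_ae ?_
      filter_upwards [S.adjoint_ae f] with x hx
      rw [hx]
    have m1 : AEMeasurable (fun x => ‖f x‖ₑ * ∫⁻ y, K₁ x y * ‖f y‖ₑ ∂ν) ν := by
      refine (aemeasurable_enorm f).mul ?_
      have : AEMeasurable (Function.uncurry fun x y => K₁ x y * ‖f y‖ₑ) (ν.prod ν) :=
        hK₁.aemeasurable.mul (aemeasurable_enorm f).comp_snd
      exact this.lintegral_prod_right'
    have m2 : AEMeasurable (fun x => ENNReal.ofReal η * ‖f x‖ₑ ^ 2) ν :=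
      ((aemeasurable_enorm f).pow_const 2).const_mul _
    calc ENNReal.ofReal (‖adjoint J f‖ ^ 2) ≤ ‖∫ x, f x * greenOp Ω G f x ∂ν‖ₑ := by
          rw [e1, Real.enorm_eq_ofReal_abs]
          exact ENNReal.ofReal_le_ofReal (le_abs_self _)
      _ ≤ ∫⁻ x, ‖f x * greenOp Ω G f x‖ₑ ∂ν := enorm_integral_le_lintegral_enorm _
      _ ≤ ∫⁻ x, ‖f x‖ₑ * (∫⁻ y, K₁ x y * ‖f y‖ₑ ∂ν) + (ENNReal.ofReal η * ‖f x‖ₑ ^ 2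
            + ENNReal.ofReal η⁻¹ * ENNReal.ofReal (T n x ^ 2)) ∂ν := by
          refine setLIntegral_mono_ae' hΩ (Eventually.of_forall fun x hx => ?_)
          have h1 : ‖greenOp Ω G f x‖ₑ ≤ (∫⁻ y, K₁ x y * ‖f y‖ₑ ∂ν) + ‖T n x‖ₑ := by
            have h2 : greenOp Ω G f x
                = ∫ y, (K₁ x y).toReal * f y + (K₂ x y).toReal * f y ∂ν := by
              rw [greenOp_eq S.green S.dim_pos f hx]
              refine integral_congr_ae (Eventually.of_forall fun y => ?_)
              simp only
              rw [hadd, ENNReal.toReal_add (hK₁fin x y) (hK₂fin x y), add_mul]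
            rw [h2]
            refine (enorm_integral_add_le ((hK₁x x).ennreal_toReal.aestronglyMeasurable.mul
              (Lp.aestronglyMeasurable f)) (hTi x hx (g n))).trans (add_le_add (le_of_eq ?_) le_rfl)
            refine lintegral_congr fun y => ?_
            rw [Pi.mul_apply, enorm_mul, Real.enorm_eq_ofReal ENNReal.toReal_nonneg,
              ENNReal.ofReal_toReal (hK₁fin x y)]
          rw [enorm_mul]
          refine (mul_le_mul' le_rfl h1).trans ?_
          rw [mul_add]
          gcongr
          rw [← enorm_mul, Real.enorm_eq_ofReal_abs, Real.enorm_eq_ofReal_abs,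
            ← ENNReal.ofReal_pow (abs_nonneg _), ← ENNReal.ofReal_mul hη0.le,
            ← ENNReal.ofReal_mul (by positivity), ← ENNReal.ofReal_add (by positivity)
              (by positivity), abs_mul, ← sq_abs (T n x)]
          refine ENNReal.ofReal_le_ofReal ?_
          have h3 : η⁻¹ * |T n x| ^ 2 = η * (η⁻¹ * |T n x|) ^ 2 := by field_simp
          have h4 : |f x| * |T n x| = η * (|f x| * (η⁻¹ * |T n x|)) := by field_simp
          rw [h3, h4, ← mul_add]
          gcongr
          nlinarith [sq_nonneg (|f x| - η⁻¹ * |T n x|), sq_nonneg (|f x| + η⁻¹ * |T n x|)]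
      _ = (∫⁻ x, ‖f x‖ₑ * (∫⁻ y, K₁ x y * ‖f y‖ₑ ∂ν) ∂ν)
            + (ENNReal.ofReal η * (∫⁻ x, ‖f x‖ₑ ^ 2 ∂ν)
              + ENNReal.ofReal η⁻¹ * ∫⁻ x, ENNReal.ofReal (T n x ^ 2) ∂ν) := by
          rw [lintegral_add_left' m1, lintegral_add_left' m2,
            lintegral_const_mul' _ _ ENNReal.ofReal_ne_top,
            lintegral_const_mul' _ _ ENNReal.ofReal_ne_top]
      _ ≤ (ENNReal.ofReal η * ENNReal.ofReal M + ENNReal.ofReal η * ENNReal.ofReal M)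
            + (ENNReal.ofReal η * ENNReal.ofReal M
              + ENNReal.ofReal η⁻¹ * ∫⁻ x, ENNReal.ofReal (T n x ^ 2) ∂ν) := by
          gcongr
          refine (lintegral_mul_kernel_le hK₁ hK₁s hK₁A (aemeasurable_enorm f)
            (aemeasurable_enorm f)).trans ?_
          gcongr
      _ = _ := by
          rw [← add_assoc, ← ENNReal.ofReal_mul hη0.le, ← ENNReal.ofReal_add (by positivity)
            (by positivity), ← ENNReal.ofReal_add (by positivity) (by positivity)]
          congr 2; ring
  have hev : ∀ᶠ n in atTop, ENNReal.ofReal η⁻¹ * ∫⁻ x, ENNReal.ofReal (T n x ^ 2) ∂ν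
      ≤ ENNReal.ofReal (η' / 8) := by
    have := ENNReal.Tendsto.const_mul (a := ENNReal.ofReal η⁻¹) hT0 (Or.inr ENNReal.ofReal_ne_top)
    rw [mul_zero] at this
    exact this.eventually (ge_mem_nhds (by simpa using hη'))
  obtain ⟨n₀, hn₀⟩ := eventually_atTop.1 hev
  refine ⟨n₀, fun n hn => ?_⟩
  have h1 := (hmain n).trans (add_le_add le_rfl (hn₀ n hn))
  rw [← ENNReal.ofReal_add (by positivity) (by positivity),
    ENNReal.ofReal_le_ofReal_iff (by positivity)] at h1
  have h2 : 3 * η * M ≤ η' / 4 := by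
    rw [hη]
    calc 3 * (η' / (4 * (3 * M + 1))) * M = η' / 4 * (3 * M / (3 * M + 1)) := by field_simp
      _ ≤ η' / 4 * 1 := by
          gcongr
          rw [div_le_one (by positivity)]; linarith
      _ = _ := mul_one _
  rw [Real.dist_eq, sub_zero, abs_of_nonneg (by positivity)]
  linarith

/-- The embedding of `ℍ(Ω)` into `L²(Ω)` is compact. -/
theorem tendsto_norm_of_weak (S : IsGreenSetting L s γ G J) {g : ℕ → H} {R : ℝ}
    (hg : ∀ n, ‖g n‖ ≤ R) (hw : ∀ ξ, Tendsto (fun n => inner ℝ (g n) ξ) atTop (𝓝 0)) :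
    Tendsto (fun n => ‖J (g n)‖ ^ 2) atTop (𝓝 0) := by
  have h1 : Tendsto (fun n => R * √(‖adjoint J (J (g n))‖ ^ 2)) atTop (𝓝 0) := by
    simpa using ((Real.continuous_sqrt.tendsto _).comp (S.tendsto_norm_adjoint hg hw)).const_mul R
  refine squeeze_zero (fun n => by positivity) (fun n => ?_) h1
  -- ‖J g‖² = ⟨g, J† J g⟩ ≤ R ‖J† J g‖.
  rw [Real.sqrt_sq (norm_nonneg _), ← real_inner_self_eq_norm_sq,
    ← ContinuousLinearMap.adjoint_inner_right]
  refine (real_inner_le_norm _ _).trans ?_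
  gcongr
  exact hg n

end IsGreenSetting

end Compactness

/-! ### Admissible weights -/

/-- Young's inequality for u^p δ^γ and |a|^(2p) δ^(-γ(p-1)), proved by comparing a² with M u δ^γ:
one factor is eliminated in each case. A large M makes the a-term small. -/
theorem rpow_mul_sq_le {p u a d γ M : ℝ} (hp : 1 < p) (hu : 0 < u) (hd : 0 < d) (hM : 0 < M) :
    u ^ (p - 1) * a ^ 2
      ≤ M ^ (1 - p) * (|a| ^ (2 * p) * d ^ (-(γ * (p - 1)))) + M * (u ^ p * d ^ γ) := by
  have hup : u ^ p = u ^ (p - 1) * u := by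
    rw [Real.rpow_sub_one hu.ne']; field_simp
  have hdg : 0 < d ^ γ := Real.rpow_pos_of_pos hd _
  rcases le_or_gt (a ^ 2) (M * (u * d ^ γ)) with h | h
  · have h1 : 0 ≤ M ^ (1 - p) * (|a| ^ (2 * p) * d ^ (-(γ * (p - 1)))) := by positivity
    have h2 : u ^ (p - 1) * a ^ 2 ≤ u ^ (p - 1) * (M * (u * d ^ γ)) := by gcongr
    rw [hup]
    linarith
  · have h1 : 0 ≤ M * (u ^ p * d ^ γ) := by positivity
    have ha : 0 < |a| := by
      refine abs_pos.2 fun h0 => ?_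
      rw [h0] at h
      have : 0 < M * (u * d ^ γ) := by positivity
      nlinarith
    have h3 : u ^ (p - 1) ≤ (a ^ 2 * (M⁻¹ * (d ^ γ)⁻¹)) ^ (p - 1) := by
      refine Real.rpow_le_rpow hu.le ?_ (by linarith)
      rw [← mul_inv, ← div_eq_mul_inv, le_div_iff₀ (by positivity)]
      linarith
    have h4 : (a ^ 2 * (M⁻¹ * (d ^ γ)⁻¹)) ^ (p - 1)
        = |a| ^ (2 * (p - 1)) * (M ^ (1 - p) * d ^ (-(γ * (p - 1)))) := by
      rw [Real.mul_rpow (by positivity) (by positivity), Real.mul_rpow (by positivity)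
        (by positivity), ← sq_abs, ← Real.rpow_natCast |a| 2, ← Real.rpow_mul ha.le,
        ← Real.rpow_neg hd.le, ← Real.rpow_mul hd.le, ← Real.rpow_neg_one M, ← Real.rpow_mul hM.le]
      congr 3
      · ring
      · ring
    have h5 : |a| ^ (2 * p) = |a| ^ (2 * (p - 1)) * a ^ 2 := by
      rw [← sq_abs a, ← Real.rpow_natCast |a| 2, ← Real.rpow_add ha]
      congr 1; push_cast; ring
    calc u ^ (p - 1) * a ^ 2
        ≤ |a| ^ (2 * (p - 1)) * (M ^ (1 - p) * d ^ (-(γ * (p - 1)))) * a ^ 2 := by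
          rw [← h4]; gcongr
      _ = M ^ (1 - p) * (|a| ^ (2 * p) * d ^ (-(γ * (p - 1)))) := by rw [h5]; ring
      _ ≤ _ := le_add_of_nonneg_right h1

/-- Young's inequality for |a|^p · |a|; the factor D^(γ(p-1)) d^(-γ(p-1)) ≥ 1 inserts the weight. -/
theorem abs_rpow_le {p a d γ D M : ℝ} (hp : 1 < p) (hγ : 0 ≤ γ) (hd : 0 < d) (hdD : d ≤ D)
    (hM : 0 < M) : |a| ^ (p + 1)
      ≤ M ^ (1 - p) * D ^ (γ * (p - 1)) * (|a| ^ (2 * p) * d ^ (-(γ * (p - 1))))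
        + M ^ (p - 1) * a ^ 2 := by
  set m := γ * (p - 1) with hm
  have hm0 : 0 ≤ m := mul_nonneg hγ (by linarith)
  have h1 : 1 ≤ D ^ m * d ^ (-m) := by
    rw [Real.rpow_neg hd.le, ← div_eq_mul_inv, le_div_iff₀ (by positivity), one_mul]
    gcongr
  set t := M ^ (p - 1) with ht
  have ht0 : 0 < t := by positivity
  have ht' : M ^ (1 - p) = t⁻¹ := by
    rw [ht, ← Real.rpow_neg hM.le]; congr 1; ring
  have h2 : |a| ^ (p + 1) = |a| ^ p * |a| :=
    Real.rpow_add_one' (abs_nonneg a) (by linarith)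
  have h3 : |a| ^ (2 * p) = (|a| ^ p) ^ 2 := by
    rw [← Real.rpow_natCast (|a| ^ p) 2, ← Real.rpow_mul (abs_nonneg a)]
    congr 1; push_cast; ring
  have h4 : |a| ^ p * |a| ≤ t⁻¹ * (|a| ^ p) ^ 2 + t * |a| ^ 2 := by
    have e : t⁻¹ * (|a| ^ p) ^ 2 = t * (t⁻¹ * |a| ^ p) ^ 2 := by field_simp
    have e2 : |a| ^ p * |a| = t * ((t⁻¹ * |a| ^ p) * |a|) := by field_simp
    rw [e, e2, ← mul_add]
    gcongr
    nlinarith [sq_nonneg (t⁻¹ * |a| ^ p - |a|), sq_nonneg (t⁻¹ * |a| ^ p + |a|)]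
  rw [h2, ht', h3, ← sq_abs a]
  refine h4.trans ?_
  gcongr ?_ + _
  calc t⁻¹ * (|a| ^ p) ^ 2 = t⁻¹ * (|a| ^ p) ^ 2 * 1 := (mul_one _).symm
    _ ≤ t⁻¹ * (|a| ^ p) ^ 2 * (D ^ m * d ^ (-m)) := by gcongr
    _ = _ := by ring

/-- The three terms become small for different reasons: the first for large M by the Sobolev bound,
the last for large K as a tail of u^p δ^γ, the middle one by L² convergence with M and K fixed. -/
theorem nlWeight_le {p u a d γ D M K : ℝ} (hp : 1 < p) (hγ : 0 ≤ γ) (hu : 0 < u) (hd : 0 < d)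
    (hdD : d ≤ D) (hM : 0 < M) (hK : 0 ≤ K) : nlWeight p u a
      ≤ M ^ (1 - p) * (1 + D ^ (γ * (p - 1))) * (|a| ^ (2 * p) * d ^ (-(γ * (p - 1))))
        + (K ^ (p - 1) + M ^ (p - 1)) * a ^ 2
        + M * (if K < u then u ^ p * d ^ γ else 0) := by
  have h1 := abs_rpow_le (a := a) hp hγ hd hdD hM
  have h2 := rpow_mul_sq_le (a := a) (γ := γ) hp hu hd hM
  have h3 : 0 ≤ M ^ (1 - p) * (|a| ^ (2 * p) * d ^ (-(γ * (p - 1)))) := by positivity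
  unfold nlWeight
  split_ifs with h
  · have : 0 ≤ K ^ (p - 1) * a ^ 2 := by positivity
    linarith
  · have : u ^ (p - 1) * a ^ 2 ≤ K ^ (p - 1) * a ^ 2 := by
      have : u ^ (p - 1) ≤ K ^ (p - 1) :=
        Real.rpow_le_rpow hu.le (not_lt.1 h) (by linarith)
      gcongr
    linarith

section Admissible

variable {N : ℕ} {Ω : TopologicalSpace.Opens (Eucl N)} {L : Test Ω →ₗ[ℝ] L2 Ω} {s γ : ℝ}
  {G : Eucl N → Eucl N → ℝ} {H : Type*} [NormedAddCommGroup H] [InnerProductSpace ℝ H]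
  [CompleteSpace H] {J : H →L[ℝ] L2 Ω}

namespace IsGreenSetting

/-- The weighted Sobolev inequality in homogeneous form. -/
theorem exists_weighted_bound_homogeneous (S : IsGreenSetting L s γ G J) {p : ℝ} (hp : 1 < p)
    (hpS : p * (N + γ - 2 * s) < N + γ) :
    ∃ C : ℝ, 0 ≤ C ∧ ∀ h : H,
      Integrable (fun x => |J h x| ^ (2 * p) * bdist Ω x ^ (-(γ * (p - 1))))
        (volume.restrict (Ω : Set (Eucl N))) ∧
      ∫ x in (Ω : Set (Eucl N)), |J h x| ^ (2 * p) * bdist Ω x ^ (-(γ * (p - 1)))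
        ≤ C * ‖h‖ ^ (2 * p) := by
  obtain ⟨r, C, hr, hC, hb⟩ := S.exists_weighted_bound hp hpS
  set ν := volume.restrict (Ω : Set (Eucl N)) with hν
  have hmeas : ∀ h : H, Measurable fun x => |J h x| ^ (2 * p) * bdist Ω x ^ (-(γ * (p - 1))) :=
    fun h => by
      have h1 : Measurable (J h) := (Lp.stronglyMeasurable (J h)).measurable
      have h2 := measurable_bdist (Ω := Ω)
      fun_prop
  have h0 : ∀ (h : H) x, 0 ≤ |J h x| ^ (2 * p) * bdist Ω x ^ (-(γ * (p - 1))) := fun h x => by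
    have := bdist_nonneg (Ω := Ω) x
    positivity
  have hsmall : ∀ h : H, ‖h‖ ≤ r →
      Integrable (fun x => |J h x| ^ (2 * p) * bdist Ω x ^ (-(γ * (p - 1)))) ν ∧
      ∫ x, |J h x| ^ (2 * p) * bdist Ω x ^ (-(γ * (p - 1))) ∂ν ≤ C := fun h hh => by
    have h1 := hb h hh
    refine ⟨⟨(hmeas h).aestronglyMeasurable, ?_⟩, ?_⟩
    · rw [hasFiniteIntegral_iff_ofReal (Eventually.of_forall (h0 h))]
      exact h1.trans_lt ENNReal.ofReal_lt_top
    · rw [integral_eq_lintegral_of_nonneg_ae (Eventually.of_forall (h0 h))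
        (hmeas h).aestronglyMeasurable]
      exact ENNReal.toReal_le_of_le_ofReal hC h1
  refine ⟨C * r ^ (-(2 * p)), by positivity, fun h => ?_⟩
  rcases eq_or_ne h 0 with rfl | hh
  · have h1 : (fun x => |J (0 : H) x| ^ (2 * p) * bdist Ω x ^ (-(γ * (p - 1)))) =ᵐ[ν]
        fun _ => 0 := by
      rw [map_zero]
      filter_upwards [Lp.coeFn_zero ℝ 2 ν] with x hx
      rw [hx, Pi.zero_apply, abs_zero, Real.zero_rpow (by linarith), zero_mul]
    refine ⟨(integrable_congr h1).2 (integrable_zero _ _ _), ?_⟩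
    rw [integral_congr_ae h1, integral_zero]
    positivity
  · have hn : 0 < ‖h‖ := norm_pos_iff.2 hh
    set c := r / ‖h‖ with hc
    have hc0 : 0 < c := by positivity
    have h1 : ‖c • h‖ ≤ r := by
      rw [norm_smul, Real.norm_of_nonneg hc0.le, hc]
      exact (by field_simp : r / ‖h‖ * ‖h‖ = r).le
    have h2 : (fun x => |J (c • h) x| ^ (2 * p) * bdist Ω x ^ (-(γ * (p - 1)))) =ᵐ[ν]
        fun x => c ^ (2 * p) * (|J h x| ^ (2 * p) * bdist Ω x ^ (-(γ * (p - 1)))) := by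
      rw [map_smul]
      filter_upwards [Lp.coeFn_smul c (J h)] with x hx
      rw [hx, Pi.smul_apply, smul_eq_mul, abs_mul, abs_of_pos hc0,
        Real.mul_rpow hc0.le (abs_nonneg _), mul_assoc]
    obtain ⟨h3, h4⟩ := hsmall _ h1
    rw [integrable_congr h2] at h3
    rw [integral_congr_ae h2, integral_const_mul] at h4
    have hcp : c ^ (2 * p) ≠ 0 := by positivity
    refine ⟨(integrable_const_mul_iff (IsUnit.mk0 _ hcp) _).1 h3, ?_⟩
    refine le_of_mul_le_mul_left (h4.trans (le_of_eq ?_)) (by positivity : 0 < c ^ (2 * p))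
    rw [hc, Real.div_rpow hr.le hn.le, Real.rpow_neg hr.le]
    field_simp

theorem exists_integral_nlWeight_le (S : IsGreenSetting L s γ G J) {p : ℝ} (hp : 1 < p)
    (hpS : p * (N + γ - 2 * s) < N + γ) {u : Eucl N → ℝ}
    (hum : AEStronglyMeasurable u (volume.restrict (Ω : Set (Eucl N))))
    (hu : ∀ᵐ x ∂volume.restrict (Ω : Set (Eucl N)), 0 < u x)
    (hui : Integrable (fun x => u x ^ p * bdist Ω x ^ γ)
      (volume.restrict (Ω : Set (Eucl N)))) :
    ∃ C : ℝ, 0 ≤ C ∧ ∀ h : H,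
      Integrable (fun x => nlWeight p (u x) (J h x)) (volume.restrict (Ω : Set (Eucl N))) ∧
      ∀ M K : ℝ, 0 < M → 0 ≤ K →
        ∫ x in (Ω : Set (Eucl N)), nlWeight p (u x) (J h x) ≤ M ^ (1 - p) * (C * ‖h‖ ^ (2 * p))
          + (K ^ (p - 1) + M ^ (p - 1)) * ‖J h‖ ^ 2
          + M * ∫ x in (Ω : Set (Eucl N)), if K < u x then u x ^ p * bdist Ω x ^ γ else 0 := by
  obtain ⟨C, hC, hW⟩ := S.exists_weighted_bound_homogeneous hp hpS
  obtain ⟨D, hD1, hD⟩ := exists_bdist_le S.bounded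
  set ν := volume.restrict (Ω : Set (Eucl N)) with hν
  have hΩ : MeasurableSet (Ω : Set (Eucl N)) := Ω.isOpen.measurableSet
  have hD0 : 0 < D := by linarith
  refine ⟨(1 + D ^ (γ * (p - 1))) * C, by positivity, fun h => ?_⟩
  obtain ⟨hWi, hWb⟩ := hW h
  have hsqi : Integrable (fun x => J h x ^ 2) ν := (Lp.memLp (J h)).integrable_sq
  have hsq : ∫ x, J h x ^ 2 ∂ν = ‖J h‖ ^ 2 := by
    rw [← real_inner_self_eq_norm_sq, inner_L2_eq]
    simp only [sq, hν]
  have hcut : ∀ K : ℝ, Integrable (fun x => if K < u x then u x ^ p * bdist Ω x ^ γ else 0) ν :=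
    fun K => by
      have hs : NullMeasurableSet {x | K < u x} ν :=
        nullMeasurableSet_lt aemeasurable_const hum.aemeasurable
      exact hui.indicator₀ hs
  have hb : ∀ M K : ℝ, 0 < M → 0 ≤ K → ∀ᵐ x ∂ν, nlWeight p (u x) (J h x)
      ≤ M ^ (1 - p) * (1 + D ^ (γ * (p - 1)))
          * (|J h x| ^ (2 * p) * bdist Ω x ^ (-(γ * (p - 1))))
        + (K ^ (p - 1) + M ^ (p - 1)) * J h x ^ 2
        + M * (if K < u x then u x ^ p * bdist Ω x ^ γ else 0) := fun M K hM hK => by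
    filter_upwards [hu, ae_restrict_mem hΩ] with x hx hxΩ
    exact nlWeight_le hp S.γ_pos.le hx (bdist_pos S.frontier hxΩ) (hD x hxΩ) hM hK
  have hi : ∀ M K : ℝ, Integrable (fun x => M ^ (1 - p) * (1 + D ^ (γ * (p - 1)))
          * (|J h x| ^ (2 * p) * bdist Ω x ^ (-(γ * (p - 1))))
        + (K ^ (p - 1) + M ^ (p - 1)) * J h x ^ 2
        + M * (if K < u x then u x ^ p * bdist Ω x ^ γ else 0)) ν := fun M K =>
    ((hWi.const_mul _).add (hsqi.const_mul _)).add ((hcut K).const_mul M)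
  have hint : Integrable (fun x => nlWeight p (u x) (J h x)) ν := by
    refine (hi 1 0).mono' ?_ ?_
    · have h1 : AEMeasurable u ν := hum.aemeasurable
      have h2 : AEMeasurable (J h) ν := (Lp.aestronglyMeasurable (J h)).aemeasurable
      unfold nlWeight
      exact (((h1.pow_const (p - 1)).mul (h2.pow_const 2)).add
        ((h2.abs).pow_const (p + 1))).aestronglyMeasurable
    · filter_upwards [hb 1 0 one_pos le_rfl, hu] with x hx hux
      rwa [Real.norm_of_nonneg (nlWeight_nonneg hux _)]
  refine ⟨hint, fun M K hM hK => ?_⟩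
  refine (integral_mono_ae hint (hi M K) (hb M K hM hK)).trans ?_
  have e : ∫ x, M ^ (1 - p) * (1 + D ^ (γ * (p - 1)))
          * (|J h x| ^ (2 * p) * bdist Ω x ^ (-(γ * (p - 1))))
        + (K ^ (p - 1) + M ^ (p - 1)) * J h x ^ 2
        + M * (if K < u x then u x ^ p * bdist Ω x ^ γ else 0) ∂ν
      = M ^ (1 - p) * (1 + D ^ (γ * (p - 1)))
          * (∫ x, |J h x| ^ (2 * p) * bdist Ω x ^ (-(γ * (p - 1))) ∂ν)
        + (K ^ (p - 1) + M ^ (p - 1)) * (∫ x, J h x ^ 2 ∂ν)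
        + M * ∫ x, (if K < u x then u x ^ p * bdist Ω x ^ γ else 0) ∂ν := by
    have i1 := hWi.const_mul (M ^ (1 - p) * (1 + D ^ (γ * (p - 1))))
    have i2 := hsqi.const_mul (K ^ (p - 1) + M ^ (p - 1))
    have i3 := (hcut K).const_mul M
    have i12 : Integrable (fun x => M ^ (1 - p) * (1 + D ^ (γ * (p - 1)))
          * (|J h x| ^ (2 * p) * bdist Ω x ^ (-(γ * (p - 1))))
        + (K ^ (p - 1) + M ^ (p - 1)) * J h x ^ 2) ν := i1.add i2
    rw [integral_add i12 i3, integral_add i1 i2, integral_const_mul, integral_const_mul,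
      integral_const_mul]
  rw [e, hsq]
  gcongr ?_ + _ + _
  calc M ^ (1 - p) * (1 + D ^ (γ * (p - 1)))
        * (∫ x, |J h x| ^ (2 * p) * bdist Ω x ^ (-(γ * (p - 1))) ∂ν)
      ≤ M ^ (1 - p) * (1 + D ^ (γ * (p - 1))) * (C * ‖h‖ ^ (2 * p)) := by gcongr
    _ = _ := by ring

theorem isAdmissible (S : IsGreenSetting L s γ G J) {p : ℝ} (hp : 1 < p)
    (hpS : p * (N + γ - 2 * s) < N + γ) {u : Eucl N → ℝ}
    (hum : AEStronglyMeasurable u (volume.restrict (Ω : Set (Eucl N))))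
    (hu : ∀ᵐ x ∂volume.restrict (Ω : Set (Eucl N)), 0 < u x)
    (hui : Integrable (fun x => u x ^ p * bdist Ω x ^ γ)
      (volume.restrict (Ω : Set (Eucl N)))) : IsAdmissible J p u := by
  obtain ⟨C, -, h⟩ := S.exists_integral_nlWeight_le hp hpS hum hu hui
  exact ⟨hp, hum, hu, fun k => (h k).1⟩

theorem exists_integral_nlWeight_bound (S : IsGreenSetting L s γ G J) {p : ℝ} (hp : 1 < p)
    (hpS : p * (N + γ - 2 * s) < N + γ) {u : Eucl N → ℝ}
    (hum : AEStronglyMeasurable u (volume.restrict (Ω : Set (Eucl N))))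
    (hu : ∀ᵐ x ∂volume.restrict (Ω : Set (Eucl N)), 0 < u x)
    (hui : Integrable (fun x => u x ^ p * bdist Ω x ^ γ)
      (volume.restrict (Ω : Set (Eucl N)))) :
    ∃ C : ℝ, ∀ k : H, ‖k‖ ≤ 1 →
      ∫ x in (Ω : Set (Eucl N)), nlWeight p (u x) (J k x) ≤ C := by
  obtain ⟨C, hC, h⟩ := S.exists_integral_nlWeight_le hp hpS hum hu hui
  refine ⟨_, fun k hk => ((h k).2 1 0 one_pos le_rfl).trans (c := (1 : ℝ) ^ (1 - p) * (C * 1 ^ (2 * p))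
    + (0 ^ (p - 1) + 1 ^ (p - 1)) * ‖J‖ ^ 2
    + 1 * ∫ x in (Ω : Set (Eucl N)), if 0 < u x then u x ^ p * bdist Ω x ^ γ else 0) ?_⟩
  have h1 : ‖J k‖ ≤ ‖J‖ := (J.le_opNorm k).trans (mul_le_of_le_one_right (norm_nonneg _) hk)
  have h2 : ‖k‖ ^ (2 * p) ≤ 1 ^ (2 * p) := Real.rpow_le_rpow (norm_nonneg _) hk (by linarith)
  gcongr

/-- Compactness of the embedding of `ℍ(Ω)` for the weight of the nonlinearity. -/
theorem exists_tendsto_nlWeight (S : IsGreenSetting L s γ G J) {p : ℝ} (hp : 1 < p)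
    (hpS : p * (N + γ - 2 * s) < N + γ) {u : Eucl N → ℝ}
    (hum : AEStronglyMeasurable u (volume.restrict (Ω : Set (Eucl N))))
    (hu : ∀ᵐ x ∂volume.restrict (Ω : Set (Eucl N)), 0 < u x)
    (hui : Integrable (fun x => u x ^ p * bdist Ω x ^ γ)
      (volume.restrict (Ω : Set (Eucl N)))) (h : ℕ → H) (hh : ∀ n, ‖h n‖ ≤ 1) :
    ∃ k : H, ‖k‖ ≤ 1 ∧ ∃ φ : ℕ → ℕ, StrictMono φ ∧
      Tendsto (fun n => ∫ x in (Ω : Set (Eucl N)), nlWeight p (u x) (J (h (φ n) - k) x))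
        atTop (𝓝 0) := by
  obtain ⟨C, hC, hw⟩ := S.exists_integral_nlWeight_le hp hpS hum hu hui
  have := S.energy.separableSpace
  obtain ⟨k, hk, φ, hφ, hlim⟩ := exists_weak_limit h hh
  refine ⟨k, hk, φ, hφ, ?_⟩
  set ν := volume.restrict (Ω : Set (Eucl N)) with hν
  set g : ℕ → H := fun n => h (φ n) - k with hg
  have hg2 : ∀ n, ‖g n‖ ≤ 2 := fun n => (norm_sub_le _ _).trans (by linarith [hh (φ n)])
  have hL2 := S.tendsto_norm_of_weak hg2 hlim
  have hcut : Tendsto (fun n : ℕ => ∫ x, (if (n : ℝ) < u x then u x ^ p * bdist Ω x ^ γ else 0) ∂ν)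
      atTop (𝓝 0) := by
    have := tendsto_integral_of_dominated_convergence (μ := ν)
      (F := fun (n : ℕ) x => if (n : ℝ) < u x then u x ^ p * bdist Ω x ^ γ else 0)
      (f := fun _ => 0) (fun x => |u x ^ p * bdist Ω x ^ γ|) ?_ hui.abs ?_ ?_
    · simpa using this
    · intro n
      have hs : NullMeasurableSet {x | (n : ℝ) < u x} ν :=
        nullMeasurableSet_lt aemeasurable_const hum.aemeasurable
      exact (hui.indicator₀ hs).aestronglyMeasurable
    · refine fun n => Eventually.of_forall fun x => ?_
      split_ifs
      · rw [Real.norm_eq_abs]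
      · rw [norm_zero]; positivity
    · refine Eventually.of_forall fun x => ?_
      obtain ⟨n₀, hn₀⟩ := exists_nat_ge (u x)
      refine tendsto_const_nhds.congr' ?_
      filter_upwards [eventually_ge_atTop n₀] with n hn
      rw [if_neg (not_lt.2 (hn₀.trans (by exact_mod_cast hn)))]
  have hnn : ∀ n, 0 ≤ ∫ x, nlWeight p (u x) (J (g n) x) ∂ν := fun n => by
    refine integral_nonneg_of_ae ?_
    filter_upwards [hu] with x hx using nlWeight_nonneg hx _
  refine Metric.tendsto_atTop.2 fun ε hε => ?_
  have hM : Tendsto (fun M : ℝ => M ^ (1 - p) * (C * 2 ^ (2 * p))) atTop (𝓝 0) := by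
    have h1 := (tendsto_rpow_neg_atTop (y := p - 1) (by linarith)).mul_const (C * 2 ^ (2 * p))
    rw [zero_mul] at h1
    simpa using h1
  -- The order matters: M first, then K depending on M, then the index depending on both.
  obtain ⟨M, hM1, hM0⟩ := ((hM.eventually (gt_mem_nhds (by positivity : 0 < ε / 3))).and
    (eventually_gt_atTop 0)).exists
  have hK := hcut.const_mul M
  rw [mul_zero] at hK
  obtain ⟨K, hK1⟩ := (hK.eventually (gt_mem_nhds (by positivity : 0 < ε / 3))).exists
  have hJ := hL2.const_mul ((K : ℝ) ^ (p - 1) + M ^ (p - 1))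
  rw [mul_zero] at hJ
  obtain ⟨n₀, hn₀⟩ := eventually_atTop.1 (hJ.eventually (gt_mem_nhds (by positivity : 0 < ε / 3)))
  refine ⟨n₀, fun n hn => ?_⟩
  rw [Real.dist_eq, sub_zero, abs_of_nonneg (hnn n)]
  refine ((hw (g n)).2 M K hM0 (by positivity)).trans_lt ?_
  have h1 : ‖g n‖ ^ (2 * p) ≤ 2 ^ (2 * p) :=
    Real.rpow_le_rpow (norm_nonneg _) (hg2 n) (by linarith)
  have h2 : M ^ (1 - p) * (C * ‖g n‖ ^ (2 * p)) ≤ M ^ (1 - p) * (C * 2 ^ (2 * p)) := by gcongr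
  have h3 := hn₀ n hn
  linarith

end IsGreenSetting

end Admissible

/-! ### Potentials of measures and weak-dual solutions -/

section WeakDual

variable {N : ℕ} {Ω : TopologicalSpace.Opens (Eucl N)} {L : Test Ω →ₗ[ℝ] L2 Ω} {s γ p : ℝ}
  {G : Eucl N → Eucl N → ℝ} {μ ρ : Measure (Eucl N)} {lam : ℝ}

/-- `∫ G(x, y) dρ(x)` with values in `[0, ∞]`. -/
def measurePotential (Ω : TopologicalSpace.Opens (Eucl N)) (G : Eucl N → Eucl N → ℝ)
    (ρ : Measure (Eucl N)) (y : Eucl N) : ℝ≥0∞ :=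
  ∫⁻ x, greenKernel Ω G x y ∂ρ

theorem measurable_measurePotential (hG : IsGreenFunction L s γ G) [SFinite ρ] :
    Measurable (measurePotential Ω G ρ) :=
  hG.measurable_kernel.lintegral_prod_left

theorem measurePotential_withDensity (hG : IsGreenFunction L s γ G) {f : Eucl N → ℝ≥0∞}
    (hf : AEMeasurable f (volume.restrict (Ω : Set (Eucl N)))) :
    measurePotential Ω G ((volume.restrict (Ω : Set (Eucl N))).withDensity f)
      = greenPotential Ω G f := by
  funext y
  have hm : AEMeasurable (fun x => greenKernel Ω G x y) (volume.restrict (Ω : Set (Eucl N))) := by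
    simp only [hG.kernel_symm _ y]
    exact (measurable_kernel_left hG y).aemeasurable
  rw [measurePotential, lintegral_withDensity_eq_lintegral_mul₀ hf hm]
  refine lintegral_congr fun x => ?_
  rw [Pi.mul_apply, hG.kernel_symm x y, mul_comm]

theorem lintegral_measurePotential_mul (hG : IsGreenFunction L s γ G) [SFinite ρ]
    {g : Eucl N → ℝ≥0∞} (hg : AEMeasurable g (volume.restrict (Ω : Set (Eucl N)))) :
    ∫⁻ y in (Ω : Set (Eucl N)), measurePotential Ω G ρ y * g y
      = ∫⁻ x, greenPotential Ω G g x ∂ρ := by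
  set ν := volume.restrict (Ω : Set (Eucl N)) with hν
  have m1 : AEMeasurable (Function.uncurry fun x y => greenKernel Ω G x y * g y) (ρ.prod ν) :=
    hG.measurable_kernel.aemeasurable.mul hg.comp_snd
  unfold greenPotential
  rw [lintegral_lintegral_swap m1]
  refine lintegral_congr fun y => ?_
  have hm : Measurable fun x => greenKernel Ω G x y := by
    simp only [hG.kernel_symm _ y]
    exact measurable_kernel_left hG y
  rw [lintegral_mul_const _ hm, measurePotential]

/-- The geometric data, without reference to the energy space. -/
structure IsGreenDomain (L : Test Ω →ₗ[ℝ] L2 Ω) (s γ : ℝ) (G : Eucl N → Eucl N → ℝ) : Prop where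
  green : IsGreenFunction L s γ G
  dim_pos : 0 < N
  s_pos : 0 < s
  γ_pos : 0 < γ
  frontier : (frontier (Ω : Set (Eucl N))).Nonempty
  bounded : Bornology.IsBounded (Ω : Set (Eucl N))

namespace IsGreenDomain

theorem isFiniteMeasure (S : IsGreenDomain L s γ G) :
    IsFiniteMeasure (volume.restrict (Ω : Set (Eucl N))) :=
  ⟨by rw [Measure.restrict_apply_univ]; exact S.bounded.measure_lt_top⟩

theorem weight_pos (S : IsGreenDomain L s γ G) {x : Eucl N} (hx : x ∈ Ω) : 0 < bdist Ω x ^ γ :=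
  Real.rpow_pos_of_pos (bdist_pos S.frontier hx) _

/-- The bound 𝔾[δ^γ] ≤ A δ^γ makes δ^γ the natural weight for the sources. -/
theorem lintegral_greenPotential_lt_top (S : IsGreenDomain L s γ G) (hρΩ : ∀ᵐ x ∂ρ, x ∈ Ω)
    (hρ : ∫⁻ x, ENNReal.ofReal (bdist Ω x ^ γ) ∂ρ < ∞) :
    ∫⁻ x, greenPotential Ω G (fun y => ENNReal.ofReal (bdist Ω y ^ γ)) x ∂ρ < ∞ := by
  obtain ⟨A, hA', hA⟩ := S.green.exists_lintegral_kernel_mul_le S.s_pos S.γ_pos.le S.dim_pos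
    S.frontier S.bounded
  calc ∫⁻ x, greenPotential Ω G (fun y => ENNReal.ofReal (bdist Ω y ^ γ)) x ∂ρ
      ≤ ∫⁻ x, A * ENNReal.ofReal (bdist Ω x ^ γ) ∂ρ := by
        refine lintegral_mono_ae ?_
        filter_upwards [hρΩ] with x hx using hA x hx
    _ = A * ∫⁻ x, ENNReal.ofReal (bdist Ω x ^ γ) ∂ρ := lintegral_const_mul' _ _ hA'.ne
    _ < ∞ := ENNReal.mul_lt_top hA' hρ

/-- By Tonelli the potential is integrable against the positive weight δ^γ, hence finite almost
everywhere. -/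
theorem measurePotential_lt_top (S : IsGreenDomain L s γ G) [SFinite ρ] (hρΩ : ∀ᵐ x ∂ρ, x ∈ Ω)
    (hρ : ∫⁻ x, ENNReal.ofReal (bdist Ω x ^ γ) ∂ρ < ∞) :
    ∀ᵐ y ∂volume.restrict (Ω : Set (Eucl N)), measurePotential Ω G ρ y < ∞ := by
  have hw : Measurable fun y => ENNReal.ofReal (bdist Ω y ^ γ) := by
    have := measurable_bdist (Ω := Ω)
    fun_prop
  have h1 := S.lintegral_greenPotential_lt_top hρΩ hρ
  rw [← lintegral_measurePotential_mul S.green hw.aemeasurable] at h1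
  have h2 : ∀ᵐ y ∂volume.restrict (Ω : Set (Eucl N)),
      measurePotential Ω G ρ y * ENNReal.ofReal (bdist Ω y ^ γ) < ∞ :=
    ae_lt_top ((measurable_measurePotential S.green).mul hw) h1.ne
  filter_upwards [h2, ae_restrict_mem Ω.isOpen.measurableSet] with y hy hyΩ
  by_contra hcon
  rw [not_lt_top_iff] at hcon
  have hd := S.weight_pos hyΩ
  rw [hcon, ENNReal.top_mul (by simpa using hd)] at hy
  exact lt_irrefl _ hy

/-- Fubini's theorem for the Green operator and a measure. -/
theorem integral_greenOp_measure (S : IsGreenDomain L s γ G) [SFinite ρ] (hρΩ : ∀ᵐ x ∂ρ, x ∈ Ω)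
    (hρ : ∫⁻ x, ENNReal.ofReal (bdist Ω x ^ γ) ∂ρ < ∞) {f : Eucl N → ℝ}
    (hf : AEStronglyMeasurable f (volume.restrict (Ω : Set (Eucl N)))) {B : ℝ} (hB : 0 ≤ B)
    (hfB : ∀ᵐ y ∂volume.restrict (Ω : Set (Eucl N)), |f y| ≤ B * bdist Ω y ^ γ) :
    Integrable (greenOp Ω G f) ρ ∧
    Integrable (fun y => (measurePotential Ω G ρ y).toReal * f y)
      (volume.restrict (Ω : Set (Eucl N))) ∧
    ∫ x, greenOp Ω G f x ∂ρ
      = ∫ y in (Ω : Set (Eucl N)), (measurePotential Ω G ρ y).toReal * f y := by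
  set ν := volume.restrict (Ω : Set (Eucl N)) with hν
  have hK : Measurable fun z : Eucl N × Eucl N => (greenKernel Ω G z.1 z.2).toReal :=
    S.green.measurable_kernel.ennreal_toReal
  have hFm : AEStronglyMeasurable
      (fun z : Eucl N × Eucl N => (greenKernel Ω G z.1 z.2).toReal * f z.2) (ρ.prod ν) :=
    hK.aestronglyMeasurable.mul hf.comp_snd
  have hF : Integrable
      (fun z : Eucl N × Eucl N => (greenKernel Ω G z.1 z.2).toReal * f z.2) (ρ.prod ν) := by
    refine ⟨hFm, ?_⟩
    rw [hasFiniteIntegral_iff_enorm, lintegral_prod _ hFm.enorm]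
    calc ∫⁻ x, ∫⁻ y, ‖(greenKernel Ω G x y).toReal * f y‖ₑ ∂ν ∂ρ
        ≤ ∫⁻ x, ENNReal.ofReal B
            * greenPotential Ω G (fun y => ENNReal.ofReal (bdist Ω y ^ γ)) x ∂ρ := by
          refine lintegral_mono fun x => ?_
          unfold greenPotential
          rw [← lintegral_const_mul' _ _ ENNReal.ofReal_ne_top]
          refine lintegral_mono_ae ?_
          filter_upwards [hfB] with y hy
          rw [enorm_kernel_mul, Real.enorm_eq_ofReal_abs]
          calc greenKernel Ω G x y * ENNReal.ofReal |f y|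
              ≤ greenKernel Ω G x y * ENNReal.ofReal (B * bdist Ω y ^ γ) := by gcongr
            _ = _ := by rw [ENNReal.ofReal_mul hB]; ring
      _ < ∞ := by
          rw [lintegral_const_mul' _ _ ENNReal.ofReal_ne_top]
          exact ENNReal.mul_lt_top ENNReal.ofReal_lt_top
            (S.lintegral_greenPotential_lt_top hρΩ hρ)
  have e1 : (fun x => ∫ y, (greenKernel Ω G x y).toReal * f y ∂ν) =ᵐ[ρ] greenOp Ω G f := by
    filter_upwards [hρΩ] with x hx
    exact (greenOp_eq S.green S.dim_pos f hx).symm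
  have e2 : (fun y => ∫ x, (greenKernel Ω G x y).toReal * f y ∂ρ)
      = fun y => (measurePotential Ω G ρ y).toReal * f y := by
    funext y
    have hm : Measurable fun x => greenKernel Ω G x y := by
      simp only [S.green.kernel_symm _ y]
      exact measurable_kernel_left S.green y
    rw [integral_mul_const, integral_toReal hm.aemeasurable
      (Eventually.of_forall fun x => greenKernel_lt_top x y), measurePotential]
  refine ⟨(integrable_congr e1).1 hF.integral_prod_left, e2 ▸ hF.integral_prod_right, ?_⟩
  rw [← integral_congr_ae e1, ← e2]
  exact integral_integral_swap hF

end IsGreenDomain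

/-- On Ω the measure is δ^(-γ) times the finite measure δ^γ μ. The Fubini arguments for μ rest on
this. -/
theorem sFinite_of_unitWeighted (S : IsGreenDomain L s γ G) (hμ : IsUnitWeightedMeasure Ω γ μ) :
    SFinite (μ.restrict (Ω : Set (Eucl N))) := by
  have hw : Measurable fun y => ENNReal.ofReal (bdist Ω y ^ γ) := by
    have := measurable_bdist (Ω := Ω)
    fun_prop
  set m := (μ.restrict (Ω : Set (Eucl N))).withDensity fun y => ENNReal.ofReal (bdist Ω y ^ γ)
    with hm
  have : IsFiniteMeasure m := ⟨by
    rw [hm, withDensity_apply _ MeasurableSet.univ, setLIntegral_univ, hμ]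
    exact ENNReal.one_lt_top⟩
  have h1 := withDensity_inv_same (μ := μ.restrict (Ω : Set (Eucl N))) hw (by
    filter_upwards [ae_restrict_mem Ω.isOpen.measurableSet] with y hy
    simpa using S.weight_pos hy) (Eventually.of_forall fun y => ENNReal.ofReal_ne_top)
  rw [← h1]
  infer_instance

/-- The right hand side `u^p + λ μ` as a measure on `Ω`. -/
def sourceMeasure (Ω : TopologicalSpace.Opens (Eucl N)) (p : ℝ) (μ : Measure (Eucl N)) (lam : ℝ)
    (u : Eucl N → ℝ) : Measure (Eucl N) :=
  (volume.restrict (Ω : Set (Eucl N))).withDensity (fun x => ENNReal.ofReal (u x ^ p))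
    + ENNReal.ofReal lam • μ.restrict (Ω : Set (Eucl N))

theorem measurePotential_sourceMeasure (hG : IsGreenFunction L s γ G) {u : Eucl N → ℝ}
    (hu : AEStronglyMeasurable u (volume.restrict (Ω : Set (Eucl N)))) (y : Eucl N) :
    measurePotential Ω G (sourceMeasure Ω p μ lam u) y
      = greenPotential Ω G (fun x => ENNReal.ofReal (u x ^ p)) y
        + ENNReal.ofReal lam * measurePotential Ω G (μ.restrict (Ω : Set (Eucl N))) y := by
  rw [← measurePotential_withDensity hG (hu.aemeasurable.pow_const p).ennreal_ofReal]
  simp only [measurePotential, sourceMeasure]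
  rw [lintegral_add_measure, lintegral_smul_measure, smul_eq_mul]

/-- The kernel is 0 on the diagonal, so the potential may vanish at one point, as for a Dirac mass.
Vanishing at two points would concentrate μ on each of two disjoint singletons, hence force μ = 0 on
Ω. -/
theorem measurePotential_pos (S : IsGreenDomain L s γ G) (hμ : IsUnitWeightedMeasure Ω γ μ) :
    ∀ᵐ y ∂volume.restrict (Ω : Set (Eucl N)),
      0 < measurePotential Ω G (μ.restrict (Ω : Set (Eucl N))) y := by
  have hΩ : MeasurableSet (Ω : Set (Eucl N)) := Ω.isOpen.measurableSet
  have : Nonempty (Fin N) := ⟨⟨0, S.dim_pos⟩⟩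
  have hsub : {y | y ∈ Ω ∧ measurePotential Ω G (μ.restrict (Ω : Set (Eucl N))) y = 0}.Subsingleton
      := by
    rintro a ⟨ha, ha0⟩ b ⟨hb, hb0⟩
    by_contra hab
    have hm : ∀ y, Measurable fun x => greenKernel Ω G x y := fun y => by
      simp only [S.green.kernel_symm _ y]
      exact measurable_kernel_left S.green y
    rw [measurePotential, lintegral_eq_zero_iff (hm _)] at ha0 hb0
    have h0 : ∀ᵐ x ∂μ.restrict (Ω : Set (Eucl N)), False := by
      filter_upwards [ha0, hb0, ae_restrict_mem hΩ] with x hxa hxb hxΩ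
      have h1 : x = a := by
        by_contra h
        exact (S.green.kernel_pos hxΩ ha h).ne' hxa
      have h2 : x = b := by
        by_contra h
        exact (S.green.kernel_pos hxΩ hb h).ne' hxb
      exact hab (h1.symm.trans h2)
    have h1 : ∫⁻ x in (Ω : Set (Eucl N)), ENNReal.ofReal (bdist Ω x ^ γ) ∂μ = 0 := by
      rw [lintegral_congr_ae (g := fun _ => 0) (h0.mono fun x hx => hx.elim), lintegral_zero]
    have h2 : ∫⁻ x in (Ω : Set (Eucl N)), ENNReal.ofReal (bdist Ω x ^ γ) ∂μ = 1 := hμ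
    rw [h1] at h2
    exact zero_ne_one h2
  have h0 : ∀ᵐ y ∂volume.restrict (Ω : Set (Eucl N)),
      y ∉ {y | y ∈ Ω ∧ measurePotential Ω G (μ.restrict (Ω : Set (Eucl N))) y = 0} :=
    measure_eq_zero_iff_ae_notMem.1 (hsub.measure_zero _)
  filter_upwards [h0, ae_restrict_mem hΩ] with y hy hyΩ
  exact pos_iff_ne_zero.2 fun h => hy ⟨hyΩ, h⟩

/-- Common facts on the right hand side of the equation. -/
theorem sourceMeasure_facts (S : IsGreenDomain L s γ G) (hμ : IsUnitWeightedMeasure Ω γ μ)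
    {u : Eucl N → ℝ} (hu : AEStronglyMeasurable u (volume.restrict (Ω : Set (Eucl N))))
    (hpos : ∀ᵐ x ∂volume.restrict (Ω : Set (Eucl N)), 0 < u x)
    (hi : Integrable (fun x => u x ^ p * bdist Ω x ^ γ) (volume.restrict (Ω : Set (Eucl N)))) :
    SFinite (sourceMeasure Ω p μ lam u) ∧ (∀ᵐ x ∂sourceMeasure Ω p μ lam u, x ∈ Ω) ∧
      ∫⁻ x, ENNReal.ofReal (bdist Ω x ^ γ) ∂sourceMeasure Ω p μ lam u < ∞ := by
  have hs := sFinite_of_unitWeighted S hμ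
  have hΩ : MeasurableSet (Ω : Set (Eucl N)) := Ω.isOpen.measurableSet
  have hw : Measurable fun y => ENNReal.ofReal (bdist Ω y ^ γ) := by
    have := measurable_bdist (Ω := Ω)
    fun_prop
  have hum : AEMeasurable (fun x => ENNReal.ofReal (u x ^ p))
      (volume.restrict (Ω : Set (Eucl N))) := (hu.aemeasurable.pow_const p).ennreal_ofReal
  refine ⟨by unfold sourceMeasure; infer_instance, ?_, ?_⟩
  · unfold sourceMeasure
    rw [ae_add_measure_iff]
    exact ⟨(withDensity_absolutelyContinuous _ _).ae_le (ae_restrict_mem hΩ),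
      Measure.ae_smul_measure (ae_restrict_mem hΩ) _⟩
  · unfold sourceMeasure
    rw [lintegral_add_measure, lintegral_smul_measure, smul_eq_mul, hμ,
      lintegral_withDensity_eq_lintegral_mul₀ hum hw.aemeasurable]
    refine ENNReal.add_lt_top.2 ⟨?_, by simp⟩
    have h1 := hi.2
    rw [hasFiniteIntegral_iff_enorm] at h1
    refine lt_of_le_of_lt (lintegral_mono_ae ?_) h1
    filter_upwards [hpos] with x hx
    rw [Pi.mul_apply, ← ENNReal.ofReal_mul (by positivity), Real.enorm_eq_ofReal_abs]
    exact ENNReal.ofReal_le_ofReal (le_abs_self _)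

theorem integral_sourceMeasure {f u : Eucl N → ℝ} (hlam : 0 ≤ lam)
    (hu : AEStronglyMeasurable u (volume.restrict (Ω : Set (Eucl N))))
    (hpos : ∀ᵐ x ∂volume.restrict (Ω : Set (Eucl N)), 0 < u x)
    (hf : Integrable f (sourceMeasure Ω p μ lam u)) :
    ∫ x, f x ∂sourceMeasure Ω p μ lam u
      = (∫ x in (Ω : Set (Eucl N)), u x ^ p * f x) + lam * ∫ x in (Ω : Set (Eucl N)), f x ∂μ := by
  unfold sourceMeasure at hf ⊢
  have hum : AEMeasurable (fun x => ENNReal.ofReal (u x ^ p))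
      (volume.restrict (Ω : Set (Eucl N))) := (hu.aemeasurable.pow_const p).ennreal_ofReal
  rw [integral_add_measure (hf.mono_measure (Measure.le_add_right le_rfl))
    (hf.mono_measure (Measure.le_add_left le_rfl)), integral_smul_measure,
    ENNReal.toReal_ofReal hlam, smul_eq_mul,
    integral_withDensity_eq_integral_toReal_smul₀ hum
      (Eventually.of_forall fun x => ENNReal.ofReal_lt_top)]
  congr 1
  refine integral_congr_ae ?_
  filter_upwards [hpos] with x hx
  rw [ENNReal.toReal_ofReal (by positivity), smul_eq_mul]

/-- Weak-dual solutions are the fixed points of `u ↦ 𝔾[u^p + λ μ]`. -/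
theorem isPositiveWeakDualSolution_iff (S : IsGreenDomain L s γ G)
    (hμ : IsUnitWeightedMeasure Ω γ μ) (hlam : 0 < lam) {u : Eucl N → ℝ} :
    IsPositiveWeakDualSolution Ω γ p G μ lam u ↔
      AEStronglyMeasurable u (volume.restrict (Ω : Set (Eucl N))) ∧
      (∀ᵐ x ∂volume.restrict (Ω : Set (Eucl N)), 0 < u x) ∧
      Integrable (fun x => u x ^ p * bdist Ω x ^ γ) (volume.restrict (Ω : Set (Eucl N))) ∧
      ∀ᵐ x ∂volume.restrict (Ω : Set (Eucl N)), ENNReal.ofReal (u x)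
        = greenPotential Ω G (fun y => ENNReal.ofReal (u y ^ p)) x
          + ENNReal.ofReal lam * measurePotential Ω G (μ.restrict (Ω : Set (Eucl N))) x := by
  set ν := volume.restrict (Ω : Set (Eucl N)) with hν
  have hΩ : MeasurableSet (Ω : Set (Eucl N)) := Ω.isOpen.measurableSet
  have hfin := S.isFiniteMeasure
  have hbm := measurable_bdist (Ω := Ω)
  have habs : (∀ᵐ x ∂ν, 0 < u x) →
      (fun x => |u x| ^ p * bdist Ω x ^ γ) =ᵐ[ν] fun x => u x ^ p * bdist Ω x ^ γ := fun h => by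
    filter_upwards [h] with x hx
    rw [abs_of_pos hx]
  have htest : ∀ w : Eucl N → ℝ, MemLp w ⊤ ν → ∃ B : ℝ, 0 ≤ B ∧
      AEStronglyMeasurable (fun y => bdist Ω y ^ γ * w y) ν ∧
      ∀ᵐ y ∂ν, |bdist Ω y ^ γ * w y| ≤ B * bdist Ω y ^ γ := fun w hw => by
    have hB : ∀ᵐ y ∂ν, |w y| ≤ (eLpNorm w ⊤ ν).toReal := by
      filter_upwards [ae_le_eLpNormEssSup (f := w) (μ := ν)] with y hy
      rw [← eLpNorm_exponent_top, Real.enorm_eq_ofReal_abs] at hy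
      exact (ENNReal.ofReal_le_iff_le_toReal hw.2.ne).1 hy
    refine ⟨(eLpNorm w ⊤ ν).toReal, ENNReal.toReal_nonneg, ((hbm.pow_const γ).aestronglyMeasurable).mul hw.1, ?_⟩
    filter_upwards [hB, ae_restrict_mem hΩ] with y hy hyΩ
    have := S.weight_pos hyΩ
    rw [abs_mul, abs_of_pos this, mul_comm]
    gcongr
  constructor
  · intro h
    have hi : Integrable (fun x => u x ^ p * bdist Ω x ^ γ) ν :=
      (integrable_congr (habs h.pos)).1 h.integrable
    refine ⟨h.measurable, h.pos, hi, ?_⟩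
    obtain ⟨hs, hρΩ, hρ⟩ := sourceMeasure_facts (lam := lam) S hμ h.measurable h.pos hi
    set ρ := sourceMeasure Ω p μ lam u with hρd
    have hlt := S.measurePotential_lt_top hρΩ hρ
    have hpp : ∀ᵐ y ∂ν, 0 < measurePotential Ω G ρ y := by
      filter_upwards [measurePotential_pos S hμ] with y hy
      rw [hρd, measurePotential_sourceMeasure S.green h.measurable]
      exact lt_of_lt_of_le (ENNReal.mul_pos (by simpa using hlam) hy.ne') le_add_self
    have key : ∀ w : Eucl N → ℝ, MemLp w ⊤ ν →
        Integrable (fun y => (measurePotential Ω G ρ y).toReal * (bdist Ω y ^ γ * w y)) ν ∧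
        ∫ x, u x * (bdist Ω x ^ γ * w x) ∂ν
          = ∫ y, (measurePotential Ω G ρ y).toReal * (bdist Ω y ^ γ * w y) ∂ν := fun w hw => by
      obtain ⟨B, hB0, hm, hB⟩ := htest w hw
      obtain ⟨i1, i2, e⟩ := S.integral_greenOp_measure hρΩ hρ hm hB0 hB
      refine ⟨i2, ?_⟩
      rw [h.eq w hw, ← e, integral_sourceMeasure hlam.le h.measurable h.pos i1]
    -- Integrability of u δ^γ is not part of the definition. Testing with w = 1 recovers it: the
    -- right side is positive, whereas the integral of a nonintegrable function has the default
    -- value 0.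
    obtain ⟨i1, e1⟩ := key (fun _ => 1) (memLp_const 1)
    simp only [mul_one] at i1 e1
    have hpos1 : 0 < ∫ y, (measurePotential Ω G ρ y).toReal * bdist Ω y ^ γ ∂ν := by
      have hp1 : ∀ᵐ y ∂ν, 0 < (measurePotential Ω G ρ y).toReal * bdist Ω y ^ γ := by
        filter_upwards [hlt, hpp, ae_restrict_mem hΩ] with y h1 h2 h3
        exact mul_pos (ENNReal.toReal_pos h2.ne' h1.ne) (S.weight_pos h3)
      rw [integral_pos_iff_support_of_nonneg_ae (hp1.mono fun y hy => hy.le) i1]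
      rw [pos_iff_ne_zero]
      intro h0
      have h1 : ∀ᵐ y ∂ν, False := by
        filter_upwards [hp1, measure_eq_zero_iff_ae_notMem.1 h0] with y h2 h3
        exact h3 h2.ne'
      have h2 : IsUnitWeightedMeasure Ω γ μ := hμ
      rcases (Ω : Set (Eucl N)).eq_empty_or_nonempty with h3 | h3
      · rw [IsUnitWeightedMeasure, h3] at h2
        simp at h2
      · have h4 : ν Set.univ = 0 := by
          rw [ae_iff] at h1
          simpa using h1
        rw [hν, Measure.restrict_apply_univ] at h4
        exact (Ω.isOpen.measure_pos volume h3).ne' h4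
    have i2 : Integrable (fun x => u x * bdist Ω x ^ γ) ν := by
      by_contra hcon
      rw [integral_undef hcon] at e1
      linarith
    have hd : (fun x => u x * bdist Ω x ^ γ - (measurePotential Ω G ρ x).toReal * bdist Ω x ^ γ)
        =ᵐ[ν] 0 := by
      -- Indicators of measurable sets are admissible w, so the weighted difference has vanishing
      -- integral over every set.
      refine (i2.sub i1).ae_eq_zero_of_forall_setIntegral_eq_zero fun E hE _ => ?_
      obtain ⟨i3, e3⟩ := key (E.indicator fun _ => 1)
        (memLp_indicator_const ⊤ hE 1 (Or.inr (measure_ne_top _ _)))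
      have h1 : ∀ g : Eucl N → ℝ, ∫ x, g x * (bdist Ω x ^ γ * E.indicator (fun _ => 1) x) ∂ν
          = ∫ x in E, g x * bdist Ω x ^ γ ∂ν := fun g => by
        rw [← integral_indicator hE]
        refine integral_congr_ae (Eventually.of_forall fun x => ?_)
        by_cases hx : x ∈ E <;> simp [hx]
      rw [h1, h1] at e3
      simp only [Pi.sub_apply]
      rw [integral_sub i2.integrableOn i1.integrableOn, e3, sub_self]
    filter_upwards [hd, hlt, ae_restrict_mem hΩ] with x h1 h2 h3
    have h4 := S.weight_pos h3
    rw [← measurePotential_sourceMeasure S.green h.measurable, ← hρd]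
    have h5 : u x = (measurePotential Ω G ρ x).toReal := by
      simp only [Pi.zero_apply] at h1
      rw [← sub_mul] at h1
      have := (mul_eq_zero.1 h1).resolve_right h4.ne'
      linarith
    rw [h5, ENNReal.ofReal_toReal h2.ne]
  · rintro ⟨hm, hpos, hi, heq⟩
    refine ⟨hm, hpos, (integrable_congr (habs hpos)).2 hi, fun w hw => ?_⟩
    obtain ⟨hs, hρΩ, hρ⟩ := sourceMeasure_facts (lam := lam) S hμ hm hpos hi
    obtain ⟨B, hB0, hwm, hB⟩ := htest w hw
    obtain ⟨i1, i2, e⟩ := S.integral_greenOp_measure hρΩ hρ hwm hB0 hB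
    rw [← integral_sourceMeasure hlam.le hm hpos i1, e]
    refine integral_congr_ae ?_
    filter_upwards [heq, hpos] with x h1 h2
    rw [measurePotential_sourceMeasure S.green hm, ← h1, ENNReal.toReal_ofReal h2.le]

end WeakDual

/-! ### The minimal solution -/

section Minimal

variable {N : ℕ} {Ω : TopologicalSpace.Opens (Eucl N)} {L : Test Ω →ₗ[ℝ] L2 Ω} {s γ p : ℝ}
  {G : Eucl N → Eucl N → ℝ} {μ : Measure (Eucl N)} {lam : ℝ}

/-- `U ↦ 𝔾[U^p + λ μ]`. -/
def solutionMap (Ω : TopologicalSpace.Opens (Eucl N)) (G : Eucl N → Eucl N → ℝ) (p : ℝ)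
    (μ : Measure (Eucl N)) (lam : ℝ) (U : Eucl N → ℝ≥0∞) (x : Eucl N) : ℝ≥0∞ :=
  greenPotential Ω G (fun y => U y ^ p) x
    + ENNReal.ofReal lam * measurePotential Ω G (μ.restrict (Ω : Set (Eucl N))) x

/-- Monotone iteration started at `0`. -/
def monotoneIterate (Ω : TopologicalSpace.Opens (Eucl N)) (G : Eucl N → Eucl N → ℝ) (p : ℝ)
    (μ : Measure (Eucl N)) (lam : ℝ) : ℕ → Eucl N → ℝ≥0∞
  | 0 => fun _ => 0
  | n + 1 => solutionMap Ω G p μ lam (monotoneIterate Ω G p μ lam n)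

/-- The limit of the monotone iteration. -/
def iterateLimit (Ω : TopologicalSpace.Opens (Eucl N)) (G : Eucl N → Eucl N → ℝ) (p : ℝ)
    (μ : Measure (Eucl N)) (lam : ℝ) (x : Eucl N) : ℝ≥0∞ :=
  ⨆ n, monotoneIterate Ω G p μ lam n x

theorem solutionMap_mono_ae (hp : 0 ≤ p) {U W : Eucl N → ℝ≥0∞}
    (h : ∀ᵐ x ∂volume.restrict (Ω : Set (Eucl N)), U x ≤ W x) (x : Eucl N) :
    solutionMap Ω G p μ lam U x ≤ solutionMap Ω G p μ lam W x := by
  refine add_le_add (lintegral_mono_ae ?_) le_rfl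
  filter_upwards [h] with y hy
  gcongr

theorem monotone_monotoneIterate (hp : 0 ≤ p) : Monotone (monotoneIterate Ω G p μ lam) := by
  refine monotone_nat_of_le_succ fun n => ?_
  induction n with
  | zero => exact fun x => zero_le
  | succ n ih => exact fun x => solutionMap_mono_ae hp (Eventually.of_forall ih) x

theorem measurable_monotoneIterate (hG : IsGreenFunction L s γ G)
    [SFinite (μ.restrict (Ω : Set (Eucl N)))] (n : ℕ) :
    Measurable (monotoneIterate Ω G p μ lam n) := by
  induction n with
  | zero => exact measurable_const
  | succ n ih =>
    exact (measurable_greenPotential hG (ih.pow_const p)).add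
      ((measurable_measurePotential hG).const_mul _)

theorem measurable_iterateLimit (hG : IsGreenFunction L s γ G)
    [SFinite (μ.restrict (Ω : Set (Eucl N)))] : Measurable (iterateLimit Ω G p μ lam) :=
  Measurable.iSup fun n => measurable_monotoneIterate hG n

/-- Monotone convergence in [0, ∞], which holds at every point and needs no finiteness. -/
theorem iterateLimit_eq (hG : IsGreenFunction L s γ G) [SFinite (μ.restrict (Ω : Set (Eucl N)))]
    (hp : 0 < p) (x : Eucl N) :
    solutionMap Ω G p μ lam (iterateLimit Ω G p μ lam) x = iterateLimit Ω G p μ lam x := by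
  have hmono := monotone_monotoneIterate (Ω := Ω) (G := G) (μ := μ) (lam := lam) hp.le
  have h1 : ∀ y, iterateLimit Ω G p μ lam y ^ p
      = ⨆ n, monotoneIterate Ω G p μ lam n y ^ p := fun y =>
    (ENNReal.orderIsoRpow p hp).map_iSup _
  have h2 : greenPotential Ω G (fun y => iterateLimit Ω G p μ lam y ^ p) x
      = ⨆ n, greenPotential Ω G (fun y => monotoneIterate Ω G p μ lam n y ^ p) x := by
    unfold greenPotential
    rw [← lintegral_iSup]
    · simp only [h1, ENNReal.mul_iSup]
    · exact fun n => (measurable_kernel_left hG x).mul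
        ((measurable_monotoneIterate hG n).pow_const p)
    · intro i j hij y
      have := hmono hij y
      dsimp only
      gcongr
  calc solutionMap Ω G p μ lam (iterateLimit Ω G p μ lam) x
      = ⨆ n, monotoneIterate Ω G p μ lam (n + 1) x := by
        rw [solutionMap, h2, ENNReal.iSup_add]
        rfl
    _ = _ := (Monotone.iSup_nat_add (f := fun n => monotoneIterate Ω G p μ lam n x)
        (fun i j hij => hmono hij x) 1)

/-- Induction: each iterate stays below any supersolution. -/
theorem iterateLimit_le (hp : 0 ≤ p) {W : Eucl N → ℝ≥0∞}
    (hW : ∀ᵐ x ∂volume.restrict (Ω : Set (Eucl N)), solutionMap Ω G p μ lam W x ≤ W x) :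
    ∀ᵐ x ∂volume.restrict (Ω : Set (Eucl N)), iterateLimit Ω G p μ lam x ≤ W x := by
  have h : ∀ n, ∀ᵐ x ∂volume.restrict (Ω : Set (Eucl N)),
      monotoneIterate Ω G p μ lam n x ≤ W x := fun n => by
    induction n with
    | zero => exact Eventually.of_forall fun x => zero_le
    | succ n ih =>
      filter_upwards [hW] with x hx using (solutionMap_mono_ae hp ih x).trans hx
  filter_upwards [ae_all_iff.2 h] with x hx using iSup_le hx

theorem solutionMap_ofReal {u : Eucl N → ℝ}
    (hu : ∀ᵐ x ∂volume.restrict (Ω : Set (Eucl N)), 0 < u x) (x : Eucl N) :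
    solutionMap Ω G p μ lam (fun y => ENNReal.ofReal (u y)) x
      = greenPotential Ω G (fun y => ENNReal.ofReal (u y ^ p)) x
        + ENNReal.ofReal lam * measurePotential Ω G (μ.restrict (Ω : Set (Eucl N))) x := by
  rw [solutionMap, greenPotential_congr]
  filter_upwards [hu] with y hy
  exact ENNReal.ofReal_rpow_of_pos hy

/-- A multiple of a solution for a larger parameter is a supersolution. -/
theorem iterateLimit_le_mul (S : IsGreenDomain L s γ G) (hμ : IsUnitWeightedMeasure Ω γ μ)
    (hp : 1 ≤ p) (hlam : 0 < lam) {lam' : ℝ} (hlam' : lam ≤ lam') {w : Eucl N → ℝ}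
    (hw : IsPositiveWeakDualSolution Ω γ p G μ lam' w) :
    ∀ᵐ x ∂volume.restrict (Ω : Set (Eucl N)),
      iterateLimit Ω G p μ lam x ≤ ENNReal.ofReal (lam / lam' * w x) := by
  have h0 : 0 < lam' := hlam.trans_le hlam'
  obtain ⟨hm, hpos, -, heq⟩ := (isPositiveWeakDualSolution_iff S hμ h0).1 hw
  set θ := lam / lam' with hθ
  have hθ0 : 0 < θ := by positivity
  have hθ1 : θ ≤ 1 := (div_le_one h0).2 hlam'
  -- For θ ≤ 1 the nonlinear term scales down at least as fast as the function, so θw is a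
  -- supersolution for the parameter θλ' = λ.
  have hθp : θ ^ p ≤ θ := by
    simpa using Real.rpow_le_rpow_of_exponent_ge hθ0 hθ1 hp
  have hwm : AEMeasurable (fun y => ENNReal.ofReal (w y ^ p))
      (volume.restrict (Ω : Set (Eucl N))) := (hm.aemeasurable.pow_const p).ennreal_ofReal
  have hθw : ∀ᵐ x ∂volume.restrict (Ω : Set (Eucl N)), 0 < θ * w x := by
    filter_upwards [hpos] with x hx
    positivity
  refine iterateLimit_le (by linarith) ?_
  filter_upwards [heq] with x hx
  rw [solutionMap_ofReal hθw, ENNReal.ofReal_mul hθ0.le, hx, mul_add, mul_greenPotential S.green hwm,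
    ← mul_assoc, ← ENNReal.ofReal_mul hθ0.le]
  refine add_le_add (lintegral_mono_ae ?_) (le_of_eq ?_)
  · filter_upwards [hpos] with y hy
    rw [Real.mul_rpow hθ0.le hy.le, ENNReal.ofReal_mul (by positivity), mul_left_comm]
    gcongr
  · congr 2
    rw [hθ]
    field_simp

theorem isPositiveWeakDualSolution_iterateLimit (S : IsGreenDomain L s γ G)
    (hμ : IsUnitWeightedMeasure Ω γ μ) (hp : 1 ≤ p) (hlam : 0 < lam) {lam' : ℝ}
    (hlam' : lam ≤ lam') {w : Eucl N → ℝ} (hw : IsPositiveWeakDualSolution Ω γ p G μ lam' w) :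
    IsPositiveWeakDualSolution Ω γ p G μ lam fun x => (iterateLimit Ω G p μ lam x).toReal := by
  have h0 : 0 < lam' := hlam.trans_le hlam'
  have hs := sFinite_of_unitWeighted S hμ
  have hΩ : MeasurableSet (Ω : Set (Eucl N)) := Ω.isOpen.measurableSet
  obtain ⟨hm, hpos, hi, -⟩ := (isPositiveWeakDualSolution_iff S hμ h0).1 hw
  set U := iterateLimit Ω G p μ lam with hU
  have hp0 : 0 < p := by linarith
  have hUm : Measurable U := measurable_iterateLimit S.green
  have hUeq : ∀ x, solutionMap Ω G p μ lam U x = U x := iterateLimit_eq S.green hp0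
  have hle := iterateLimit_le_mul S hμ hp hlam hlam' hw
  have hfin : ∀ᵐ x ∂volume.restrict (Ω : Set (Eucl N)), U x < ∞ := by
    filter_upwards [hle] with x hx using hx.trans_lt ENNReal.ofReal_lt_top
  have hUpos : ∀ᵐ x ∂volume.restrict (Ω : Set (Eucl N)), 0 < (U x).toReal := by
    filter_upwards [hfin, measurePotential_pos S hμ] with x h1 h2
    refine ENNReal.toReal_pos ?_ h1.ne
    rw [← hUeq x]
    exact (lt_of_lt_of_le (ENNReal.mul_pos (by simpa using hlam) h2.ne') le_add_self).ne'
  refine (isPositiveWeakDualSolution_iff S hμ hlam).2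
    ⟨hUm.ennreal_toReal.aestronglyMeasurable, hUpos, ?_, ?_⟩
  · have hbm := measurable_bdist (Ω := Ω)
    refine hi.mono' ((hUm.ennreal_toReal.pow_const p).mul
      (hbm.pow_const γ)).aestronglyMeasurable ?_
    filter_upwards [hle, hUpos, hpos, ae_restrict_mem hΩ] with x h1 h2 h3 h4
    have h5 := S.weight_pos h4
    rw [Real.norm_of_nonneg (by positivity)]
    have h6 : (U x).toReal ≤ w x := by
      refine ENNReal.toReal_le_of_le_ofReal h3.le (h1.trans (ENNReal.ofReal_le_ofReal ?_))
      exact mul_le_of_le_one_left h3.le ((div_le_one h0).2 hlam')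
    gcongr
  · have he : ∀ᵐ x ∂volume.restrict (Ω : Set (Eucl N)), ENNReal.ofReal (U x).toReal = U x := by
      filter_upwards [hfin] with x hx using ENNReal.ofReal_toReal hx.ne
    filter_upwards [he] with x hx
    rw [hx, ← solutionMap_ofReal hUpos, ← hUeq x, solutionMap, solutionMap]
    congr 1
    refine greenPotential_congr ?_ x
    filter_upwards [he] with y hy
    rw [hy]

theorem exists_isMinimalSolution (S : IsGreenDomain L s γ G)
    (hμ : IsUnitWeightedMeasure Ω γ μ) (hp : 1 ≤ p) (hlam : 0 < lam) {lam' : ℝ}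
    (hlam' : lam ≤ lam') {w : Eucl N → ℝ} (hw : IsPositiveWeakDualSolution Ω γ p G μ lam' w) :
    ∃ u, IsMinimalSolution Ω γ p G μ lam u := by
  refine ⟨_, isPositiveWeakDualSolution_iterateLimit S hμ hp hlam hlam' hw, fun w' hw' => ?_⟩
  -- With equal parameters θ = 1, and the comparison gives minimality.
  have h := iterateLimit_le_mul S hμ hp hlam le_rfl hw'
  filter_upwards [h, hw'.pos] with x h1 h2
  rw [div_self hlam.ne', one_mul] at h1
  exact ENNReal.toReal_le_of_le_ofReal h2.le h1

/-- Below `λ^*`, the linearised equation at the minimal solution has a strict supersolution. -/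
theorem IsMinimalSolution.exists_supersolution (S : IsGreenDomain L s γ G)
    (hμ : IsUnitWeightedMeasure Ω γ μ) (hp : 1 < p) (hlam : 0 < lam) {lam' : ℝ}
    (hlam' : lam < lam') {u w : Eucl N → ℝ} (hu : IsMinimalSolution Ω γ p G μ lam u)
    (hw : IsPositiveWeakDualSolution Ω γ p G μ lam' w) :
    ∃ ε > 0, ∃ z : Eucl N → ℝ,
      AEStronglyMeasurable z (volume.restrict (Ω : Set (Eucl N))) ∧
      (∀ᵐ x ∂volume.restrict (Ω : Set (Eucl N)), 0 < z x) ∧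
      ∀ᵐ x ∂volume.restrict (Ω : Set (Eucl N)), ENNReal.ofReal (1 + ε)
        * greenPotential Ω G (fun y => ENNReal.ofReal (p * u y ^ (p - 1) * z y)) x
        ≤ ENNReal.ofReal (z x) := by
  have h0 : 0 < lam' := hlam.trans hlam'
  have hθ0 : 0 < lam / lam' := by positivity
  have hθ1 : lam / lam' < 1 := (div_lt_one h0).2 hlam'
  obtain ⟨ε, hε, hconv⟩ := rpow_sub_rpow_ge hp hθ0 hθ1
  obtain ⟨hum, hupos, -, hueq⟩ := (isPositiveWeakDualSolution_iff S hμ hlam).1 hu.1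
  obtain ⟨hwm, hwpos, -, hweq⟩ := (isPositiveWeakDualSolution_iff S hμ h0).1 hw
  have hle : ∀ᵐ x ∂volume.restrict (Ω : Set (Eucl N)), u x ≤ lam / lam' * w x := by
    filter_upwards [hu.2 _ (isPositiveWeakDualSolution_iterateLimit S hμ hp.le hlam hlam'.le hw),
      iterateLimit_le_mul S hμ hp.le hlam hlam'.le hw, hwpos] with x h1 h2 h3
    exact h1.trans (ENNReal.toReal_le_of_le_ofReal (by positivity) h2)
  have hzpos : ∀ᵐ x ∂volume.restrict (Ω : Set (Eucl N)), 0 < w x - u x := by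
    filter_upwards [hle, hwpos] with x h1 h2
    have : lam / lam' * w x < 1 * w x := by gcongr
    linarith
  refine ⟨ε, hε, fun x => w x - u x, hwm.sub hum, hzpos, ?_⟩
  have m1 : AEMeasurable (fun y => ENNReal.ofReal (u y ^ p))
      (volume.restrict (Ω : Set (Eucl N))) := (hum.aemeasurable.pow_const p).ennreal_ofReal
  have m2 : AEMeasurable (fun y => ENNReal.ofReal (p * u y ^ (p - 1) * (w y - u y)))
      (volume.restrict (Ω : Set (Eucl N))) :=
    (((hum.aemeasurable.pow_const (p - 1)).const_mul p).mul
      (hwm.aemeasurable.sub hum.aemeasurable)).ennreal_ofReal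
  filter_upwards [hueq, hweq, hupos] with x h1 h2 h3
  -- Subtract the two fixed-point equations: the measure terms compare since λ ≤ λ', and the rest is
  -- the secant inequality for u ≤ θw under the kernel.
  rw [ENNReal.ofReal_sub _ h3.le]
  refine ENNReal.le_sub_of_add_le_right ENNReal.ofReal_ne_top ?_
  rw [h1, h2, ← add_assoc]
  refine add_le_add ?_ (by gcongr)
  have m3 : AEMeasurable (fun y => ENNReal.ofReal (1 + ε) * (greenKernel Ω G x y
      * ENNReal.ofReal (p * u y ^ (p - 1) * (w y - u y)))) (volume.restrict (Ω : Set (Eucl N))) :=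
    ((measurable_kernel_left S.green x).aemeasurable.mul m2).const_mul _
  rw [mul_greenPotential S.green m2, greenPotential, ← lintegral_add_left' m3]
  refine lintegral_mono_ae ?_
  filter_upwards [hle, hupos, hzpos] with y h4 h5 h6
  rw [mul_left_comm, ← mul_add, ← ENNReal.ofReal_mul (by positivity),
    ← ENNReal.ofReal_add (by positivity) (by positivity)]
  gcongr
  have := hconv (u y) (w y) h5 h4
  linarith

end Minimal

/-! ### Stability -/

section Stability

variable {N : ℕ} {Ω : TopologicalSpace.Opens (Eucl N)} {L : Test Ω →ₗ[ℝ] L2 Ω} {s γ p : ℝ}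
  {G : Eucl N → Eucl N → ℝ} {H : Type*} [NormedAddCommGroup H] [InnerProductSpace ℝ H]
  [CompleteSpace H] {J : H →L[ℝ] L2 Ω}

/-- A strict supersolution of the linearised equation yields coercivity of its form. -/
theorem IsGreenSetting.integral_le_of_supersolution (S : IsGreenSetting L s γ G J)
    {u z : Eucl N → ℝ} {ε : ℝ} (hε : 0 < ε) (A : IsAdmissible J p u)
    (hz : AEStronglyMeasurable z (volume.restrict (Ω : Set (Eucl N))))
    (hzpos : ∀ᵐ x ∂volume.restrict (Ω : Set (Eucl N)), 0 < z x)
    (hsup : ∀ᵐ x ∂volume.restrict (Ω : Set (Eucl N)), ENNReal.ofReal (1 + ε)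
      * greenPotential Ω G (fun y => ENNReal.ofReal (p * u y ^ (p - 1) * z y)) x
      ≤ ENNReal.ofReal (z x)) (h : H) :
    ∫ x in (Ω : Set (Eucl N)), p * u x ^ (p - 1) * J h x ^ 2 ≤ (1 + ε)⁻¹ * ‖h‖ ^ 2 := by
  set ν := volume.restrict (Ω : Set (Eucl N)) with hν
  have hp := A.one_lt
  have hp0 : 0 < p := by linarith
  have hum : AEMeasurable u ν := A.meas.aemeasurable
  have hJm : AEMeasurable (J h) ν := (Lp.aestronglyMeasurable (J h)).aemeasurable
  have hVm : AEMeasurable (fun x => p * u x ^ (p - 1)) ν := (hum.pow_const (p - 1)).const_mul p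
  have hVi : Integrable (fun x => p * u x ^ (p - 1) * J h x ^ 2) ν := by
    refine ((A.int h).const_mul p).mono' (hVm.mul (hJm.pow_const 2)).aestronglyMeasurable ?_
    filter_upwards [A.pos] with x hx
    rw [Real.norm_of_nonneg (by positivity), mul_assoc]
    gcongr
    exact le_add_of_nonneg_right (by positivity)
  have hset : ∀ n : ℕ, NullMeasurableSet {x | p * u x ^ (p - 1) ≤ n} ν := fun n =>
    nullMeasurableSet_le hVm aemeasurable_const
  let I : ℕ → ℝ := fun n =>
    ∫ x, (if p * u x ^ (p - 1) ≤ n then p * u x ^ (p - 1) * J h x ^ 2 else 0) ∂ν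
  have hIi : ∀ n : ℕ, Integrable
      (fun x => if p * u x ^ (p - 1) ≤ n then p * u x ^ (p - 1) * J h x ^ 2 else 0) ν :=
    fun n => hVi.indicator₀ (hset n)
  have hI0 : ∀ n : ℕ, ∀ᵐ x ∂ν,
      0 ≤ if p * u x ^ (p - 1) ≤ (n : ℝ) then p * u x ^ (p - 1) * J h x ^ 2 else 0 := fun n => by
    filter_upwards [A.pos] with x hx
    split_ifs
    · positivity
    · exact le_rfl
  have hlim : Tendsto I atTop (𝓝 (∫ x, p * u x ^ (p - 1) * J h x ^ 2 ∂ν)) := by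
    refine tendsto_integral_of_dominated_convergence
      (fun x => |p * u x ^ (p - 1) * J h x ^ 2|) (fun n => (hIi n).aestronglyMeasurable)
      hVi.abs ?_ ?_
    · refine fun n => Eventually.of_forall fun x => ?_
      split_ifs
      · rw [Real.norm_eq_abs]
      · rw [norm_zero]; positivity
    · refine Eventually.of_forall fun x => ?_
      obtain ⟨n₀, hn₀⟩ := exists_nat_ge (p * u x ^ (p - 1))
      refine tendsto_const_nhds.congr' ?_
      filter_upwards [eventually_ge_atTop n₀] with n hn
      rw [if_pos (hn₀.trans (by exact_mod_cast hn))]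
  refine le_of_tendsto' hlim fun n => ?_
  -- With V = p u^(p-1), f is V h cut off where V > n, so that it lies in L². Schur's test with
  -- weight V z gives ∫ |f| 𝔾[|f|] ≤ (1+ε)⁻¹ ∫ f²/V, which is (1+ε)⁻¹ I n.
  let f : Eucl N → ℝ := fun x => if p * u x ^ (p - 1) ≤ n then p * u x ^ (p - 1) * J h x else 0
  have hfm : AEStronglyMeasurable f ν :=
    (hVm.mul hJm).aestronglyMeasurable.indicator₀ (hset n)
  have hf2 : MemLp f 2 ν := by
    refine MemLp.of_le_mul (c := n) (Lp.memLp (J h)) hfm ?_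
    filter_upwards [A.pos] with x hx
    simp only [f]
    split_ifs with h1
    · rw [norm_mul, Real.norm_of_nonneg (by positivity : 0 ≤ p * u x ^ (p - 1))]
      gcongr
    · rw [norm_zero]; positivity
  have hωm : AEMeasurable (fun x => ENNReal.ofReal (p * u x ^ (p - 1) * z x)) ν :=
    (hVm.mul hz.aemeasurable).ennreal_ofReal
  have hω0 : ∀ᵐ x ∂ν, ENNReal.ofReal (p * u x ^ (p - 1) * z x) ≠ 0
      ∧ ENNReal.ofReal (p * u x ^ (p - 1) * z x) ≠ ∞ := by
    filter_upwards [A.pos, hzpos] with x h1 h2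
    have : 0 < p * u x ^ (p - 1) * z x := by positivity
    exact ⟨by simpa using this, ENNReal.ofReal_ne_top⟩
  have hI : 0 ≤ I n := integral_nonneg_of_ae (hI0 n)
  have hM : ∫⁻ x, ‖f x‖ₑ * greenPotential Ω G (fun y => ‖f y‖ₑ) x ∂ν
      ≤ ENNReal.ofReal ((1 + ε)⁻¹ * I n) := by
    calc ∫⁻ x, ‖f x‖ₑ * greenPotential Ω G (fun y => ‖f y‖ₑ) x ∂ν
        ≤ ∫⁻ x, ‖f x‖ₑ ^ 2 / ENNReal.ofReal (p * u x ^ (p - 1) * z x)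
            * greenPotential Ω G (fun y => ENNReal.ofReal (p * u y ^ (p - 1) * z y)) x ∂ν :=
          schur_test S.green hfm.enorm hωm hω0
      _ ≤ ∫⁻ x, ENNReal.ofReal ((1 + ε)⁻¹ *
            if p * u x ^ (p - 1) ≤ n then p * u x ^ (p - 1) * J h x ^ 2 else 0) ∂ν := by
          refine lintegral_mono_ae ?_
          filter_upwards [A.pos, hzpos, hsup] with x h1 h2 h3
          have hV : 0 < p * u x ^ (p - 1) * z x := by positivity
          have h4 : greenPotential Ω G (fun y => ENNReal.ofReal (p * u y ^ (p - 1) * z y)) x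
              ≤ ENNReal.ofReal (z x / (1 + ε)) := by
            rw [ENNReal.ofReal_div_of_pos (by positivity), ENNReal.le_div_iff_mul_le
              (Or.inl (by simp; positivity)) (Or.inl ENNReal.ofReal_ne_top), mul_comm]
            exact h3
          refine (mul_le_mul' le_rfl h4).trans (le_of_eq ?_)
          rw [Real.enorm_eq_ofReal_abs, ← ENNReal.ofReal_pow (abs_nonneg _), sq_abs,
            ← ENNReal.ofReal_div_of_pos hV, ← ENNReal.ofReal_mul (by positivity)]
          congr 1
          simp only [f]
          have hu1 : 0 < u x ^ (p - 1) := by positivity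
          split_ifs
          · field_simp
          · simp
      _ = ENNReal.ofReal ((1 + ε)⁻¹ * I n) := by
          rw [← integral_const_mul, ofReal_integral_eq_lintegral_ofReal ((hIi n).const_mul _)]
          filter_upwards [hI0 n] with x hx
          exact mul_nonneg (by positivity) hx
  -- Duality gives I² ≤ (1+ε)⁻¹ I ‖h‖², and I cancels.
  have h1 := S.sq_integral_le hf2 h (by positivity) hM
  have h2 : ∫ x, f x * J h x ∂ν = I n := by
    refine integral_congr_ae (Eventually.of_forall fun x => ?_)
    simp only [f]
    split_ifs
    · ring
    · ring
  rw [h2] at h1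
  rcases eq_or_lt_of_le hI with h3 | h3
  · rw [← h3]; positivity
  · refine le_of_mul_le_mul_left ?_ h3
    calc I n * I n = I n ^ 2 := (sq _).symm
      _ ≤ (1 + ε)⁻¹ * I n * ‖h‖ ^ 2 := h1
      _ = _ := by ring

end Stability

/-! ### Existence of a nontrivial variational solution -/

theorem exists_testToL2_ne_zero {N : ℕ} {Ω : TopologicalSpace.Opens (Eucl N)}
    (hne : (Ω : Set (Eucl N)).Nonempty) : ∃ φ : Test Ω, testToL2 Ω φ ≠ 0 := by
  obtain ⟨x, hx⟩ := hne
  obtain ⟨f, hfs, hfc, hfd, -, hfx⟩ :=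
    exists_contDiff_tsupport_subset (n := ⊤) (Ω.isOpen.mem_nhds hx)
  let φ : Test Ω := ⟨f, hfd, hfc, hfs⟩
  refine ⟨φ, fun h0 => ?_⟩
  have h1 := testToL2_ae φ
  rw [h0] at h1
  have h2 : ∀ᵐ y ∂volume.restrict (Ω : Set (Eucl N)), f y = 0 := by
    filter_upwards [h1, Lp.coeFn_zero ℝ 2 (volume.restrict (Ω : Set (Eucl N)))] with y h3 h4
    rw [h4] at h3
    exact h3.symm
  have h3 : IsOpen ({y | f y ≠ 0} ∩ Ω) := (isOpen_ne_fun hfd.continuous continuous_const).inter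
    Ω.isOpen
  have h4 := h3.measure_pos volume ⟨x, by simp [hfx], hx⟩
  rw [ae_iff, Measure.restrict_apply₀' Ω.isOpen.measurableSet.nullMeasurableSet] at h2
  exact h4.ne' h2

variable {N : ℕ} {Ω : TopologicalSpace.Opens (Eucl N)} {L : Test Ω →ₗ[ℝ] L2 Ω} {s γ p : ℝ}
  {G : Eucl N → Eucl N → ℝ}

/-- A positive function with a strict supersolution of its linearised equation admits a nontrivial
variational solution of the shifted equation. -/
theorem IsGreenDomain.exists_variationalSolution (D : IsGreenDomain L s γ G)
    (hL : IsPositiveSymmetric L) (hN : 2 * s < N) (hne : (Ω : Set (Eucl N)).Nonempty)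
    (hp : 1 < p) (hpS : p * (N + γ - 2 * s) < N + γ) {u z : Eucl N → ℝ} {ε : ℝ} (hε : 0 < ε)
    (hum : AEStronglyMeasurable u (volume.restrict (Ω : Set (Eucl N))))
    (hu : ∀ᵐ x ∂volume.restrict (Ω : Set (Eucl N)), 0 < u x)
    (hui : Integrable (fun x => u x ^ p * bdist Ω x ^ γ) (volume.restrict (Ω : Set (Eucl N))))
    (hz : AEStronglyMeasurable z (volume.restrict (Ω : Set (Eucl N))))
    (hzpos : ∀ᵐ x ∂volume.restrict (Ω : Set (Eucl N)), 0 < z x)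
    (hsup : ∀ᵐ x ∂volume.restrict (Ω : Set (Eucl N)), ENNReal.ofReal (1 + ε)
      * greenPotential Ω G (fun y => ENNReal.ofReal (p * u y ^ (p - 1) * z y)) x
      ≤ ENNReal.ofReal (z x)) :
    ∃ v : L2 Ω, v ≠ 0 ∧
      IsVariationalSolution L (fun x t => (u x + max t 0) ^ p - u x ^ p) v := by
  obtain ⟨A, hA', hA⟩ := D.green.exists_lintegral_kernel_le D.s_pos D.γ_pos.le D.dim_pos D.frontier
    D.bounded
  have hA0 : 0 ≤ A.toReal := ENNReal.toReal_nonneg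
  have hnorm := norm_testToL2_sq_le hL D.green D.dim_pos hA0 fun x hx => by
    rw [ENNReal.ofReal_toReal hA'.ne]
    exact hA x hx
  obtain ⟨H, _, _, _, J, hmem, hsurj, hinner⟩ :=
    exists_energySpace hL (by positivity : 0 ≤ 2 * A.toReal) hnorm
  have S : IsGreenSetting L s γ G J := ⟨D.green, ⟨hmem, hsurj, hinner⟩, D.dim_pos, D.s_pos,
    D.γ_pos, hN, D.frontier, D.bounded⟩
  have Ad := S.isAdmissible hp hpS hum hu hui
  obtain ⟨v, hv0, hv⟩ := Ad.exists_critical (S.exists_integral_nlWeight_bound hp hpS hum hu hui)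
    (S.exists_tendsto_nlWeight hp hpS hum hu hui)
    (fun h hh => by
      refine (S.integral_le_of_supersolution hε Ad hz hzpos hsup h).trans_lt ?_
      have h1 : 0 < ‖h‖ ^ 2 := by have := norm_pos_iff.2 hh; positivity
      have h2 : (1 + ε)⁻¹ < 1 := inv_lt_one_of_one_lt₀ (by linarith)
      nlinarith)
    (by
      obtain ⟨φ, hφ⟩ := exists_testToL2_ne_zero hne
      obtain ⟨h, hh⟩ := hsurj _ (testToL2_mem_formDomain (L := L) φ)
      exact ⟨h, hh ▸ hφ⟩)
  refine ⟨J v, fun h0 => hv0 (S.energy.injective (by rw [h0, map_zero])), hmem v,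
    fun ξ hξ => ?_⟩
  obtain ⟨k, rfl⟩ := hsurj ξ hξ
  exact ⟨Ad.integrable_nl_mul v k, by rw [hinner, ← hv k]; rfl⟩

end GreenSemilinear

end

/-! ### The main theorem -/

theorem theorem7p6 (N : ℕ) (Ω : TopologicalSpace.Opens (GreenSemilinear.Eucl N))
    (hΩ : GreenSemilinear.IsBoundedC2Domain Ω)
    (s γ : ℝ) (hs0 : 0 < s) (hs1 : s ≤ 1) (hγ0 : 0 < γ) (hγ1 : γ ≤ 1)
    (hN : 2 * s < N) (hγs : s - 1 / 2 ≤ γ) (hNs : GreenSemilinear.Nsγ s γ ≤ N)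
    (L : GreenSemilinear.Test Ω →ₗ[ℝ] GreenSemilinear.L2 Ω)
    (hL : GreenSemilinear.IsPositiveSymmetric L)
    (hH : GreenSemilinear.formDomain L = GreenSemilinear.Hs00 Ω s)
    (G : GreenSemilinear.Eucl N → GreenSemilinear.Eucl N → ℝ)
    (hG : GreenSemilinear.IsGreenFunction L s γ G)
    (p : ℝ) (hp1 : 1 < p) (hp : p < GreenSemilinear.pStar N s γ)
    (μ : MeasureTheory.Measure (GreenSemilinear.Eucl N))
    (hμ : GreenSemilinear.IsUnitWeightedMeasure Ω γ μ)
    (lam : ℝ) (hlam0 : 0 < lam) (hlam : (lam : EReal) < GreenSemilinear.lamStar Ω γ p G μ) :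
    (∃ u, GreenSemilinear.IsMinimalSolution Ω γ p G μ lam u) ∧
      ∀ u, GreenSemilinear.IsMinimalSolution Ω γ p G μ lam u →
        ∃ v : GreenSemilinear.L2 Ω, v ≠ 0 ∧
          GreenSemilinear.IsVariationalSolution L
            (fun x t => (u x + max t 0) ^ p - u x ^ p) v := by
  have hdim : 0 < N := by
    have : (0 : ℝ) < N := by linarith
    exact_mod_cast this
  have hne := hΩ.connected.nonempty
  have D : GreenSemilinear.IsGreenDomain L s γ G := ⟨hG, hdim, hs0, hγ0,
    GreenSemilinear.frontier_nonempty hdim hne hΩ.bounded, hΩ.bounded⟩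
  -- The supremum supplies a solution at some λ' strictly above λ; the strict gap is the source of
  -- both the minimal solution and its stability.
  obtain ⟨_, ⟨lam', ⟨-, w, hw⟩, rfl⟩, hlt⟩ := lt_sSup_iff.1 hlam
  have hlt' : lam < lam' := EReal.coe_lt_coe_iff.1 hlt
  refine ⟨GreenSemilinear.exists_isMinimalSolution D hμ hp1.le hlam0 hlt'.le hw, fun u hu => ?_⟩
  obtain ⟨hum, hupos, hui, -⟩ :=
    (GreenSemilinear.isPositiveWeakDualSolution_iff D hμ hlam0).1 hu.1
  obtain ⟨ε, hε, z, hz, hzpos, hsup⟩ := hu.exists_supersolution D hμ hp1 hlam0 hlt' hw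
  refine D.exists_variationalSolution hL hN hne hp1 ?_ hε hum hupos hui hz hzpos hsup
  rw [GreenSemilinear.pStar, lt_div_iff₀ (by linarith)] at hp
  exact hp
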